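/- Let $d,n\ge 1$ be integers, let $\xi_1,\dots,\xi_d$ be the complex $d$-th roots of unity, and let $R=\mathbb{C}[u^{\pm1},v]$. **Algebras.** For $m\ge 1$ let $\mathcal{H}_m$ be the $R$-algebra generated by $T_1,\dots,T_{m-1}$ with relations $T_iT_j=T_jT_i$ for $|i-j|>1$, $T_iT_{i+1}T_i=T_{i+1}T_iT_{i+1}$ and $T_i^2=u^2+vT_i$ (and $\mathcal{H}_0=R$). Let $Y_{d,m}$ be the $R$-algebra generated by $g_1,\dots,g_{m-1},t_1,\dots,t_m$ with relations $g_ig_j=g_jg_i$ for $|i-j|>1$, $g_ig_{i+1}g_i=g_{i+1}g_ig_{i+1}$, $t_it_j=t_jt_i$, $g_it_j=t_{s_i(j)}g_i$, $t_j^d=1$ and $g_i^2=u^2+v\,e_ig_i$, where $s_i=(i,i+1)$ and $e_i=\frac1d\sum_{0\le s\le d-1}t_i^st_{i+1}^{-s}$. For $w\in\mathfrak{S}_m$ with reduced expression $s_{i_1}\cdots s_{i_r}$ put $\widetilde T_w=u^{-r}T_{i_1}\cdots T_{i_r}$ and $\widetilde g_w=u^{-r}g_{i_1}\cdots g_{i_r}$.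 **Compositions and characters.** Let $\operatorname{Comp}_d(m)$ be the set of $\mu=(\mu_1,\dots,\mu_d)\in\mathbb{Z}_{\ge0}^d$ with $\sum_a\mu_a=m$; for $1\le a\le d$ let $\mu^{[a]}\in\operatorname{Comp}_d(m+1)$ be obtained from $\mu$ by adding $1$ to $\mu_a$. Let $\mathfrak{S}^\mu\simeq\mathfrak{S}_{\mu_1}\times\dots\times\mathfrak{S}_{\mu_d}$ be the Young subgroup of $\mathfrak{S}_m$ preserving the consecutive blocks of sizes $\mu_1,\dots,\mu_d$, and let $\mathcal{H}^\mu\simeq\mathcal{H}_{\mu_1}\otimes\dots\otimes\mathcal{H}_{\mu_d}$ be the subalgebra of $\mathcal{H}_m$ generated by the $T_i$ with $s_i\in\mathfrak{S}^\mu$; it is free over $R$ with basis $\{\widetilde T_w : w\in\mathfrak{S}^\mu\}$. The natural embedding $\mathcal{H}^\mu\hookrightarrow\mathcal{H}^{\mu^{[a]}}$ is $x_1\otimes\dots\otimes x_d\mapsto x_1\otimes\dots\otimes x_d$. Let $\chi_1^\mu,\dots,\chi_{m_\mu}^\mu$ be the complex characters $\chi$ of $(\mathbb{Z}/d\mathbb{Z})^m=\langle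 t_1,\dots,t_m\rangle$ such that, for every $a$, exactly $\mu_a$ of the values $\chi(t_1),\dots,\chi(t_m)$ equal $\xi_a$; here $\chi_1^\mu$ is the one whose values are $\mu_1$ times $\xi_1$, then $\mu_2$ times $\xi_2$, and so on. The group $\mathfrak{S}_m$ acts on characters by $w(\chi)(t_i)=\chi(t_{w^{-1}(i)})$, and $\pi_{k,\mu}$ is the element of minimal length in $\mathfrak{S}_m$ with $\pi_{k,\mu}(\chi_1^\mu)=\chi_k^\mu$. Put $E_\chi=\prod_{i=1}^m\frac1d\sum_{0\le s\le d-1}\chi(t_i)^st_i^{-s}\in Y_{d,m}$. **Isomorphisms.** Let $$\Phi_m:\bigoplus_{\mu\in\operatorname{Comp}_d(m)}\operatorname{Mat}_{m_\mu}(\mathcal{H}^\mu)\to Y_{d,m},\qquad \Phi_m(\widetilde T_w\,\mathrm{M}_{i,j})=E_{\chi_i^\mu}\,\widetilde g_{\pi_{i,\mu}w\pi_{j,\mu}^{-1}}\,E_{\chi_j^\mu}\quad(w\in\mathfrak{S}^\mu,\ 1\le i,j\le m_\mu),$$ where $\mathrm{M}_{i,j}$ is the elementary matrix. It is an isomorphism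 of $R$-algebras, whose inverse $\Psi_m$ is the linear map with $\Psi_m(E_{\chi_k^\mu}\widetilde g_w)=\widetilde T_{\pi_{k,\mu}^{-1}w\pi_{j,\mu}}\mathrm{M}_{k,j}$ for $w\in\mathfrak{S}_m$, where $j$ is determined by $w(\chi_j^\mu)=\chi_k^\mu$. **Proposition.** The map $Y_{d,n}\to Y_{d,n+1}$ with $g_i\mapsto g_i$, $t_j\mapsto t_j$ is injective, and the embedding $$\iota=\Psi_{n+1}\circ(Y_{d,n}\subset Y_{d,n+1})\circ\Phi_n:\ \bigoplus_{\mu\in\operatorname{Comp}_d(n)}\operatorname{Mat}_{m_\mu}(\mathcal{H}^\mu)\to\bigoplus_{\nu\in\operatorname{Comp}_d(n+1)}\operatorname{Mat}_{m_\nu}(\mathcal{H}^\nu)$$ is given by $\iota=\bigoplus_{\mu\in\operatorname{Comp}_d(n)}\iota_\mu$ (that is, $\iota$ sends $(X_\mu)_\mu$ to $\sum_\mu\iota_\mu(X_\mu)$), where the $\iota_\mu$ are the injective morphisms of (not necessarily unital) $R$-algebras $$\iota_\mu:\operatorname{Mat}_{m_\mu}(\mathcal{H}^\mu)\to\bigoplus_{1\le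 a\le d}\operatorname{Mat}_{m_{\mu^{[a]}}}(\mathcal{H}^{\mu^{[a]}}),\qquad x\,\mathrm{M}_{i,j}\mapsto\sum_{1\le a\le d}x\,\mathrm{M}_{i_a,j_a}\qquad(x\in\mathcal{H}^\mu,\ 1\le i,j\le m_\mu).$$ On the right, $x$ is viewed in $\mathcal{H}^{\mu^{[a]}}$ through the natural embedding, and $k_a$ is the index such that $\chi_{k_a}^{\mu^{[a]}}(t_i)=\chi_k^\mu(t_i)$ for $1\le i\le n$ and $\chi_{k_a}^{\mu^{[a]}}(t_{n+1})=\xi_a$. -/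

import Mathlib

noncomputable section

namespace YokonumaHecke

/-! ## The ground ring -/

/-- The ground ring `ℂ[u^{±1}, v]`, realised as `ℂ[u^{±1}][v]`. -/
abbrev GroundRing : Type := Polynomial (LaurentPolynomial ℂ)

/-- The invertible indeterminate `u`. -/
def u : GroundRing := Polynomial.C (LaurentPolynomial.T 1)

/-- The inverse `u⁻¹`. -/
def uInv : GroundRing := Polynomial.C (LaurentPolynomial.T (-1))

/-- The indeterminate `v`. -/
def v : GroundRing := Polynomial.X

/-- The scalar `1 / d`. -/
def oneOver (d : ℕ) : GroundRing := algebraMap ℂ GroundRing ((d : ℂ)⁻¹)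

/-! ## The symmetric group and reduced expressions

The letters `1, …, n` are the elements of `Fin n` (shifted by one), and the indices
`1, …, n - 1` of the adjacent transpositions are the elements of `Fin (n - 1)` (shifted by one). -/

/-- The smaller letter moved by the adjacent transposition of index `i`. -/
def lo {n : ℕ} (i : Fin (n - 1)) : Fin n := ⟨i, by omega⟩

/-- The larger letter moved by the adjacent transposition of index `i`. -/
def hi {n : ℕ} (i : Fin (n - 1)) : Fin n := ⟨i + 1, by omega⟩

/-- The adjacent transposition `s_i = (i, i + 1)`. -/
def simpleRefl {n : ℕ} (i : Fin (n - 1)) : Equiv.Perm (Fin n) := Equiv.swap (lo i) (hi i)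

/-- The permutation expressed by a word in the adjacent transpositions. -/
def wordProd {n : ℕ} (l : List (Fin (n - 1))) : Equiv.Perm (Fin n) := (l.map simpleRefl).prod

/-- `l` is a reduced expression of `w`: an expression of `w` of minimal length. -/
def IsReduced {n : ℕ} (l : List (Fin (n - 1))) (w : Equiv.Perm (Fin n)) : Prop :=
  wordProd l = w ∧ ∀ l' : List (Fin (n - 1)), wordProd l' = w → l.length ≤ l'.length

theorem exists_wordProd {n : ℕ} (w : Equiv.Perm (Fin n)) :
    ∃ l : List (Fin (n - 1)), wordProd l = w := by
  cases n with
  | zero => exact ⟨[], Subsingleton.elim _ _⟩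
  | succ m =>
    have hw : w ∈ Submonoid.closure
        (Set.range fun i : Fin m => Equiv.swap i.castSucc i.succ) := by
      rw [Equiv.Perm.mclosure_swap_castSucc_succ]; trivial
    induction hw using Submonoid.closure_induction with
    | mem x hx =>
      obtain ⟨i, rfl⟩ := hx
      refine ⟨[i], ?_⟩
      simp only [wordProd, List.map_cons, List.map_nil, List.prod_cons, List.prod_nil, mul_one]
      rfl
    | one => exact ⟨[], rfl⟩
    | mul x y _ _ hx hy =>
      obtain ⟨l, rfl⟩ := hx
      obtain ⟨l', rfl⟩ := hy
      exact ⟨l ++ l', by simp [wordProd]⟩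

theorem exists_isReduced {n : ℕ} (w : Equiv.Perm (Fin n)) :
    ∃ l : List (Fin (n - 1)), IsReduced l w := by
  obtain ⟨l, hl, hmin⟩ := exists_minimal_of_wellFoundedLT
    (fun k : ℕ => ∃ l : List (Fin (n - 1)), wordProd l = w ∧ l.length = k)
    (by obtain ⟨l, hl⟩ := exists_wordProd w; exact ⟨l.length, l, hl, rfl⟩)
  obtain ⟨l, hl, rfl⟩ := hl
  refine ⟨l, hl, fun l' hl' => ?_⟩
  rcases le_total l.length l'.length with h | h
  · exact h
  · exact hmin ⟨l', hl', rfl⟩ h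

/-- A reduced expression of `w`. -/
def reducedWord {n : ℕ} (w : Equiv.Perm (Fin n)) : List (Fin (n - 1)) :=
  Classical.choose (exists_isReduced w)

/-- The length `ℓ(w)`. -/
def len {n : ℕ} (w : Equiv.Perm (Fin n)) : ℕ := (reducedWord w).length

/-! ## The Iwahori--Hecke algebra of type `A` -/

/-- The defining relations of the Iwahori--Hecke algebra. -/
inductive HeckeRel (n : ℕ) :
    FreeAlgebra GroundRing (Fin (n - 1)) → FreeAlgebra GroundRing (Fin (n - 1)) → Prop
  | comm (i j : Fin (n - 1)) (h : (i : ℕ) + 1 < j ∨ (j : ℕ) + 1 < i) :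
      HeckeRel n (FreeAlgebra.ι _ i * FreeAlgebra.ι _ j) (FreeAlgebra.ι _ j * FreeAlgebra.ι _ i)
  | braid (i j : Fin (n - 1)) (h : (j : ℕ) = i + 1) :
      HeckeRel n (FreeAlgebra.ι _ i * FreeAlgebra.ι _ j * FreeAlgebra.ι _ i)
        (FreeAlgebra.ι _ j * FreeAlgebra.ι _ i * FreeAlgebra.ι _ j)
  | quad (i : Fin (n - 1)) :
      HeckeRel n (FreeAlgebra.ι _ i ^ 2) (algebraMap _ _ (u ^ 2) + v • FreeAlgebra.ι _ i)

/-- The Iwahori--Hecke algebra `H_n` over `ℂ[u^{±1}, v]`. -/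
abbrev Hecke (n : ℕ) : Type := RingQuot (HeckeRel n)

/-- The generator `T_i` of `H_n`. -/
def heckeT {n : ℕ} (i : Fin (n - 1)) : Hecke n :=
  RingQuot.mkAlgHom GroundRing (HeckeRel n) (FreeAlgebra.ι _ i)

/-- `T_w`, the product of the `T_i` along a reduced expression of `w`. -/
def heckeTw {n : ℕ} (w : Equiv.Perm (Fin n)) : Hecke n := ((reducedWord w).map heckeT).prod

/-- `T̃_w = u^{-ℓ(w)} T_w`. -/
def heckeTt {n : ℕ} (w : Equiv.Perm (Fin n)) : Hecke n := uInv ^ len w • heckeTw w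

/-! ## The Yokonuma--Hecke algebra -/

/-- The free algebra on the symbols `g_1, …, g_{n-1}, t_1, …, t_n`. -/
abbrev FreeGT (n : ℕ) : Type := FreeAlgebra GroundRing (Fin (n - 1) ⊕ Fin n)

/-- The symbol `g_i`. -/
def freeG {n : ℕ} (i : Fin (n - 1)) : FreeGT n := FreeAlgebra.ι _ (Sum.inl i)

/-- The symbol `t_j`. -/
def freeT {n : ℕ} (j : Fin n) : FreeGT n := FreeAlgebra.ι _ (Sum.inr j)

/-- `e_i = (1/d) ∑_{0 ≤ s ≤ d-1} t_i^s t_{i+1}^{-s}`; as `t_j^d = 1`, the inverse of `t_j` is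
written `t_j^{d-1}`. -/
def freeE (d : ℕ) {n : ℕ} (i : Fin (n - 1)) : FreeGT n :=
  oneOver d • ∑ s ∈ Finset.range d, freeT (lo i) ^ s * (freeT (hi i) ^ (d - 1)) ^ s

/-- The defining relations of the Yokonuma--Hecke algebra. -/
inductive YokRel (d n : ℕ) : FreeGT n → FreeGT n → Prop
  | comm (i j : Fin (n - 1)) (h : (i : ℕ) + 1 < j ∨ (j : ℕ) + 1 < i) :
      YokRel d n (freeG i * freeG j) (freeG j * freeG i)
  | braid (i j : Fin (n - 1)) (h : (j : ℕ) = i + 1) :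
      YokRel d n (freeG i * freeG j * freeG i) (freeG j * freeG i * freeG j)
  | tcomm (i j : Fin n) : YokRel d n (freeT i * freeT j) (freeT j * freeT i)
  | gt (i : Fin (n - 1)) (j : Fin n) :
      YokRel d n (freeG i * freeT j) (freeT (simpleRefl i j) * freeG i)
  | tpow (j : Fin n) : YokRel d n (freeT j ^ d) 1
  | quad (i : Fin (n - 1)) :
      YokRel d n (freeG i ^ 2) (algebraMap _ _ (u ^ 2) + v • (freeE d i * freeG i))

/-- The Yokonuma--Hecke algebra `Y_{d,n}` over `ℂ[u^{±1}, v]`. -/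
abbrev Yok (d n : ℕ) : Type := RingQuot (YokRel d n)

/-- The generator `g_i` of `Y_{d,n}`. -/
def yokG (d : ℕ) {n : ℕ} (i : Fin (n - 1)) : Yok d n :=
  RingQuot.mkAlgHom GroundRing (YokRel d n) (freeG i)

/-- The generator `t_j` of `Y_{d,n}`. -/
def yokT (d : ℕ) {n : ℕ} (j : Fin n) : Yok d n :=
  RingQuot.mkAlgHom GroundRing (YokRel d n) (freeT j)

/-- `g_w`, the product of the `g_i` along a reduced expression of `w`. -/
def yokGw (d : ℕ) {n : ℕ} (w : Equiv.Perm (Fin n)) : Yok d n :=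
  ((reducedWord w).map (yokG d)).prod

/-- `g̃_w = u^{-ℓ(w)} g_w`. -/
def yokGt (d : ℕ) {n : ℕ} (w : Equiv.Perm (Fin n)) : Yok d n := uInv ^ len w • yokGw d w

theorem yok_rel {d n : ℕ} {x y : FreeGT n} (h : YokRel d n x y) :
    RingQuot.mkAlgHom GroundRing (YokRel d n) x = RingQuot.mkAlgHom GroundRing (YokRel d n) y :=
  RingQuot.mkAlgHom_rel GroundRing h

/-- The homomorphism of free algebras under the natural embedding `Y_{d,n} → Y_{d,n+1}`. -/
def freeIncl (n : ℕ) : FreeGT n →ₐ[GroundRing] FreeGT (n + 1) :=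
  FreeAlgebra.lift GroundRing
    (Sum.elim (fun i => freeG ⟨i, by omega⟩) (fun j => freeT j.castSucc))

theorem freeIncl_G {n : ℕ} (i : Fin (n - 1)) :
    freeIncl n (freeG i) = freeG (n := n + 1) ⟨i, by omega⟩ := by
  simp [freeIncl, freeG]

theorem freeIncl_T {n : ℕ} (j : Fin n) : freeIncl n (freeT j) = freeT j.castSucc := by
  simp [freeIncl, freeT]

theorem freeIncl_E (d : ℕ) {n : ℕ} (i : Fin (n - 1)) :
    freeIncl n (freeE d i) = freeE (n := n + 1) d ⟨i, by omega⟩ := by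
  simp only [freeE, map_smul, map_sum, map_mul, map_pow, freeIncl_T]
  rfl

theorem castSucc_simpleRefl {n : ℕ} (i : Fin (n - 1)) (j : Fin n) :
    (simpleRefl i j).castSucc = simpleRefl (n := n + 1) ⟨i, by omega⟩ j.castSucc := by
  have h := (Fin.castSucc_injective n).swap_apply (lo i) (hi i) j
  exact h.symm

theorem yokRel_freeIncl {d n : ℕ} {x y : FreeGT n} (h : YokRel d n x y) :
    YokRel d (n + 1) (freeIncl n x) (freeIncl n y) := by
  cases h with
  | comm i j h => simp only [map_mul, freeIncl_G]; exact YokRel.comm _ _ h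
  | braid i j h => simp only [map_mul, freeIncl_G]; exact YokRel.braid _ _ h
  | tcomm i j => simp only [map_mul, freeIncl_T]; exact YokRel.tcomm _ _
  | gt i j =>
    simp only [map_mul, freeIncl_G, freeIncl_T, castSucc_simpleRefl]; exact YokRel.gt _ _
  | tpow j => simp only [map_pow, map_one, freeIncl_T]; exact YokRel.tpow _
  | quad i =>
    simp only [map_pow, map_add, map_smul, map_mul, freeIncl_G, freeIncl_E, AlgHom.commutes]
    have := YokRel.quad (d := d) (n := n + 1) ⟨i, by omega⟩
    simpa using this

/-- The natural embedding `Y_{d,n} → Y_{d,n+1}`, given by `g_i ↦ g_i` and `t_j ↦ t_j`. -/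
def yokIncl (d n : ℕ) : Yok d n →ₐ[GroundRing] Yok d (n + 1) :=
  RingQuot.liftAlgHom GroundRing
    ⟨(RingQuot.mkAlgHom GroundRing (YokRel d (n + 1))).comp (freeIncl n),
      fun _ _ h => yok_rel (yokRel_freeIncl h)⟩

/-! ## Compositions, Young subgroups and parabolic subalgebras -/

/-- `Comp_d(n)`: the compositions of `n` with `d` (possibly zero) parts. -/
abbrev Comp (d n : ℕ) : Type := {μ : Fin d → ℕ // ∑ a, μ a = n}

instance (d n : ℕ) : Fintype (Comp d n) :=
  Fintype.subtype (Finset.Nat.antidiagonalTuple d n)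
    (fun _ => Finset.Nat.mem_antidiagonalTuple)

/-- `μ^{[a]}`: the composition obtained from `μ` by adding `1` to the part `μ_a`. -/
def Comp.incr {d n : ℕ} (μ : Comp d n) (a : Fin d) : Comp d (n + 1) :=
  ⟨fun b => μ.1 b + if b = a then 1 else 0, by
    simp [Finset.sum_add_distrib, μ.2]⟩

/-- `μ_1 + ⋯ + μ_{b-1}`: the number of letters before the `b`-th block. -/
def Comp.start {d n : ℕ} (μ : Comp d n) (b : Fin d) : ℕ := ∑ c ∈ Finset.univ.filter (· < b), μ.1 c

/-- The index set `I_μ` obtained from `{1, …, n - 1}` by removing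
`μ_1, μ_1 + μ_2, …, μ_1 + ⋯ + μ_{d-1}`. -/
def Comp.innerIdx {d n : ℕ} (μ : Comp d n) : Set (Fin (n - 1)) :=
  {i | ∀ b : Fin d, (i : ℕ) + 1 ≠ μ.start b}

/-- The subalgebra `H^μ` of `H_n` generated by the `T_i` with `i ∈ I_μ`. -/
def heckeSub {d n : ℕ} (μ : Comp d n) : Subalgebra GroundRing (Hecke n) :=
  Algebra.adjoin GroundRing (heckeT '' μ.innerIdx)

/-- The block of `μ` that contains the letter `j`. -/
def Comp.block {d n : ℕ} (μ : Comp d n) (j : Fin n) : Fin d :=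
  (finSigmaFinEquiv.symm (Fin.cast μ.2.symm j)).1

/-- The Young subgroup `S^μ = S_{μ_1} × ⋯ × S_{μ_d}`: the permutations that map each of the
consecutive blocks of sizes `μ_1, …, μ_d` to itself. -/
def young {d n : ℕ} (μ : Comp d n) : Subgroup (Equiv.Perm (Fin n)) where
  carrier := {w | ∀ j, μ.block (w j) = μ.block j}
  mul_mem' := fun {a b} ha hb j => by
    rw [Equiv.Perm.mul_apply, ha, hb]
  one_mem' := fun j => rfl
  inv_mem' := fun {a} ha j => by
    have := ha (a⁻¹ j)
    simpa using this.symm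

/-- `f` is the natural homomorphism `H^μ → H^{μ'}` for `μ ≤ μ'`, that is
`x_1 ⊗ ⋯ ⊗ x_d ↦ x_1 ⊗ ⋯ ⊗ x_d` under `H^μ ≃ H_{μ_1} ⊗ ⋯ ⊗ H_{μ_d}` and
`H^{μ'} ≃ H_{μ'_1} ⊗ ⋯ ⊗ H_{μ'_d}`: for each block `b`, it maps the `(r+1)`-st generator of the
factor `H_{μ_b}` to the `(r+1)`-st generator of the factor `H_{μ'_b}`. -/
def IsNaturalEmbedding {d n n' : ℕ} (μ : Comp d n) (μ' : Comp d n')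
    (f : heckeSub μ →ₐ[GroundRing] heckeSub μ') : Prop :=
  ∀ (b : Fin d) (r : ℕ), r + 1 < μ.1 b → ∀ (i : Fin (n - 1)) (i' : Fin (n' - 1)),
    (i : ℕ) = μ.start b + r → (i' : ℕ) = μ'.start b + r →
    ∀ x : heckeSub μ, (x : Hecke n) = heckeT i → (f x : Hecke n') = heckeT i'

/-! ## Characters and idempotents

Once the `d`-th roots of unity are enumerated as `ξ_1, …, ξ_d`, a complex character `χ` of
`(ℤ/dℤ)^n` is the same as a function `c : Fin n → Fin d`, through `χ(t_j) = ξ_{c(j)}`. -/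

/-- The action of the symmetric group: `w(χ)(t_i) = χ(t_{w⁻¹(i)})`. -/
def permChar {d n : ℕ} (w : Equiv.Perm (Fin n)) (c : Fin n → Fin d) : Fin n → Fin d :=
  fun i => c (w⁻¹ i)

/-- The orbit `O(μ)`: the characters `χ` with `Comp(χ) = μ`, that is, with
`μ_a = #{j | χ(t_j) = ξ_a}` for all `a`. It has `m_μ` elements and indexes the rows and columns of
the matrices of size `m_μ`. -/
abbrev Orbit {d n : ℕ} (μ : Comp d n) : Type :=
  {c : Fin n → Fin d // ∀ a, (Finset.univ.filter fun j => c j = a).card = μ.1 a}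

/-- The distinguished character `χ_1^μ`, with `χ_1^μ(t_j) = ξ_a` for `j` in the `a`-th block. -/
def chiOne {d n : ℕ} (μ : Comp d n) : Fin n → Fin d := μ.block

theorem card_chiOne {d n : ℕ} (μ : Comp d n) (a : Fin d) :
    (Finset.univ.filter fun j => chiOne μ j = a).card = μ.1 a := by
  rw [← Fintype.card_subtype]
  have e : {j // chiOne μ j = a} ≃ {p : (b : Fin d) × Fin (μ.1 b) // p.1 = a} :=
    ((finCongr μ.2.symm).trans finSigmaFinEquiv.symm).subtypeEquiv (fun j => Iff.rfl)
  rw [Fintype.card_congr (e.trans (Equiv.sigmaSubtype a)), Fintype.card_fin]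

theorem exists_permChar {d n : ℕ} {μ : Comp d n} (χ : Orbit μ) :
    ∃ w : Equiv.Perm (Fin n), permChar w (chiOne μ) = χ.1 := by
  have h : ∀ a, Nonempty ({j // chiOne μ j = a} ≃ {j // χ.1 j = a}) := fun a => by
    rw [← Fintype.card_eq, Fintype.card_subtype, Fintype.card_subtype, card_chiOne, χ.2]
  have f := fun a => (h a).some
  let w : Equiv.Perm (Fin n) :=
    (Equiv.sigmaFiberEquiv (chiOne μ)).symm.trans
      ((Equiv.sigmaCongrRight fun a => (f a)).trans (Equiv.sigmaFiberEquiv χ.1))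
  have hw : ∀ j, χ.1 (w j) = chiOne μ j := fun j => (f (chiOne μ j) ⟨j, rfl⟩).2
  refine ⟨w, funext fun i => ?_⟩
  have := hw (w⁻¹ i)
  simpa [permChar] using this.symm

theorem exists_minimal_rep {d n : ℕ} {μ : Comp d n} (χ : Orbit μ) :
    ∃ w : Equiv.Perm (Fin n), permChar w (chiOne μ) = χ.1 ∧
      ∀ w' : Equiv.Perm (Fin n), permChar w' (chiOne μ) = χ.1 → len w ≤ len w' :=
  Set.exists_min_image {w : Equiv.Perm (Fin n) | permChar w (chiOne μ) = χ.1} len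
    (Set.toFinite _) (exists_permChar χ)

/-- `π_χ`: the element of minimal length among the `w` with `w(χ_1^μ) = χ`, that is, the
distinguished representative of a left coset of the Young subgroup. -/
def minRep {d n : ℕ} {μ : Comp d n} (χ : Orbit μ) : Equiv.Perm (Fin n) :=
  Classical.choose (exists_minimal_rep χ)

/-- `E_χ = ∏_i (1/d) ∑_{0 ≤ s ≤ d-1} χ(t_i)^s t_i^{-s}`, with `t_i^{-1} = t_i^{d-1}`; the factors
commute. -/
def idem {d : ℕ} (ξ : Fin d → ℂ) {n : ℕ} (c : Fin n → Fin d) : Yok d n :=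
  (List.ofFn fun i : Fin n =>
    oneOver d • ∑ s ∈ Finset.range d,
      algebraMap ℂ GroundRing (ξ (c i) ^ s) • (yokT d i ^ (d - 1)) ^ s).prod

theorem card_snoc {d n : ℕ} (c : Fin n → Fin d) (a b : Fin d) :
    (Finset.univ.filter fun j => Fin.snoc (α := fun _ => Fin d) c a j = b).card =
      (Finset.univ.filter fun j => c j = b).card + if b = a then 1 else 0 := by
  simp only [Finset.card_filter, Fin.sum_univ_castSucc, Fin.snoc_castSucc, Fin.snoc_last]
  simp only [eq_comm]

/-- The extended character: `χ_a(t_i) = χ(t_i)` for `i ≤ n`, and `χ_a(t_{n+1}) = ξ_a`. -/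
def Orbit.extend {d n : ℕ} {μ : Comp d n} (χ : Orbit μ) (a : Fin d) : Orbit (μ.incr a) :=
  ⟨Fin.snoc (α := fun _ => Fin d) χ.1 a, fun b => by rw [card_snoc, χ.2]; rfl⟩

/-! ## The isomorphism -/

/-- `Mat_{m_μ}(H^μ)`. -/
abbrev MatBlock {d n : ℕ} (μ : Comp d n) : Type := Matrix (Orbit μ) (Orbit μ) (heckeSub μ)

/-- The algebra `⊕_{μ ∈ Comp_d(n)} Mat_{m_μ}(H^μ)`. -/
abbrev MatAlg (d n : ℕ) : Type := (μ : Comp d n) → MatBlock μ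

/-- The rule that defines `Φ_n` on the basis elements `T̃_w M_{i,j}`, `w ∈ S^μ`:
`T̃_w M_{i,j} ↦ E_{χ_i} g̃_{π_i w π_j⁻¹} E_{χ_j}`. -/
def IsPhi {d : ℕ} (ξ : Fin d → ℂ) {n : ℕ} (Φ : MatAlg d n →ₗ[GroundRing] Yok d n) : Prop :=
  ∀ (μ : Comp d n) (i j : Orbit μ) (w : Equiv.Perm (Fin n)), w ∈ young μ →
    ∃ h : heckeTt w ∈ heckeSub μ,
      Φ (Pi.single μ (Matrix.single i j ⟨heckeTt w, h⟩)) =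
        idem ξ i.1 * yokGt d (minRep i * w * (minRep j)⁻¹) * idem ξ j.1

/-- The rule that defines `Ψ_n` on the basis elements `E_{χ_k} g̃_w`, `w ∈ S_n`:
`E_{χ_k} g̃_w ↦ T̃_{π_k⁻¹ w π_j} M_{k,j}`, where `w(χ_j) = χ_k`. -/
def IsPsi {d : ℕ} (ξ : Fin d → ℂ) {n : ℕ} (Ψ : Yok d n →ₗ[GroundRing] MatAlg d n) : Prop :=
  ∀ (μ : Comp d n) (k j : Orbit μ) (w : Equiv.Perm (Fin n)), permChar w j.1 = k.1 →
    ∃ h : heckeTt ((minRep k)⁻¹ * w * minRep j) ∈ heckeSub μ,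
      Ψ (idem ξ k.1 * yokGt d w) =
        Pi.single μ (Matrix.single k j ⟨heckeTt ((minRep k)⁻¹ * w * minRep j), h⟩)

end YokonumaHecke

end

open YokonumaHecke

/-!
The proof rests on one computation. Multiplying the relation `g_i² = u² + v e_i g_i` by the
idempotent `E_χ` of a character `χ` turns it into the quadratic relation of the Iwahori--Hecke
algebra if `s_i` fixes `χ`, and into `g_i² E_χ = u² E_χ` if `s_i` moves `χ`. With the normalised
elements `g̃_w`, left multiplication by `g̃_i` on the `g̃_w E_χ` is therefore
`g̃_w E_χ ↦ g̃_{s_i w} E_χ`, plus a multiple of `g̃_w E_χ` exactly when `s_i` is a descent of `w` that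
fixes `w(χ)` (`yokGn_mul_yokGt_mul_idem`; that `g̃_w` does not depend on the reduced expression is
Matsumoto's theorem, `IsBraided.prod_eq`). So the `g̃_w E_χ` span `Y_{d,n}`. Conversely, these
formulas define operators on the free module on the symmetric group that satisfy the defining
relations (`stepOp`, `diagOp`, `yokRep`), which gives coordinates (`yokCoord`) and shows that the
`g̃_w E_χ` are linearly independent. Everything is done with an arbitrary colouring of the letters,
and the constant colouring gives the basis `T̃_w` of the Iwahori--Hecke algebra.

*The isomorphism.* The elements of the Young subgroup fix `χ_1^μ`, so that `T̃_w ↦ g̃_w E_{χ_1^μ}` is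
multiplicative on `H^μ` (`subCorner_mul`). Every letter of a reduced expression of the minimal coset
representative `π_χ` moves the character that it meets, since otherwise it could be deleted
(`moves_minRep`); hence `g̃_{π_χ}` multiplies without correction terms, and the elements
`g̃_{π_χ} E_{χ_1}` and `g̃_{π_χ⁻¹} E_χ` are mutually inverse between the corners of `Y_{d,n}` at `χ_1`
and at `χ` (`cornerRight_mul_cornerLeft`, `cornerLeft_mul_cornerRight`). As the `E_χ` form a complete
system of orthogonal idempotents, `Y_{d,n}` is the sum of the matrix algebras over these corners.
No length of a product `π_i w π_j⁻¹` has to be computed.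

*The embedding.* On bases, `Y_{d,n} → Y_{d,n+1}` is `g̃_w E_χ ↦ ∑_a g̃_w E_{χ_a}`, where `χ_a` extends
`χ` by the value `ξ_a`; this is visibly injective. The minimal representative of `χ_a` is
`π_χ σ_a`, where `σ_a` is the representative for `χ = χ_1^μ` (`minRep_extend`): both permutations
have the same effect on `χ_1^{μ^{[a]}}` and are increasing on its blocks. Hence
`π_{i_a}⁻¹ (π_i w π_j⁻¹) π_{j_a} = σ_a⁻¹ w σ_a` (`youngEmb_eq`), and conjugation by `σ_a` maps each
simple reflection in a block of `μ` to the one at the same place in the same block of `μ^{[a]}`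
(`youngEmb_simpleRefl`). So `Ψ_{n+1}` of the image of `T̃_w M_{i,j}` is the sum over `a` of
`κ(T̃_w) M_{i_a,j_a}`, with `κ` the natural embedding (`phiLin_iotaTot`). That `κ` and `ι_μ` are
multiplicative then follows from the multiplicativity of the two isomorphisms and of
`Y_{d,n} → Y_{d,n+1}`.
-/

noncomputable section

namespace YokonumaHecke

open Finsupp

/-! ### Lengths and inversions -/

theorem lo_lt_hi {n : ℕ} (i : Fin (n - 1)) : lo i < hi i := by
  simp [Fin.lt_def, lo, hi]

theorem lo_ne_hi {n : ℕ} (i : Fin (n - 1)) : lo i ≠ hi i := (lo_lt_hi i).ne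

@[simp] theorem simpleRefl_lo {n : ℕ} (i : Fin (n - 1)) : simpleRefl i (lo i) = hi i :=
  Equiv.swap_apply_left _ _

@[simp] theorem simpleRefl_hi {n : ℕ} (i : Fin (n - 1)) : simpleRefl i (hi i) = lo i :=
  Equiv.swap_apply_right _ _

@[simp] theorem simpleRefl_mul_self {n : ℕ} (i : Fin (n - 1)) :
    simpleRefl i * simpleRefl i = 1 := Equiv.swap_mul_self _ _

@[simp] theorem simpleRefl_inv {n : ℕ} (i : Fin (n - 1)) :
    (simpleRefl i)⁻¹ = simpleRefl i := Equiv.swap_inv _ _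

@[simp] theorem simpleRefl_simpleRefl {n : ℕ} (i : Fin (n - 1)) (j : Fin n) :
    simpleRefl i (simpleRefl i j) = j := by
  rw [← Equiv.Perm.mul_apply, simpleRefl_mul_self, Equiv.Perm.one_apply]

@[simp] theorem simpleRefl_mul_cancel {n : ℕ} (i : Fin (n - 1)) (w : Equiv.Perm (Fin n)) :
    simpleRefl i * (simpleRefl i * w) = w := by
  rw [← mul_assoc, simpleRefl_mul_self, one_mul]

@[simp] theorem mul_simpleRefl_cancel {n : ℕ} (i : Fin (n - 1)) (w : Equiv.Perm (Fin n)) :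
    w * simpleRefl i * simpleRefl i = w := by
  rw [mul_assoc, simpleRefl_mul_self, mul_one]

theorem simpleRefl_of_ne {n : ℕ} (i : Fin (n - 1)) {j : Fin n} (h : (j : ℕ) ≠ i)
    (h' : (j : ℕ) ≠ i + 1) : simpleRefl i j = j :=
  Equiv.swap_apply_of_ne_of_ne (by simpa [Fin.ext_iff, lo] using h)
    (by simpa [Fin.ext_iff, hi] using h')

theorem simpleRefl_mul_comm {n : ℕ} {i j : Fin (n - 1)} (h : (i : ℕ) + 1 < j) :
    simpleRefl i * simpleRefl j = simpleRefl j * simpleRefl i := by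
  have h₁ := Equiv.swap_apply_apply (simpleRefl i) (lo j) (hi j)
  rw [simpleRefl_of_ne i (j := lo j) (by simp [lo]; omega) (by simp [lo]; omega),
    simpleRefl_of_ne i (j := hi j) (by simp [hi]; omega) (by simp [hi]; omega)] at h₁
  exact (eq_mul_inv_iff_mul_eq.1 h₁).symm

theorem simpleRefl_braid {n : ℕ} {i j : Fin (n - 1)} (h : (j : ℕ) = i + 1) :
    simpleRefl i * simpleRefl j * simpleRefl i = simpleRefl j * simpleRefl i * simpleRefl j := by
  have hhl : lo j = hi i := Fin.ext (by simp [lo, hi, h])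
  have h₁ := Equiv.swap_apply_apply (simpleRefl i) (lo j) (hi j)
  have h₂ := Equiv.swap_apply_apply (simpleRefl j) (lo i) (hi i)
  rw [simpleRefl_of_ne i (j := hi j) (by simp [hi]; omega) (by simp [hi]; omega), hhl,
    simpleRefl_hi, simpleRefl_inv] at h₁
  rw [simpleRefl_of_ne j (j := lo i) (by simp [lo]; omega) (by simp [lo]; omega), ← hhl,
    simpleRefl_lo, simpleRefl_inv] at h₂
  have e₁ : simpleRefl j = Equiv.swap (hi i) (hi j) := by rw [← hhl, simpleRefl]
  have e₂ : simpleRefl i = Equiv.swap (lo i) (lo j) := by rw [hhl, simpleRefl]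
  rw [← e₁] at h₁
  rw [← e₂] at h₂
  exact h₁.symm.trans h₂

/-- The order of two letters is changed by `s_i` only if they are the letters that it moves. -/
theorem simpleRefl_lt_iff {n : ℕ} (i : Fin (n - 1)) {a b : Fin n}
    (h₁ : ¬ (a = lo i ∧ b = hi i)) (h₂ : ¬ (a = hi i ∧ b = lo i)) :
    simpleRefl i a < simpleRefl i b ↔ a < b := by
  simp only [simpleRefl, Equiv.swap_apply_def]
  simp only [Fin.ext_iff, lo, hi, Fin.lt_def] at *
  split_ifs <;> simp <;> omega

/-- The inversions of `w`, as pairs of positions. -/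
def invSet {n : ℕ} (w : Equiv.Perm (Fin n)) : Finset (Fin n × Fin n) :=
  Finset.univ.filter fun p => p.1 < p.2 ∧ w p.2 < w p.1

theorem mem_invSet {n : ℕ} {w : Equiv.Perm (Fin n)} {p : Fin n × Fin n} :
    p ∈ invSet w ↔ p.1 < p.2 ∧ w p.2 < w p.1 := by simp [invSet]

/-- Multiplying on the left by `s_i` adds exactly one inversion if `w⁻¹` preserves the order of the
letters moved by `s_i`. -/
theorem invSet_simpleRefl_mul {n : ℕ} (i : Fin (n - 1)) (w : Equiv.Perm (Fin n))
    (h : w⁻¹ (lo i) < w⁻¹ (hi i)) :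
    (invSet (simpleRefl i * w)).card = (invSet w).card + 1 := by
  have hn : (w⁻¹ (lo i), w⁻¹ (hi i)) ∉ invSet w := by
    simp [mem_invSet, (lo_lt_hi i).le]
  rw [← Finset.card_insert_of_notMem hn]
  congr 1
  ext ⟨a, b⟩
  simp only [mem_invSet, Finset.mem_insert, Prod.mk.injEq, Equiv.Perm.mul_apply]
  by_cases hab : a = w⁻¹ (lo i) ∧ b = w⁻¹ (hi i)
  · obtain ⟨rfl, rfl⟩ := hab
    simpa [lo_lt_hi] using h
  · by_cases hlt : a < b
    · have key : simpleRefl i (w b) < simpleRefl i (w a) ↔ w b < w a := by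
        refine simpleRefl_lt_iff i ?_ ?_
        · rintro ⟨e₁, e₂⟩
          rw [← e₁, ← e₂] at h
          exact absurd (by simpa using h) hlt.not_gt
        · rintro ⟨e₁, e₂⟩
          exact hab ⟨by simp [← e₂], by simp [← e₁]⟩
      simp only [hlt, hab, key, true_and, false_or]
    · simp only [hlt, hab, false_and, false_or]

theorem invSet_simpleRefl_mul_of_gt {n : ℕ} (i : Fin (n - 1)) (w : Equiv.Perm (Fin n))
    (h : w⁻¹ (hi i) < w⁻¹ (lo i)) :
    (invSet (simpleRefl i * w)).card + 1 = (invSet w).card := by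
  have := invSet_simpleRefl_mul i (simpleRefl i * w) (by simpa using h)
  rw [← this, simpleRefl_mul_cancel]

theorem inv_lo_lt_or_gt {n : ℕ} (i : Fin (n - 1)) (w : Equiv.Perm (Fin n)) :
    w (lo i) < w (hi i) ∨ w (hi i) < w (lo i) :=
  lt_or_gt_of_ne fun h => lo_ne_hi i (w.injective h)

theorem card_invSet_wordProd_le {n : ℕ} (l : List (Fin (n - 1))) :
    (invSet (wordProd l)).card ≤ l.length := by
  induction l with
  | nil =>
    simp only [wordProd, List.map_nil, List.prod_nil, List.length_nil, Nat.le_zero,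
      Finset.card_eq_zero, Finset.eq_empty_iff_forall_notMem, mem_invSet]
    rintro ⟨a, b⟩ ⟨h, h'⟩
    exact absurd h h'.not_gt
  | cons i l ih =>
    have e : wordProd (i :: l) = simpleRefl i * wordProd l := by simp [wordProd]
    rw [e, List.length_cons]
    rcases inv_lo_lt_or_gt i (wordProd l)⁻¹ with h | h
    · rw [invSet_simpleRefl_mul i _ h]; omega
    · have := invSet_simpleRefl_mul_of_gt i _ h; omega

/-- A strictly increasing permutation is trivial. -/
theorem perm_eq_one_of_strictMono {n : ℕ} {w : Equiv.Perm (Fin n)} (h : StrictMono w) : w = 1 := by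
  have := Subsingleton.elim (h.orderIsoOfSurjective w w.surjective) (OrderIso.refl (Fin n))
  ext i
  have := congrArg (fun f : Fin n ≃o Fin n => f i) this
  simpa [Fin.ext_iff] using this

theorem strictMono_of_forall_lo_lt_hi {n : ℕ} {α : Type*} [Preorder α] {f : Fin n → α}
    (h : ∀ i : Fin (n - 1), f (lo i) < f (hi i)) : StrictMono f := by
  cases n with
  | zero => intro i; exact i.elim0
  | succ m => exact Fin.strictMono_iff_lt_succ.2 fun i => h i

theorem exists_word_length {n : ℕ} (w : Equiv.Perm (Fin n)) :
    ∃ l : List (Fin (n - 1)), wordProd l = w ∧ l.length = (invSet w).card := by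
  generalize hk : (invSet w).card = k
  induction k generalizing w with
  | zero =>
    refine ⟨[], ?_, rfl⟩
    have : w⁻¹ = 1 := perm_eq_one_of_strictMono (strictMono_of_forall_lo_lt_hi fun i => by
      rcases inv_lo_lt_or_gt i w⁻¹ with h | h
      · exact h
      · have := invSet_simpleRefl_mul_of_gt i w h; omega)
    rw [inv_eq_one.1 this]; rfl
  | succ k ih =>
    by_cases hw : ∀ i : Fin (n - 1), w⁻¹ (lo i) < w⁻¹ (hi i)
    · have := perm_eq_one_of_strictMono (strictMono_of_forall_lo_lt_hi hw)
      rw [inv_eq_one.1 this] at hk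
      have h0 := card_invSet_wordProd_le (n := n) []
      have e : wordProd ([] : List (Fin (n - 1))) = 1 := rfl
      rw [e, hk] at h0
      simp at h0
    · push Not at hw
      obtain ⟨i, hi'⟩ := hw
      have hlt := lt_of_le_of_ne hi' fun h => lo_ne_hi i ((w⁻¹).injective h).symm
      have := invSet_simpleRefl_mul_of_gt i w hlt
      obtain ⟨l, hl, hlen⟩ := ih (simpleRefl i * w) (by omega)
      refine ⟨i :: l, ?_, by simp [hlen]⟩
      have e : wordProd (i :: l) = simpleRefl i * wordProd l := by simp [wordProd]
      rw [e, hl, simpleRefl_mul_cancel]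

/-- The length of a permutation is the number of its inversions. -/
theorem isReduced_iff {n : ℕ} {l : List (Fin (n - 1))} {w : Equiv.Perm (Fin n)} :
    IsReduced l w ↔ wordProd l = w ∧ l.length = (invSet w).card := by
  refine ⟨fun h => ⟨h.1, ?_⟩, fun h => ⟨h.1, fun l' hl' => ?_⟩⟩
  · obtain ⟨l', hl', e⟩ := exists_word_length w
    refine le_antisymm (e ▸ h.2 l' hl') ?_
    rw [← h.1]; exact card_invSet_wordProd_le l
  · rw [h.2, ← hl']; exact card_invSet_wordProd_le l'

theorem reducedWord_spec {n : ℕ} (w : Equiv.Perm (Fin n)) : IsReduced (reducedWord w) w :=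
  Classical.choose_spec (exists_isReduced w)

theorem len_eq_card_invSet {n : ℕ} (w : Equiv.Perm (Fin n)) : len w = (invSet w).card :=
  (isReduced_iff.1 (reducedWord_spec w)).2

theorem isReduced_iff_len {n : ℕ} {l : List (Fin (n - 1))} {w : Equiv.Perm (Fin n)} :
    IsReduced l w ↔ wordProd l = w ∧ l.length = len w := by
  rw [isReduced_iff, len_eq_card_invSet]

theorem len_simpleRefl_mul {n : ℕ} {i : Fin (n - 1)} {w : Equiv.Perm (Fin n)}
    (h : w⁻¹ (lo i) < w⁻¹ (hi i)) : len (simpleRefl i * w) = len w + 1 := by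
  simp only [len_eq_card_invSet, invSet_simpleRefl_mul i w h]

theorem len_simpleRefl_mul_of_gt {n : ℕ} {i : Fin (n - 1)} {w : Equiv.Perm (Fin n)}
    (h : w⁻¹ (hi i) < w⁻¹ (lo i)) : len (simpleRefl i * w) + 1 = len w := by
  simp only [len_eq_card_invSet, invSet_simpleRefl_mul_of_gt i w h]

theorem wordProd_nil {n : ℕ} : wordProd ([] : List (Fin (n - 1))) = 1 := rfl

theorem wordProd_cons {n : ℕ} (i : Fin (n - 1)) (l : List (Fin (n - 1))) :
    wordProd (i :: l) = simpleRefl i * wordProd l := by simp [wordProd]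

theorem wordProd_reverse {n : ℕ} (l : List (Fin (n - 1))) :
    wordProd l.reverse = (wordProd l)⁻¹ := by
  simp [wordProd, List.prod_inv_reverse, List.map_reverse, Function.comp_def]

theorem wordProd_reducedWord {n : ℕ} (w : Equiv.Perm (Fin n)) : wordProd (reducedWord w) = w :=
  (reducedWord_spec w).1

theorem isReduced_reverse {n : ℕ} {l : List (Fin (n - 1))} {w : Equiv.Perm (Fin n)}
    (h : IsReduced l w) : IsReduced l.reverse w⁻¹ := by
  refine ⟨by rw [wordProd_reverse, h.1], fun l' hl' => ?_⟩
  have := h.2 l'.reverse (by rw [wordProd_reverse, hl', inv_inv])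
  simpa using this

theorem len_inv {n : ℕ} (w : Equiv.Perm (Fin n)) : len w⁻¹ = len w := by
  have := (isReduced_iff_len.1 (isReduced_reverse (reducedWord_spec w))).2
  rw [← this, List.length_reverse]; rfl

theorem len_mul_simpleRefl_of_gt {n : ℕ} {i : Fin (n - 1)} {w : Equiv.Perm (Fin n)}
    (h : w (hi i) < w (lo i)) : len (w * simpleRefl i) + 1 = len w := by
  have := len_simpleRefl_mul_of_gt (i := i) (w := w⁻¹) (by simpa using h)
  rw [len_inv] at this
  rw [← this, ← len_inv, mul_inv_rev, simpleRefl_inv]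

theorem len_wordProd_le {n : ℕ} (l : List (Fin (n - 1))) : len (wordProd l) ≤ l.length :=
  (reducedWord_spec (wordProd l)).2 l rfl

/-- The first letter of a reduced expression is a left descent, and the rest is reduced. -/
theorem IsReduced.of_cons {n : ℕ} {i : Fin (n - 1)} {l : List (Fin (n - 1))}
    {w : Equiv.Perm (Fin n)} (h : IsReduced (i :: l) w) :
    w⁻¹ (hi i) < w⁻¹ (lo i) ∧ IsReduced l (simpleRefl i * w) := by
  rw [isReduced_iff_len, wordProd_cons, List.length_cons] at h
  have hl : wordProd l = simpleRefl i * w := by rw [← h.1, simpleRefl_mul_cancel]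
  have hle := len_wordProd_le l
  rw [hl] at hle
  have hd : w⁻¹ (hi i) < w⁻¹ (lo i) := by
    rcases inv_lo_lt_or_gt i w⁻¹ with h' | h'
    · have := len_simpleRefl_mul h'; omega
    · exact h'
  have := len_simpleRefl_mul_of_gt hd
  exact ⟨hd, isReduced_iff_len.2 ⟨hl, by omega⟩⟩

theorem IsReduced.cons {n : ℕ} {i : Fin (n - 1)} {l : List (Fin (n - 1))}
    {w : Equiv.Perm (Fin n)} (hd : w⁻¹ (hi i) < w⁻¹ (lo i)) (h : IsReduced l (simpleRefl i * w)) :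
    IsReduced (i :: l) w := by
  rw [isReduced_iff_len] at h ⊢
  have := len_simpleRefl_mul_of_gt hd
  refine ⟨by rw [wordProd_cons, h.1, simpleRefl_mul_cancel], by simp; omega⟩

/-! ### Products along reduced expressions -/

section Matsumoto

variable {n : ℕ} {M : Type*} [Monoid M] (x : Fin (n - 1) → M)

/-- The braid relations of type `A`, for a family of elements of a monoid. -/
structure IsBraided : Prop where
  comm : ∀ i j : Fin (n - 1), (i : ℕ) + 1 < j → x i * x j = x j * x i
  braid : ∀ i j : Fin (n - 1), (j : ℕ) = i + 1 → x i * x j * x i = x j * x i * x j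

variable {x}

/-- The step of Matsumoto's theorem for two reduced expressions with first letters `i < j`: both
are compared with an expression that begins with the longest element of `⟨s_i, s_j⟩`. -/
theorem IsBraided.prod_eq_of_lt (hx : IsBraided x) {w : Equiv.Perm (Fin n)}
    {i j : Fin (n - 1)} (hij : i < j) {l l' : List (Fin (n - 1))}
    (ih : ∀ (w' : Equiv.Perm (Fin n)) (a b : List (Fin (n - 1))), a.length < (i :: l).length →
      IsReduced a w' → IsReduced b w' → (a.map x).prod = (b.map x).prod)
    (hl : IsReduced (i :: l) w) (hl' : IsReduced (j :: l') w) :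
    ((i :: l).map x).prod = ((j :: l').map x).prod := by
  have hlen : (i :: l).length = (j :: l').length := by
    rw [(isReduced_iff_len.1 hl).2, (isReduced_iff_len.1 hl').2]
  obtain ⟨di, ri⟩ := hl.of_cons
  obtain ⟨dj, rj⟩ := hl'.of_cons
  simp only [List.length_cons] at ih hlen
  rcases Nat.lt_or_ge ((i : ℕ) + 1) j with h | h
  · -- the two reflections commute
    have ei : simpleRefl j (lo i) = lo i :=
      simpleRefl_of_ne _ (by simp [lo]; omega) (by simp [lo]; omega)
    have ei' : simpleRefl j (hi i) = hi i :=
      simpleRefl_of_ne _ (by simp [hi]; omega) (by simp [hi]; omega)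
    have ej : simpleRefl i (lo j) = lo j :=
      simpleRefl_of_ne _ (by simp [lo]; omega) (by simp [lo]; omega)
    have ej' : simpleRefl i (hi j) = hi j :=
      simpleRefl_of_ne _ (by simp [hi]; omega) (by simp [hi]; omega)
    have hc := simpleRefl_mul_comm h
    have r := reducedWord_spec (simpleRefl j * (simpleRefl i * w))
    have r₁ : IsReduced (j :: reducedWord (simpleRefl j * (simpleRefl i * w)))
        (simpleRefl i * w) := IsReduced.cons (by simpa [ej, ej'] using dj) r
    have r₂ : IsReduced (i :: reducedWord (simpleRefl j * (simpleRefl i * w)))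
        (simpleRefl j * w) :=
      IsReduced.cons (by simpa [ei, ei'] using di)
        (by rw [← mul_assoc (simpleRefl i), hc, mul_assoc]; exact r)
    have e₁ := ih _ _ _ (by omega) ri r₁
    have e₂ := ih _ _ _ (by omega) rj r₂
    simp only [List.map_cons, List.prod_cons] at e₁ e₂ ⊢
    rw [e₁, e₂, ← mul_assoc (x i), ← mul_assoc (x j), hx.comm i j h]
  · -- the two reflections generate a copy of the symmetric group on three letters
    have hj : (j : ℕ) = i + 1 := by have := Fin.lt_def.1 hij; omega
    have hhl : lo j = hi i := Fin.ext (by simp [lo, hi, hj])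
    have ei : simpleRefl j (lo i) = lo i :=
      simpleRefl_of_ne _ (by simp [lo]; omega) (by simp [lo]; omega)
    have ej' : simpleRefl i (hi j) = hi j :=
      simpleRefl_of_ne _ (by simp [hi]; omega) (by simp [hi]; omega)
    have fj : simpleRefl j (hi i) = hi j := by rw [← hhl, simpleRefl_lo]
    have fi : simpleRefl i (lo j) = lo i := by rw [hhl, simpleRefl_hi]
    have hb := simpleRefl_braid hj
    rw [hhl] at dj
    have dij := dj.trans di
    set w₃ := simpleRefl i * (simpleRefl j * (simpleRefl i * w)) with hw₃
    have hw₃' : w₃ = simpleRefl j * (simpleRefl i * (simpleRefl j * w)) := by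
      simp only [hw₃, ← mul_assoc]; rw [hb]
    have r := reducedWord_spec w₃
    have r₁ : IsReduced (j :: i :: reducedWord w₃) (simpleRefl i * w) :=
      IsReduced.cons (by simpa [hhl, ej'] using dij)
        (IsReduced.cons (by simpa [ei, fj, ej'] using dj) r)
    have r₂ : IsReduced (i :: j :: reducedWord w₃) (simpleRefl j * w) :=
      IsReduced.cons (by simpa [ei, fj] using dij)
        (IsReduced.cons (by simpa [hhl, ei, fj, ej'] using di) (by rwa [← hw₃']))
    have e₁ := ih _ _ _ (by omega) ri r₁
    have e₂ := ih _ _ _ (by omega) rj r₂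
    simp only [List.map_cons, List.prod_cons] at e₁ e₂ ⊢
    rw [e₁, e₂]
    simp only [← mul_assoc]
    rw [hx.braid i j hj]

/-- **Matsumoto's theorem** for the symmetric group. -/
theorem IsBraided.prod_eq (hx : IsBraided x) {w : Equiv.Perm (Fin n)}
    {l l' : List (Fin (n - 1))} (hl : IsReduced l w) (hl' : IsReduced l' w) :
    (l.map x).prod = (l'.map x).prod := by
  generalize hk : l.length = k
  induction k using Nat.strong_induction_on generalizing w l l' with
  | _ k ih =>
    have hlen : l.length = l'.length := by
      rw [(isReduced_iff_len.1 hl).2, (isReduced_iff_len.1 hl').2]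
    match l, l' with
    | [], [] => rfl
    | [], _ :: _ => simp at hlen
    | _ :: _, [] => simp at hlen
    | i :: l, j :: l' =>
      rcases lt_trichotomy i j with h | rfl | h
      · exact hx.prod_eq_of_lt h (fun w' a b ha h₁ h₂ => ih _ (hk ▸ ha) h₁ h₂ rfl) hl hl'
      · have := ih l.length (by simp [← hk]) hl.of_cons.2 hl'.of_cons.2 rfl
        simp [this]
      · exact (hx.prod_eq_of_lt h
          (fun w' a b ha h₁ h₂ => ih _ (by rw [← hk, hlen]; exact ha) h₁ h₂ rfl) hl' hl).symm

variable (x) in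
/-- The product of the `x_i` along a reduced expression of `w`. -/
def prodRed (w : Equiv.Perm (Fin n)) : M := ((reducedWord w).map x).prod

theorem prodRed_one : prodRed x 1 = 1 := by
  have h : IsReduced ([] : List (Fin (n - 1))) 1 := ⟨rfl, fun _ _ => Nat.zero_le _⟩
  have h' := (reducedWord_spec (1 : Equiv.Perm (Fin n))).2 [] rfl
  have : reducedWord (1 : Equiv.Perm (Fin n)) = [] :=
    List.eq_nil_of_length_eq_zero (by simpa using h')
  simp [prodRed, this]

theorem IsBraided.prodRed_eq (hx : IsBraided x) {w : Equiv.Perm (Fin n)}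
    {l : List (Fin (n - 1))} (hl : IsReduced l w) : prodRed x w = (l.map x).prod :=
  hx.prod_eq (reducedWord_spec w) hl

theorem IsBraided.prodRed_simpleRefl_mul (hx : IsBraided x) {w : Equiv.Perm (Fin n)}
    {i : Fin (n - 1)} (h : w⁻¹ (lo i) < w⁻¹ (hi i)) :
    prodRed x (simpleRefl i * w) = x i * prodRed x w := by
  rw [hx.prodRed_eq (l := i :: reducedWord w)]
  · simp [prodRed]
  · exact IsReduced.cons (by simpa using h) (by simpa using reducedWord_spec w)

theorem IsBraided.prodRed_mul_simpleRefl (hx : IsBraided x) {w : Equiv.Perm (Fin n)}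
    {i : Fin (n - 1)} (h : w (lo i) < w (hi i)) :
    prodRed x (w * simpleRefl i) = prodRed x w * x i := by
  have h' : IsReduced (i :: (reducedWord w).reverse) (simpleRefl i * w⁻¹) :=
    IsReduced.cons (by simpa using h)
      (by rw [simpleRefl_mul_cancel]; exact isReduced_reverse (reducedWord_spec w))
  rw [hx.prodRed_eq (l := reducedWord w ++ [i])]
  · simp [prodRed]
  · simpa using isReduced_reverse h'

theorem IsBraided.prodRed_simpleRefl (hx : IsBraided x) (i : Fin (n - 1)) :
    prodRed x (simpleRefl i) = x i := by
  have := hx.prodRed_simpleRefl_mul (w := 1) (i := i) (by simpa using lo_lt_hi i)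
  simpa [prodRed_one] using this

/-- Induction on the length: every permutation is reached from `1` by left multiplications with
simple reflections that increase the length. -/
theorem perm_induction {p : Equiv.Perm (Fin n) → Prop} (one : p 1)
    (mul : ∀ (i : Fin (n - 1)) (w : Equiv.Perm (Fin n)), w⁻¹ (lo i) < w⁻¹ (hi i) → p w →
      p (simpleRefl i * w)) (w : Equiv.Perm (Fin n)) : p w := by
  have key : ∀ (l : List (Fin (n - 1))) (w : Equiv.Perm (Fin n)), IsReduced l w → p w := by
    intro l
    induction l with
    | nil => intro w h; rw [← h.1]; exact one
    | cons i l ih =>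
      intro w h
      obtain ⟨hd, hr⟩ := h.of_cons
      have := mul i (simpleRefl i * w) (by simpa using hd) (ih _ hr)
      rwa [simpleRefl_mul_cancel] at this
  exact key _ w (reducedWord_spec w)

end Matsumoto

/-! ### Blocks of a composition -/

section Blocks

variable {d n : ℕ} (μ : Comp d n)

theorem Comp.start_add_le_start {b b' : Fin d} (h : b < b') :
    μ.start b + μ.1 b ≤ μ.start b' := by
  unfold Comp.start
  rw [add_comm, ← Finset.sum_insert (by simp)]
  refine Finset.sum_le_sum_of_subset fun c hc => ?_
  simp only [Finset.mem_insert, Finset.mem_filter, Finset.mem_univ, true_and] at hc ⊢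
  rcases hc with rfl | hc
  · exact h
  · exact hc.trans h

theorem Comp.start_add_le (b : Fin d) : μ.start b + μ.1 b ≤ n := by
  unfold Comp.start
  conv_rhs => rw [← μ.2]
  rw [add_comm, ← Finset.sum_insert (by simp)]
  exact Finset.sum_le_sum_of_subset (Finset.subset_univ _)

theorem Comp.val_eq_start_add (j : Fin n) :
    ∃ r < μ.1 (μ.block j), (j : ℕ) = μ.start (μ.block j) + r := by
  unfold Comp.block
  set p := finSigmaFinEquiv.symm (Fin.cast μ.2.symm j) with hp
  refine ⟨p.2, p.2.2, ?_⟩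
  have h : finSigmaFinEquiv p = Fin.cast μ.2.symm j := by simp [hp]
  have h' := congrArg Fin.val h
  rw [finSigmaFinEquiv_apply] at h'
  rw [Fin.val_cast] at h'
  rw [← h', Comp.start]
  congr 1
  symm
  refine Finset.sum_bij' (fun c hc => ⟨c, ?_⟩) (fun c _ => Fin.castLE p.1.2.le c) ?_ ?_ ?_ ?_ ?_
  · simpa using hc
  all_goals simp
  intro a; exact a.2

theorem Comp.block_eq_iff {j : Fin n} {b : Fin d} :
    μ.block j = b ↔ μ.start b ≤ j ∧ (j : ℕ) < μ.start b + μ.1 b := by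
  obtain ⟨r, hr, hj⟩ := μ.val_eq_start_add j
  refine ⟨fun h => by subst h; omega, fun h => ?_⟩
  rcases lt_trichotomy (μ.block j) b with h' | h' | h'
  · have := μ.start_add_le_start h'; omega
  · exact h'
  · have := μ.start_add_le_start h'; omega

theorem Comp.block_mono : Monotone μ.block := by
  intro j j' h
  by_contra! h'
  obtain ⟨r, hr, hj⟩ := μ.val_eq_start_add j
  obtain ⟨r', hr', hj'⟩ := μ.val_eq_start_add j'
  have := μ.start_add_le_start h'
  have := Fin.le_def.1 h
  omega

theorem Comp.mem_innerIdx_iff {i : Fin (n - 1)} :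
    i ∈ μ.innerIdx ↔ μ.block (lo i) = μ.block (hi i) := by
  obtain ⟨h₁, h₂⟩ := μ.block_eq_iff.1 (rfl : μ.block (lo i) = _)
  obtain ⟨h₃, h₄⟩ := μ.block_eq_iff.1 (rfl : μ.block (hi i) = _)
  have hlo : ((lo i : Fin n) : ℕ) = i := rfl
  have hhi : ((hi i : Fin n) : ℕ) = i + 1 := rfl
  rw [hlo] at h₁ h₂
  rw [hhi] at h₃ h₄
  constructor
  · intro h
    rcases (μ.block_mono (lo_lt_hi i).le).eq_or_lt with e | e
    · exact e
    · have := μ.start_add_le_start e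
      exact absurd (show (i : ℕ) + 1 = μ.start (μ.block (hi i)) by omega) (h _)
  · intro h b hb
    rw [← h] at h₃ h₄
    rcases lt_trichotomy b (μ.block (lo i)) with e | e | e
    · have := μ.start_add_le_start e; omega
    · subst e; omega
    · have := μ.start_add_le_start e; omega

theorem Comp.exists_of_mem_innerIdx {i : Fin (n - 1)} (h : i ∈ μ.innerIdx) :
    ∃ (b : Fin d) (r : ℕ), r + 1 < μ.1 b ∧ (i : ℕ) = μ.start b + r := by
  rw [μ.mem_innerIdx_iff] at h
  obtain ⟨r, hr, hj⟩ := μ.val_eq_start_add (lo i)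
  have := (μ.block_eq_iff.1 h.symm).2
  have hlo : ((lo i : Fin n) : ℕ) = i := rfl
  have hhi : ((hi i : Fin n) : ℕ) = i + 1 := rfl
  rw [hlo] at hj
  rw [hhi] at this
  exact ⟨_, r, by omega, hj⟩

end Blocks

/-! ### The action on characters and minimal coset representatives -/

section Characters

variable {d n : ℕ}

@[simp] theorem permChar_one (c : Fin n → Fin d) : permChar 1 c = c := rfl

theorem permChar_mul (w w' : Equiv.Perm (Fin n)) (c : Fin n → Fin d) :
    permChar (w * w') c = permChar w (permChar w' c) := by
  funext i; simp [permChar, mul_inv_rev]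

theorem permChar_eq_iff {w : Equiv.Perm (Fin n)} {c c' : Fin n → Fin d} :
    permChar w c = c' ↔ ∀ j, c' (w j) = c j := by
  refine ⟨fun h j => ?_, fun h => funext fun i => ?_⟩
  · simp [← h, permChar]
  · have := h (w⁻¹ i)
    simpa [permChar] using this.symm

theorem permChar_inv_eq_iff {w : Equiv.Perm (Fin n)} {c c' : Fin n → Fin d} :
    permChar w⁻¹ c' = c ↔ permChar w c = c' := by
  constructor <;> rintro rfl <;> simp [← permChar_mul]

theorem permChar_simpleRefl_eq_self {i : Fin (n - 1)} {c : Fin n → Fin d}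
    (h : c (lo i) = c (hi i)) : permChar (simpleRefl i) c = c := by
  rw [permChar_eq_iff]
  intro j
  by_cases h₁ : j = lo i
  · subst h₁; simp [h]
  by_cases h₂ : j = hi i
  · subst h₂; simp [h]
  · rw [simpleRefl, Equiv.swap_apply_of_ne_of_ne h₁ h₂]

theorem mem_young_iff {μ : Comp d n} {w : Equiv.Perm (Fin n)} :
    w ∈ young μ ↔ permChar w (chiOne μ) = chiOne μ := permChar_eq_iff.symm

/-- Every letter of the word `l` moves the character that it meets when `l` is applied to `c`,
from right to left. -/
def Moves (c : Fin n → Fin d) : List (Fin (n - 1)) → Prop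
  | [] => True
  | i :: l => Moves c l ∧
      permChar (wordProd l) c (lo i) ≠ permChar (wordProd l) c (hi i)

/-- A letter that does not move the character it meets can be deleted. -/
theorem exists_shorter_of_not_moves {c : Fin n → Fin d} {l : List (Fin (n - 1))}
    (h : ¬ Moves c l) : ∃ l' : List (Fin (n - 1)), l'.length < l.length ∧
      permChar (wordProd l') c = permChar (wordProd l) c := by
  induction l with
  | nil => exact absurd trivial h
  | cons i l ih =>
    by_cases hl : Moves c l
    · have h' : permChar (wordProd l) c (lo i) = permChar (wordProd l) c (hi i) := by
        by_contra h'
        exact h ⟨hl, h'⟩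
      refine ⟨l, by simp, ?_⟩
      rw [wordProd_cons, permChar_mul, permChar_simpleRefl_eq_self h']
    · obtain ⟨l', h₁, h₂⟩ := ih hl
      exact ⟨i :: l', by simpa using h₁, by
        rw [wordProd_cons, wordProd_cons, permChar_mul, permChar_mul, h₂]⟩

variable {μ : Comp d n} (χ : Orbit μ)

theorem permChar_minRep : permChar (minRep χ) (chiOne μ) = χ.1 :=
  (Classical.choose_spec (exists_minimal_rep χ)).1

theorem len_minRep_le {w : Equiv.Perm (Fin n)} (h : permChar w (chiOne μ) = χ.1) :
    len (minRep χ) ≤ len w :=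
  (Classical.choose_spec (exists_minimal_rep χ)).2 w h

theorem permChar_minRep_inv : permChar (minRep χ)⁻¹ χ.1 = chiOne μ :=
  permChar_inv_eq_iff.2 (permChar_minRep χ)

/-- Every letter of a reduced expression of `π_χ` moves the character that it meets, as it could be
deleted otherwise. -/
theorem moves_minRep : Moves (chiOne μ) (reducedWord (minRep χ)) := by
  by_contra h
  obtain ⟨l, hl, e⟩ := exists_shorter_of_not_moves h
  rw [wordProd_reducedWord, permChar_minRep] at e
  have h₁ := len_minRep_le χ e
  have h₂ := len_wordProd_le l
  have h₃ : (reducedWord (minRep χ)).length = len (minRep χ) := rfl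
  omega

theorem moves_minRep_inv : Moves χ.1 (reducedWord (minRep χ)⁻¹) := by
  by_contra h
  obtain ⟨l, hl, e⟩ := exists_shorter_of_not_moves h
  rw [wordProd_reducedWord, permChar_minRep_inv] at e
  have h₁ := len_minRep_le χ (permChar_inv_eq_iff.2 e)
  rw [len_inv] at h₁
  have h₂ := len_wordProd_le l
  have h₃ : (reducedWord (minRep χ)⁻¹).length = len (minRep χ)⁻¹ := rfl
  rw [len_inv] at h₃
  omega

/-- `w` is increasing on each fibre of `c`. -/
def IncreasingOnFibres (c : Fin n → Fin d) (w : Equiv.Perm (Fin n)) : Prop :=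
  ∀ j j' : Fin n, j < j' → c j = c j' → w j < w j'

/-- A permutation of minimal length in its coset of the Young subgroup is increasing on blocks. -/
theorem increasing_minRep : IncreasingOnFibres (chiOne μ) (minRep χ) := by
  have adj : ∀ i : Fin (n - 1), chiOne μ (lo i) = chiOne μ (hi i) →
      minRep χ (lo i) < minRep χ (hi i) := by
    intro i h
    rcases inv_lo_lt_or_gt i (minRep χ) with h' | h'
    · exact h'
    · have h₁ := len_mul_simpleRefl_of_gt h'
      have h₂ := len_minRep_le χ (w := minRep χ * simpleRefl i)
        (by rw [permChar_mul, permChar_simpleRefl_eq_self h, permChar_minRep])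
      omega
  have adj' : ∀ j j' : Fin n, (j' : ℕ) = j + 1 → chiOne μ j = chiOne μ j' →
      minRep χ j < minRep χ j' := by
    intro j j' e h
    obtain ⟨i, rfl, rfl⟩ : ∃ i : Fin (n - 1), lo i = j ∧ hi i = j' :=
      ⟨⟨j, by omega⟩, rfl, Fin.ext e.symm⟩
    exact adj i h
  have key : ∀ (k : ℕ) (j j' : Fin n), (j' : ℕ) = j + k + 1 → chiOne μ j = chiOne μ j' →
      minRep χ j < minRep χ j' := by
    intro k
    induction k with
    | zero => exact fun j j' e h => adj' j j' e h
    | succ k ih =>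
      intro j j' e h
      let m : Fin n := ⟨j + k + 1, by omega⟩
      have hm : chiOne μ j = chiOne μ m := by
        refine le_antisymm (μ.block_mono (Fin.le_def.2 (by simp [m]; omega))) ?_
        rw [h]
        exact μ.block_mono (Fin.le_def.2 (by simp [m]; omega))
      exact (ih j m rfl hm).trans (adj' m j' (by simp [m]; omega) (hm.symm.trans h))
  intro j j' hlt h
  have := Fin.lt_def.1 hlt
  exact key (j' - j - 1) j j' (by omega) h

/-- A permutation is determined by its effect on `χ_1^μ` if it is increasing on blocks. -/
theorem IncreasingOnFibres.unique {w w' : Equiv.Perm (Fin n)}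
    (h : IncreasingOnFibres (chiOne μ) w) (h' : IncreasingOnFibres (chiOne μ) w')
    (e : permChar w (chiOne μ) = permChar w' (chiOne μ)) : w = w' := by
  have hy : permChar (w'⁻¹ * w) (chiOne μ) = chiOne μ := by
    rw [permChar_mul, e, ← permChar_mul, inv_mul_cancel, permChar_one]
  rw [permChar_eq_iff] at hy
  have hs : StrictMono (w'⁻¹ * w) := by
    intro j j' hlt
    by_cases hb : chiOne μ j = chiOne μ j'
    · have h₁ := h j j' hlt hb
      by_contra! h₂
      rcases h₂.eq_or_lt with h₃ | h₃
      · exact hlt.ne' ((w'⁻¹ * w).injective h₃)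
      · have := h' _ _ h₃ (by rw [hy, hy, hb])
        simp at this
        exact absurd this h₁.not_gt
    · by_contra! h₂
      have h₃ := μ.block_mono h₂
      have h₄ := μ.block_mono hlt.le
      change chiOne μ _ ≤ chiOne μ _ at h₃ h₄
      rw [hy, hy] at h₃
      exact hb (le_antisymm h₄ h₃)
  exact (inv_mul_eq_one.1 (perm_eq_one_of_strictMono hs)).symm

theorem eq_minRep {w : Equiv.Perm (Fin n)} (h : IncreasingOnFibres (chiOne μ) w)
    (e : permChar w (chiOne μ) = χ.1) : w = minRep χ :=
  h.unique (increasing_minRep χ) (by rw [e, permChar_minRep])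

end Characters

/-! ### Adding one letter -/

section Extend

variable {n : ℕ}

/-- The permutation of `n + 1` letters that fixes the last one and is `w` on the others. -/
def extPerm (w : Equiv.Perm (Fin n)) : Equiv.Perm (Fin (n + 1)) :=
  (finSuccEquivLast.trans (Equiv.optionCongr w)).trans finSuccEquivLast.symm

/-- The index of an adjacent transposition, for one more letter. -/
def extIdx (i : Fin (n - 1)) : Fin (n + 1 - 1) := ⟨i, by omega⟩

@[simp] theorem extPerm_castSucc (w : Equiv.Perm (Fin n)) (j : Fin n) :
    extPerm w j.castSucc = (w j).castSucc := by simp [extPerm]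

@[simp] theorem extPerm_last (w : Equiv.Perm (Fin n)) :
    extPerm w (Fin.last n) = Fin.last n := by simp [extPerm]

theorem extPerm_mul (w w' : Equiv.Perm (Fin n)) : extPerm (w * w') = extPerm w * extPerm w' := by
  ext j
  cases j using Fin.lastCases <;> simp

@[simp] theorem extPerm_one : extPerm (1 : Equiv.Perm (Fin n)) = 1 := by
  ext j
  cases j using Fin.lastCases <;> simp

theorem extPerm_inv (w : Equiv.Perm (Fin n)) : extPerm w⁻¹ = (extPerm w)⁻¹ :=
  eq_inv_of_mul_eq_one_left (by rw [← extPerm_mul, inv_mul_cancel, extPerm_one])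

theorem extPerm_injective : Function.Injective (extPerm (n := n)) := by
  intro w w' h
  ext j
  have := congrArg (fun f : Equiv.Perm (Fin (n + 1)) => f j.castSucc) h
  simpa [Fin.ext_iff] using this

theorem lo_extIdx (i : Fin (n - 1)) : lo (extIdx i) = (lo i).castSucc := rfl

theorem hi_extIdx (i : Fin (n - 1)) : hi (extIdx i) = (hi i).castSucc := rfl

theorem extPerm_simpleRefl (i : Fin (n - 1)) :
    extPerm (simpleRefl i) = simpleRefl (extIdx i) := by
  ext j
  cases j using Fin.lastCases with
  | last =>
    rw [extPerm_last, simpleRefl_of_ne]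
    · simp [extIdx]; omega
    · simp [extIdx]; omega
  | cast j => rw [extPerm_castSucc, castSucc_simpleRefl]; rfl

variable {d : ℕ}

theorem permChar_extPerm_snoc (w : Equiv.Perm (Fin n)) (c : Fin n → Fin d) (a : Fin d) :
    permChar (extPerm w) (Fin.snoc (α := fun _ => Fin d) c a) =
      Fin.snoc (α := fun _ => Fin d) (permChar w c) a := by
  rw [permChar_eq_iff]
  intro j
  cases j using Fin.lastCases <;> simp [permChar]

variable (μ : Comp d n) (a : Fin d)

/-- The character `χ_1^μ`, as an element of the orbit of `μ`. -/
def orbitOne : Orbit μ := ⟨chiOne μ, card_chiOne μ⟩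

/-- The permutation `σ` of minimal length with `σ(χ_1^{μ^{[a]}}) = (χ_1^μ, ξ_a)`: it moves the last
letter of the `a`-th block of `μ^{[a]}` to the end. -/
def shiftPerm : Equiv.Perm (Fin (n + 1)) := minRep ((orbitOne μ).extend a)

theorem permChar_shiftPerm : permChar (shiftPerm μ a) (chiOne (μ.incr a)) =
    Fin.snoc (α := fun _ => Fin d) (chiOne μ) a :=
  permChar_minRep ((orbitOne μ).extend a)

variable {μ} in
/-- Both sides have the same effect on `χ_1^{μ^{[a]}}`, and the right-hand side is increasing on blocks
as well: `σ` is, and `π_χ` is increasing on the blocks of `μ`. -/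
theorem minRep_extend (χ : Orbit μ) :
    minRep (χ.extend a) = extPerm (minRep χ) * shiftPerm μ a := by
  symm
  refine eq_minRep _ ?_ ?_
  · intro j j' hlt h
    have h₁ := increasing_minRep ((orbitOne μ).extend a) j j' hlt h
    have h₂ := permChar_eq_iff.1 (permChar_shiftPerm μ a)
    rw [← h₂, ← h₂] at h
    change shiftPerm μ a j < shiftPerm μ a j' at h₁
    rw [Equiv.Perm.mul_apply, Equiv.Perm.mul_apply]
    generalize shiftPerm μ a j = x at *
    generalize shiftPerm μ a j' = y at *
    cases y using Fin.lastCases with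
    | last =>
      cases x using Fin.lastCases with
      | last => exact absurd h₁ (lt_irrefl _)
      | cast x => simp [Fin.castSucc_lt_last]
    | cast y =>
      cases x using Fin.lastCases with
      | last => exact absurd h₁ (Fin.le_last _).not_gt
      | cast x =>
        simp only [Fin.snoc_castSucc] at h
        simpa using increasing_minRep χ x y (by simpa using h₁) h
  · rw [permChar_mul, permChar_shiftPerm, permChar_extPerm_snoc, permChar_minRep]
    rfl

/-- The embedding of symmetric groups under the natural embedding `H^μ → H^{μ^{[a]}}`. -/
def youngEmb (w : Equiv.Perm (Fin n)) : Equiv.Perm (Fin (n + 1)) :=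
  (shiftPerm μ a)⁻¹ * extPerm w * shiftPerm μ a

theorem youngEmb_injective : Function.Injective (youngEmb μ a) := fun w w' h => by
  simpa [youngEmb, extPerm_injective.eq_iff] using h

@[simp] theorem youngEmb_one : youngEmb μ a 1 = 1 := by simp [youngEmb]

variable {μ} in
theorem youngEmb_mem_young {w : Equiv.Perm (Fin n)} (hw : w ∈ young μ) :
    youngEmb μ a w ∈ young (μ.incr a) := by
  rw [mem_young_iff] at hw ⊢
  rw [youngEmb, permChar_mul, permChar_mul, permChar_shiftPerm, permChar_extPerm_snoc, hw,
    permChar_inv_eq_iff, permChar_shiftPerm]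

variable {μ} in
theorem youngEmb_eq (i j : Orbit μ) (w : Equiv.Perm (Fin n)) :
    (minRep (i.extend a))⁻¹ * extPerm (minRep i * w * (minRep j)⁻¹) * minRep (j.extend a) =
      youngEmb μ a w := by
  rw [minRep_extend, minRep_extend, extPerm_mul, extPerm_mul, extPerm_inv, youngEmb]
  group

/-- `σ` is the increasing bijection from each block of `μ^{[a]}` to the corresponding
fibre of `(χ_1^μ, ξ_a)`, which consists of a block of `μ` and, in one case, of the last letter. -/
theorem shiftPerm_apply (b : Fin d) (r : ℕ) (hr : r < μ.1 b) (j : Fin n) (j' : Fin (n + 1))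
    (hj : (j : ℕ) = μ.start b + r) (hj' : (j' : ℕ) = (μ.incr a).start b + r) :
    shiftPerm μ a j' = j.castSucc := by
  have hle : μ.1 b ≤ (μ.incr a).1 b := Nat.le_add_right _ _
  induction r using Nat.strong_induction_on generalizing j j' with
  | _ r ih =>
    have hc := permChar_eq_iff.1 (permChar_shiftPerm μ a)
    have hinc := increasing_minRep ((orbitOne μ).extend a)
    change IncreasingOnFibres _ (shiftPerm μ a) at hinc
    have bj : chiOne μ j = b := μ.block_eq_iff.2 (by omega)
    have bj' : chiOne (μ.incr a) j' = b := (μ.incr a).block_eq_iff.2 (by omega)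
    -- the preimage of the expected value, at position `r'` of the block
    obtain ⟨z, hz⟩ := (shiftPerm μ a).surjective j.castSucc
    have bz : chiOne (μ.incr a) z = b := by rw [← hc, hz, Fin.snoc_castSucc, bj]
    have bz' := (μ.incr a).block_eq_iff.1 bz
    rcases lt_trichotomy z j' with h | h | h
    · have := Fin.lt_def.1 h
      have e := ih (z - (μ.incr a).start b) (by omega) (by omega)
        ⟨μ.start b + (z - (μ.incr a).start b), by omega⟩ z rfl (by omega)
      rw [hz] at e
      have := congrArg Fin.val e
      simp at this
      omega
    · rw [← h, hz]
    · have hlt := hinc j' z h (by rw [bj', bz])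
      have hx := hc j'
      rw [hz] at hlt
      generalize hxe : shiftPerm μ a j' = x at *
      cases x using Fin.lastCases with
      | last => exact absurd hlt (Fin.le_last _).not_gt
      | cast x =>
        rw [Fin.snoc_castSucc, bj'] at hx
        have hx' := μ.block_eq_iff.1 hx
        have hlt' := Fin.lt_def.1 hlt
        simp only [Fin.val_castSucc] at hlt'
        have e := ih (x - μ.start b) (by omega) (by omega) x
          ⟨(μ.incr a).start b + (x - μ.start b), by omega⟩ (by omega) rfl
        rw [← hxe] at e
        have := congrArg Fin.val ((shiftPerm μ a).injective e)
        simp at this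
        omega

theorem youngEmb_simpleRefl (b : Fin d) (r : ℕ) (hr : r + 1 < μ.1 b) (i : Fin (n - 1))
    (i' : Fin (n + 1 - 1)) (hi₁ : (i : ℕ) = μ.start b + r)
    (hi' : (i' : ℕ) = (μ.incr a).start b + r) :
    youngEmb μ a (simpleRefl i) = simpleRefl i' := by
  have h₁ := shiftPerm_apply μ a b r (by omega) (lo i) (lo i') hi₁ hi'
  have h₂ := shiftPerm_apply μ a b (r + 1) hr (hi i) (hi i') (by simp [hi]; omega)
    (by simp [hi]; omega)
  have h₃ := Equiv.swap_apply_apply (shiftPerm μ a) (lo i') (hi i')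
  rw [h₁, h₂] at h₃
  rw [youngEmb, extPerm_simpleRefl]
  have h₄ : simpleRefl (extIdx i) = shiftPerm μ a * simpleRefl i' * (shiftPerm μ a)⁻¹ := h₃
  rw [h₄]
  group

theorem Comp.incr_injective : Function.Injective (μ.incr) := by
  intro a a' h
  by_contra hne
  have := congrFun (congrArg Subtype.val h) a
  simp [Comp.incr, hne] at this

end Extend

/-! ### Operators on the free module on the symmetric group -/

section Operators

variable {n : ℕ} {R : Type*} [CommSemiring R] {α : Type*}

open Classical in
/-- The indicator of the pairs `(x, y)` of letters of the same colour with `y < x`. -/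
def colInd (R : Type*) [CommSemiring R] (c : Fin n → α) (x y : Fin n) : R :=
  if y < x ∧ c x = c y then 1 else 0

theorem colInd_of_lt (c : Fin n → α) {x y : Fin n} (h : x < y) : colInd R c x y = 0 :=
  if_neg fun h' => h.not_gt h'.1

theorem colInd_of_ne (c : Fin n → α) {x y : Fin n} (h : c x ≠ c y) : colInd R c x y = 0 :=
  if_neg fun h' => h h'.2

theorem colInd_of_gt (c : Fin n → α) {x y : Fin n} (h : y < x) (h' : c x = c y) :
    colInd R c x y = 1 := if_pos ⟨h, h'⟩

theorem colInd_mul_self (c : Fin n → α) (x y : Fin n) :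
    colInd R c x y * colInd R c x y = colInd R c x y := by
  unfold colInd; split_ifs <;> simp

open Classical in
theorem colInd_add_swap (c : Fin n → α) {x y : Fin n} (h : x ≠ y) :
    colInd R c x y + colInd R c y x = if c x = c y then 1 else 0 := by
  unfold colInd
  rcases lt_or_gt_of_ne h with h' | h' <;> by_cases e : c x = c y <;>
    simp [h', h'.not_gt, e, eq_comm]

/-- The relations between indicators that the braid relation comes down to. -/
theorem colInd_braid (c : Fin n → α) {x y z : Fin n} (hxy : x ≠ y) (hyz : y ≠ z) (hxz : x ≠ z) :
    colInd R c x z * colInd R c y x + colInd R c x y * colInd R c y z =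
        colInd R c y z * colInd R c x z ∧
      colInd R c x y * colInd R c x z =
        colInd R c x z * colInd R c z y + colInd R c y z * colInd R c x y := by
  by_cases h₁ : c x = c y
  · by_cases h₂ : c y = c z
    · have h₃ := h₁.trans h₂
      rcases lt_or_gt_of_ne hxy with a | a <;> rcases lt_or_gt_of_ne hyz with b | b <;>
        rcases lt_or_gt_of_ne hxz with e | e <;>
        first
        | (exfalso; omega)
        | simp [colInd, a, b, e, a.not_gt, b.not_gt, e.not_gt, h₁, h₂]
    · have h₃ : c x ≠ c z := h₁ ▸ h₂
      simp [colInd_of_ne c h₂, colInd_of_ne c h₃, colInd_of_ne c (Ne.symm h₂)]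
  · have h₁' := colInd_of_ne (R := R) c h₁
    have h₁'' := colInd_of_ne (R := R) c (Ne.symm h₁)
    by_cases h₂ : c y = c z
    · have h₃ : c x ≠ c z := h₂ ▸ h₁
      simp [h₁', h₁'', colInd_of_ne c h₃]
    · by_cases h₃ : c x = c z
      · simp [h₁', h₁'', colInd_of_ne c h₂, colInd_of_ne c (Ne.symm h₂)]
      · simp [h₁', h₁'', colInd_of_ne c h₃]

variable (u v : R) (c : Fin n → α)

/-- The operator `w ↦ u s_i w + v w` or `w ↦ u s_i w`, where the term `v w` is present if `s_i` is a
left descent of `w` that fixes the colouring `w(c)`. For constant `c` this is left multiplication by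
`T_i` in the Hecke algebra, in the basis of the `T̃_w`. -/
def stepOp (i : Fin (n - 1)) : Module.End R (Equiv.Perm (Fin n) →₀ R) :=
  linearCombination R fun w =>
    u • single (simpleRefl i * w) 1 +
      (v * colInd R c (w⁻¹ (lo i)) (w⁻¹ (hi i))) • single w 1

theorem stepOp_single (i : Fin (n - 1)) (w : Equiv.Perm (Fin n)) :
    stepOp u v c i (single w 1) = u • single (simpleRefl i * w) 1 +
      (v * colInd R c (w⁻¹ (lo i)) (w⁻¹ (hi i))) • single w 1 := by
  simp [stepOp]

theorem stepOp_mul_of_lt {i j : Fin (n - 1)} (h : (i : ℕ) + 1 < j) :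
    stepOp u v c i * stepOp u v c j = stepOp u v c j * stepOp u v c i := by
  have ei : simpleRefl j (lo i) = lo i :=
    simpleRefl_of_ne _ (by simp [lo]; omega) (by simp [lo]; omega)
  have ei' : simpleRefl j (hi i) = hi i :=
    simpleRefl_of_ne _ (by simp [hi]; omega) (by simp [hi]; omega)
  have ej : simpleRefl i (lo j) = lo j :=
    simpleRefl_of_ne _ (by simp [lo]; omega) (by simp [lo]; omega)
  have ej' : simpleRefl i (hi j) = hi j :=
    simpleRefl_of_ne _ (by simp [hi]; omega) (by simp [hi]; omega)
  have hc := simpleRefl_mul_comm h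
  refine Finsupp.lhom_ext' fun w => LinearMap.ext_ring ?_
  simp only [LinearMap.coe_comp, Function.comp_apply, lsingle_apply, Module.End.mul_apply,
    stepOp_single, map_add, map_smul, mul_inv_rev, Equiv.Perm.mul_apply, simpleRefl_inv,
    ei, ei', ej, ej', ← mul_assoc, hc]
  module

theorem stepOp_braid {i j : Fin (n - 1)} (h : (j : ℕ) = i + 1) :
    stepOp u v c i * stepOp u v c j * stepOp u v c i =
      stepOp u v c j * stepOp u v c i * stepOp u v c j := by
  have hhl : lo j = hi i := Fin.ext (by simp [lo, hi, h])
  have ei : simpleRefl j (lo i) = lo i :=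
    simpleRefl_of_ne _ (by simp [lo]; omega) (by simp [lo]; omega)
  have ej' : simpleRefl i (hi j) = hi j :=
    simpleRefl_of_ne _ (by simp [hi]; omega) (by simp [hi]; omega)
  have fj : simpleRefl j (hi i) = hi j := by rw [← hhl, simpleRefl_lo]
  have hb := simpleRefl_braid h
  refine Finsupp.lhom_ext' fun w => LinearMap.ext_ring ?_
  have hxy : w⁻¹ (lo i) ≠ w⁻¹ (hi i) := fun e => lo_ne_hi i ((w⁻¹).injective e)
  have hyz : w⁻¹ (hi i) ≠ w⁻¹ (hi j) := fun e => lo_ne_hi j (hhl.trans ((w⁻¹).injective e))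
  have hxz : w⁻¹ (lo i) ≠ w⁻¹ (hi j) := fun e => by
    have := congrArg Fin.val ((w⁻¹).injective e)
    simp [lo, hi] at this
    omega
  obtain ⟨h₁, h₂⟩ := colInd_braid (R := R) c hxy hyz hxz
  have h₃ := colInd_mul_self (R := R) c (w⁻¹ (lo i)) (w⁻¹ (hi i))
  have h₄ := colInd_mul_self (R := R) c (w⁻¹ (hi i)) (w⁻¹ (hi j))
  simp only [LinearMap.coe_comp, Function.comp_apply, lsingle_apply, Module.End.mul_apply,
    stepOp_single, map_add, map_smul, mul_inv_rev, Equiv.Perm.mul_apply, simpleRefl_inv,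
    simpleRefl_lo, simpleRefl_hi, hhl, ei, ej', fj, ← mul_assoc, hb, simpleRefl_mul_self, one_mul]
  generalize colInd R c (w⁻¹ (lo i)) (w⁻¹ (hi i)) = a₁ at *
  generalize colInd R c (w⁻¹ (hi i)) (w⁻¹ (hi j)) = a₂ at *
  generalize colInd R c (w⁻¹ (lo i)) (w⁻¹ (hi j)) = a₃ at *
  generalize colInd R c (w⁻¹ (hi i)) (w⁻¹ (lo i)) = a₄ at *
  generalize colInd R c (w⁻¹ (hi j)) (w⁻¹ (hi i)) = a₅ at *
  trans u ^ 3 • single (simpleRefl j * simpleRefl i * simpleRefl j * w) (1 : R) +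
    (u ^ 2 * v * a₂) • single (simpleRefl j * simpleRefl i * w) (1 : R) +
    (u ^ 2 * v * a₁) • single (simpleRefl i * simpleRefl j * w) (1 : R) +
    (u * v ^ 2 * (a₃ * a₄ + a₁ * a₂)) • single (simpleRefl i * w) (1 : R) +
    (u * v ^ 2 * (a₁ * a₃)) • single (simpleRefl j * w) (1 : R) +
    (u ^ 2 * v * a₃ + v ^ 3 * (a₂ * (a₁ * a₁))) • single w (1 : R)
  · module
  · rw [h₁, h₂, show a₂ * (a₁ * a₁) = a₁ * (a₂ * a₂) by rw [h₃, h₄, mul_comm]]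
    module

open Classical in
theorem stepOp_sq_single (i : Fin (n - 1)) (w : Equiv.Perm (Fin n)) :
    stepOp u v c i (stepOp u v c i (single w 1)) = u ^ 2 • single w 1 +
      (v * if c (w⁻¹ (lo i)) = c (w⁻¹ (hi i)) then 1 else 0) • stepOp u v c i (single w 1) := by
  have hxy : w⁻¹ (lo i) ≠ w⁻¹ (hi i) := fun e => lo_ne_hi i ((w⁻¹).injective e)
  rw [← colInd_add_swap c hxy]
  have h₁ : colInd R c (w⁻¹ (lo i)) (w⁻¹ (hi i)) * colInd R c (w⁻¹ (hi i)) (w⁻¹ (lo i)) = 0 := by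
    rcases lt_or_gt_of_ne hxy with h | h <;>
      rw [colInd_of_lt c h] <;> simp only [zero_mul, mul_zero]
  have h₃ := colInd_mul_self (R := R) c (w⁻¹ (lo i)) (w⁻¹ (hi i))
  simp only [stepOp_single, map_add, map_smul, mul_inv_rev, Equiv.Perm.mul_apply, simpleRefl_inv,
    simpleRefl_lo, simpleRefl_hi, simpleRefl_mul_cancel]
  generalize colInd R c (w⁻¹ (lo i)) (w⁻¹ (hi i)) = a₁ at *
  generalize colInd R c (w⁻¹ (hi i)) (w⁻¹ (lo i)) = a₂ at *
  trans u ^ 2 • single w (1 : R) + (u * v * (a₁ + a₂)) • single (simpleRefl i * w) (1 : R) +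
    (v ^ 2 * (a₁ * a₁)) • single w (1 : R)
  · module
  · trans u ^ 2 • single w (1 : R) + (u * v * (a₁ + a₂)) • single (simpleRefl i * w) (1 : R) +
      (v ^ 2 * (a₁ * a₁ + a₁ * a₂)) • single w (1 : R)
    · rw [h₁, add_zero]
    · module

end Operators

/-! ### The standard basis of the Iwahori--Hecke algebra -/

theorem u_mul_uInv : u * uInv = 1 := by
  rw [u, uInv, ← Polynomial.C_mul, ← LaurentPolynomial.T_add]
  simp

theorem uInv_mul_u : uInv * u = 1 := by rw [mul_comm, u_mul_uInv]

/-- A submodule that contains `1` and is stable under left multiplication by the elements of `s`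
contains the subalgebra generated by `s`. -/
theorem adjoin_le_of_left_stable {R A : Type*} [CommSemiring R] [Semiring A] [Algebra R A]
    {s : Set A} {S : Submodule R A} (one : (1 : A) ∈ S) (mul : ∀ x ∈ s, ∀ y ∈ S, x * y ∈ S) :
    Subalgebra.toSubmodule (Algebra.adjoin R s) ≤ S := by
  have key : ∀ x ∈ Algebra.adjoin R s, ∀ y ∈ S, x * y ∈ S := by
    intro x hx
    induction hx using Algebra.adjoin_induction with
    | mem x hx => exact mul x hx
    | algebraMap r => intro y hy; rw [← Algebra.smul_def]; exact S.smul_mem r hy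
    | add x z _ _ hx hz => intro y hy; rw [add_mul]; exact S.add_mem (hx y hy) (hz y hy)
    | mul x z _ _ hx hz => intro y hy; rw [mul_assoc]; exact hx _ (hz y hy)
  intro x hx
  simpa using key x hx 1 one

theorem adjoin_range_mkAlgHom_ι {R X : Type*} [CommSemiring R]
    (r : FreeAlgebra R X → FreeAlgebra R X → Prop) :
    Algebra.adjoin R (Set.range fun x => RingQuot.mkAlgHom R r (FreeAlgebra.ι R x)) = ⊤ := by
  have h := congrArg (Subalgebra.map (RingQuot.mkAlgHom R r)) (FreeAlgebra.adjoin_range_ι R X)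
  rw [AlgHom.map_adjoin, Algebra.map_top,
    (AlgHom.range_eq_top _).2 (RingQuot.mkAlgHom_surjective R r), ← Set.range_comp] at h
  exact h

section Hecke

variable {n : ℕ}

-- Instance search does not find these general facts over the iterated polynomial ring `GroundRing`.
instance instIsScalarTowerHecke : IsScalarTower GroundRing (Hecke n) (Hecke n) :=
  IsScalarTower.right (R := GroundRing) (A := Hecke n)

instance instSMulCommClassHecke : SMulCommClass GroundRing (Hecke n) (Hecke n) :=
  Algebra.to_smulCommClass (R := GroundRing) (A := Hecke n)

instance instModuleHecke : Module GroundRing (Hecke n) := Algebra.toModule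

theorem heckeT_comm {i j : Fin (n - 1)} (h : (i : ℕ) + 1 < j) :
    heckeT i * heckeT j = heckeT j * heckeT i := by
  simpa [heckeT] using RingQuot.mkAlgHom_rel GroundRing (HeckeRel.comm i j (Or.inl h))

theorem heckeT_braid {i j : Fin (n - 1)} (h : (j : ℕ) = i + 1) :
    heckeT i * heckeT j * heckeT i = heckeT j * heckeT i * heckeT j := by
  simpa [heckeT] using RingQuot.mkAlgHom_rel GroundRing (HeckeRel.braid i j h)

theorem heckeT_mul_self (i : Fin (n - 1)) :
    heckeT i * heckeT i = u ^ 2 • (1 : Hecke n) + v • heckeT i := by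
  have := RingQuot.mkAlgHom_rel GroundRing (HeckeRel.quad i)
  rw [map_add, AlgHom.commutes, map_smul, map_pow, sq, Algebra.algebraMap_eq_smul_one] at this
  exact this

/-- The normalised generator `u⁻¹ T_i`. -/
def heckeTn (i : Fin (n - 1)) : Hecke n := uInv • heckeT i

theorem heckeT_eq (i : Fin (n - 1)) : heckeT i = u • heckeTn i := by
  rw [heckeTn, smul_smul, u_mul_uInv, one_smul]

theorem isBraided_heckeTn : IsBraided (heckeTn (n := n)) where
  comm i j h := by simp only [heckeTn, smul_mul_smul_comm, heckeT_comm h]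
  braid i j h := by simp only [heckeTn, smul_mul_smul_comm, heckeT_braid h]

theorem prod_map_smul {R A X : Type*} [CommSemiring R] [Semiring A] [Algebra R A] (r : R)
    (f : X → A) (l : List X) : (l.map fun i => r • f i).prod = r ^ l.length • (l.map f).prod := by
  induction l with
  | nil => simp
  | cons i l ih =>
    rw [List.map_cons, List.prod_cons, ih, smul_mul_smul_comm, List.map_cons, List.prod_cons,
      List.length_cons, pow_succ']

theorem heckeTt_eq (w : Equiv.Perm (Fin n)) : heckeTt w = prodRed heckeTn w :=
  (prod_map_smul uInv heckeT (reducedWord w)).symm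

theorem heckeTt_one : heckeTt (1 : Equiv.Perm (Fin n)) = 1 := by rw [heckeTt_eq, prodRed_one]

theorem heckeTt_simpleRefl (i : Fin (n - 1)) : heckeTt (simpleRefl i) = heckeTn i := by
  rw [heckeTt_eq, isBraided_heckeTn.prodRed_simpleRefl]

theorem smul_mul_smul_of_quadratic {K A : Type*} [CommSemiring K] [Semiring A] [Algebra K A]
    {r s q : K} (h : r * s = 1) {x y : A} (hx : x * x = s ^ 2 • (1 : A) + q • y) :
    (r • x) * (r • x) = 1 + (q * r) • (r • y) := by
  rw [smul_mul_smul_comm, hx, smul_add, smul_smul, smul_smul, smul_smul,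
    show r * r * s ^ 2 = (r * s) * (r * s) by ring, h, one_mul, one_smul,
    show r * r * q = q * r * r by ring]

theorem heckeTn_mul_self (i : Fin (n - 1)) :
    heckeTn i * heckeTn i = 1 + (v * uInv) • heckeTn i :=
  smul_mul_smul_of_quadratic uInv_mul_u (heckeT_mul_self i)

/-- The multiplication rule for the products along reduced expressions, under braid and quadratic
relations. The indicator is that of a descent, as all letters have the same colour. -/
theorem IsBraided.mul_prodRed {K A : Type*} [CommSemiring K] [Semiring A] [Algebra K A]
    {x : Fin (n - 1) → A} (hx : IsBraided x) {q : K} (hq : ∀ i, x i * x i = 1 + q • x i)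
    (i : Fin (n - 1)) (w : Equiv.Perm (Fin n)) :
    x i * prodRed x w = prodRed x (simpleRefl i * w) +
      (q * colInd K (fun _ => ()) (w⁻¹ (lo i)) (w⁻¹ (hi i))) • prodRed x w := by
  rcases inv_lo_lt_or_gt i w⁻¹ with h | h
  · rw [colInd_of_lt _ h, hx.prodRed_simpleRefl_mul h, mul_zero, zero_smul, add_zero]
  · rw [colInd_of_gt _ h rfl, mul_one]
    have e := hx.prodRed_simpleRefl_mul (w := simpleRefl i * w) (i := i)
      (by simpa using h)
    rw [simpleRefl_mul_cancel] at e
    rw [e, ← mul_assoc, hq, add_mul, one_mul, smul_mul_assoc]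

/-- The multiplication rule `T_i T̃_w`, normalised. The colouring is constant. -/
theorem heckeTn_mul_heckeTt (i : Fin (n - 1)) (w : Equiv.Perm (Fin n)) :
    heckeTn i * heckeTt w = heckeTt (simpleRefl i * w) +
      (v * uInv * colInd GroundRing (fun _ => ()) (w⁻¹ (lo i)) (w⁻¹ (hi i))) • heckeTt w := by
  simp only [heckeTt_eq]
  exact isBraided_heckeTn.mul_prodRed heckeTn_mul_self i w

variable (n) in
/-- The regular representation of the Hecke algebra, in the basis indexed by permutations. -/
def heckeRep : Hecke n →ₐ[GroundRing] Module.End GroundRing (Equiv.Perm (Fin n) →₀ GroundRing) :=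
  RingQuot.liftAlgHom GroundRing
    ⟨FreeAlgebra.lift GroundRing (stepOp u v fun _ => ()), fun x y h => by
      cases h with
      | comm i j h =>
        simp only [map_mul, FreeAlgebra.lift_ι_apply]
        rcases h with h | h
        · exact stepOp_mul_of_lt u v _ h
        · exact (stepOp_mul_of_lt u v _ h).symm
      | braid i j h =>
        simp only [map_mul, FreeAlgebra.lift_ι_apply]
        exact stepOp_braid u v _ h
      | quad i =>
        simp only [map_pow, map_add, map_smul, AlgHom.commutes, FreeAlgebra.lift_ι_apply]
        refine Finsupp.lhom_ext' fun w => LinearMap.ext_ring ?_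
        have := stepOp_sq_single u v (fun _ : Fin n => ()) i w
        simpa [sq, Module.algebraMap_end_apply] using this⟩

theorem heckeRep_heckeT (i : Fin (n - 1)) :
    heckeRep n (heckeT i) = stepOp u v (fun _ => ()) i := by
  simp [heckeRep, heckeT]

/-- The coordinates of an element of the Hecke algebra in the basis of the `T̃_w`. -/
def heckeCoord : Hecke n →ₗ[GroundRing] (Equiv.Perm (Fin n) →₀ GroundRing) :=
  (LinearMap.applyₗ (single 1 1)).comp (heckeRep n).toLinearMap

theorem heckeCoord_heckeTt (w : Equiv.Perm (Fin n)) : heckeCoord (heckeTt w) = single w 1 := by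
  change heckeRep n (heckeTt w) (single 1 1) = _
  induction w using perm_induction with
  | one => rw [heckeTt_one, map_one, Module.End.one_apply]
  | mul i w h ih =>
    have e : heckeTt (simpleRefl i * w) = heckeTn i * heckeTt w := by
      rw [heckeTn_mul_heckeTt, colInd_of_lt _ h, mul_zero, zero_smul, add_zero]
    rw [e, map_mul, Module.End.mul_apply, ih, heckeTn, map_smul, heckeRep_heckeT,
      LinearMap.smul_apply, stepOp_single, colInd_of_lt _ h, mul_zero, zero_smul, add_zero,
      smul_smul, uInv_mul_u, one_smul]

theorem span_heckeTt : Submodule.span GroundRing (Set.range (heckeTt (n := n))) = ⊤ := by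
  rw [eq_top_iff, ← Algebra.top_toSubmodule,
    ← adjoin_range_mkAlgHom_ι (R := GroundRing) (HeckeRel n)]
  refine adjoin_le_of_left_stable (Submodule.subset_span ⟨1, heckeTt_one⟩) ?_
  rintro _ ⟨i, rfl⟩ y hy
  change heckeT i * y ∈ _
  induction hy using Submodule.span_induction with
  | mem y hy =>
    obtain ⟨w, rfl⟩ := hy
    rw [heckeT_eq, smul_mul_assoc, heckeTn_mul_heckeTt]
    exact Submodule.smul_mem _ _ (Submodule.add_mem _ (Submodule.subset_span ⟨_, rfl⟩)
      (Submodule.smul_mem _ _ (Submodule.subset_span ⟨_, rfl⟩)))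
  | zero => simp
  | add y z _ _ hy hz => rw [mul_add]; exact Submodule.add_mem _ hy hz
  | smul r y _ hy => rw [mul_smul_comm]; exact Submodule.smul_mem _ _ hy

theorem linearCombination_heckeCoord (x : Hecke n) :
    linearCombination GroundRing heckeTt (heckeCoord x) = x := by
  have h : (linearCombination GroundRing heckeTt).comp heckeCoord =
      (LinearMap.id : Hecke n →ₗ[GroundRing] Hecke n) := by
    refine LinearMap.ext_on_range span_heckeTt fun w => ?_
    simp [heckeCoord_heckeTt]
  exact LinearMap.congr_fun h x

theorem heckeCoord_injective : Function.Injective (heckeCoord (n := n)) := fun x y h => by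
  rw [← linearCombination_heckeCoord x, h, linearCombination_heckeCoord]

/-- The linear map with prescribed values on the `T̃_w`. -/
def heckeLift {M : Type*} [AddCommMonoid M] [Module GroundRing M] (f : Equiv.Perm (Fin n) → M) :
    Hecke n →ₗ[GroundRing] M := (linearCombination GroundRing f).comp heckeCoord

theorem heckeLift_heckeTt {M : Type*} [AddCommMonoid M] [Module GroundRing M]
    (f : Equiv.Perm (Fin n) → M) (w : Equiv.Perm (Fin n)) : heckeLift f (heckeTt w) = f w := by
  simp [heckeLift, heckeCoord_heckeTt]

variable {d : ℕ} {μ : Comp d n}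

theorem simpleRefl_mem_young {i : Fin (n - 1)} (h : i ∈ μ.innerIdx) : simpleRefl i ∈ young μ :=
  mem_young_iff.2 (permChar_simpleRefl_eq_self (μ.mem_innerIdx_iff.1 h))

/-- Induction on the length within a Young subgroup. -/
theorem young_induction {p : Equiv.Perm (Fin n) → Prop} (one : p 1)
    (mul : ∀ i ∈ μ.innerIdx, ∀ w ∈ young μ, w⁻¹ (lo i) < w⁻¹ (hi i) → p w →
      p (simpleRefl i * w)) (w : Equiv.Perm (Fin n)) (hw : w ∈ young μ) : p w := by
  induction w using perm_induction with
  | one => exact one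
  | mul i w h ih =>
    -- the letters moved by `s_i` form an inversion of the inverse, hence lie in the same block
    have hi' : i ∈ μ.innerIdx := by
      rw [μ.mem_innerIdx_iff]
      have h₁ := (young μ).inv_mem hw
      refine le_antisymm (μ.block_mono (lo_lt_hi i).le) ?_
      have h₂ := h₁ (lo i)
      have h₃ := h₁ (hi i)
      have h₄ := μ.block_mono h.le
      rw [mul_inv_rev, simpleRefl_inv, Equiv.Perm.mul_apply] at h₂ h₃
      rw [simpleRefl_lo] at h₂
      rw [simpleRefl_hi] at h₃
      rwa [h₂, h₃] at h₄
    have hw' : w ∈ young μ := ((young μ).mul_mem_cancel_left (simpleRefl_mem_young hi')).1 hw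
    exact mul i hi' w hw' h (ih hw')

theorem heckeTt_mem_heckeSub {w : Equiv.Perm (Fin n)} (hw : w ∈ young μ) :
    heckeTt w ∈ heckeSub μ := by
  refine young_induction (μ := μ) (p := fun w => heckeTt w ∈ heckeSub μ) ?_ ?_ w hw
  · rw [heckeTt_one]; exact one_mem _
  · intro i hi' w _ h ih
    rw [heckeTt_eq, isBraided_heckeTn.prodRed_simpleRefl_mul h, ← heckeTt_eq]
    have hT : heckeT i ∈ heckeSub μ := Algebra.subset_adjoin ⟨i, hi', rfl⟩
    exact mul_mem (Subalgebra.smul_mem _ hT _) ih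

/-- `T̃_w`, for `w` in the Young subgroup, as an element of `H^μ`. -/
def subTt (w : young μ) : heckeSub μ := ⟨heckeTt w.1, heckeTt_mem_heckeSub w.2⟩

theorem heckeSub_le_span :
    Subalgebra.toSubmodule (heckeSub μ) ≤
      Submodule.span GroundRing (heckeTt '' (young μ : Set _)) := by
  refine adjoin_le_of_left_stable
    (Submodule.subset_span ⟨1, one_mem (young μ), heckeTt_one⟩) ?_
  rintro _ ⟨i, hi', rfl⟩ y hy
  induction hy using Submodule.span_induction with
  | mem y hy =>
    obtain ⟨w, hw, rfl⟩ := hy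
    rw [heckeT_eq, smul_mul_assoc, heckeTn_mul_heckeTt]
    exact Submodule.smul_mem _ _ (Submodule.add_mem _
      (Submodule.subset_span ⟨_, mul_mem (simpleRefl_mem_young hi') hw, rfl⟩)
      (Submodule.smul_mem _ _ (Submodule.subset_span ⟨_, hw, rfl⟩)))
  | zero => simp
  | add y z _ _ hy hz => rw [mul_add]; exact Submodule.add_mem _ hy hz
  | smul r y _ hy => rw [mul_smul_comm]; exact Submodule.smul_mem _ _ hy

theorem subTt_one : subTt (⟨1, one_mem _⟩ : young μ) = 1 := Subtype.ext heckeTt_one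

theorem span_subTt : Submodule.span GroundRing (Set.range (subTt (μ := μ))) = ⊤ := by
  rw [eq_top_iff]
  rintro ⟨x, hx⟩ -
  have h := heckeSub_le_span hx
  have e : (heckeTt '' (young μ : Set (Equiv.Perm (Fin n)))) =
      (heckeSub μ).val.toLinearMap '' Set.range (subTt (μ := μ)) := by
    ext y
    constructor
    · rintro ⟨w, hw, rfl⟩
      exact ⟨subTt ⟨w, hw⟩, ⟨_, rfl⟩, rfl⟩
    · rintro ⟨_, ⟨w, rfl⟩, rfl⟩
      exact ⟨w.1, w.2, rfl⟩
  rw [e, Submodule.span_image] at h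
  obtain ⟨y, hy, rfl⟩ := h
  exact hy

end Hecke

/-! ### Projections attached to roots of unity -/

/-- `ξ` enumerates the `d`-th roots of unity. -/
structure IsRootEnum {d : ℕ} (ξ : Fin d → ℂ) : Prop where
  pos : 1 ≤ d
  inj : Function.Injective ξ
  range : ∀ z : ℂ, z ∈ Set.range ξ ↔ z ^ d = 1

/-- A complex number as an element of the ground ring. -/
abbrev cst : ℂ →+* GroundRing := algebraMap ℂ GroundRing

theorem IsRootEnum.pow_eq_one {d : ℕ} {ξ : Fin d → ℂ} (hξ : IsRootEnum ξ) (a : Fin d) :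
    ξ a ^ d = 1 := (hξ.range _).1 ⟨a, rfl⟩

theorem inv_mul_sum_pow (K : Type*) [CommSemiring K] [Algebra ℂ K] {d : ℕ} (hd : 1 ≤ d) {z : ℂ}
    (hz : z ^ d = 1) :
    algebraMap ℂ K (d : ℂ)⁻¹ * ∑ s ∈ Finset.range d, algebraMap ℂ K (z ^ s) =
      if z = 1 then 1 else 0 := by
  have hd' : (d : ℂ) ≠ 0 := by exact_mod_cast (by omega : d ≠ 0)
  rw [← map_sum, ← map_mul]
  split_ifs with h
  · subst h
    simp [hd']
  · have : ∑ s ∈ Finset.range d, z ^ s = 0 := by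
      rw [geom_sum_eq h, hz, sub_self, zero_div]
    rw [this, mul_zero, map_zero]

theorem mul_pow_pred_eq_one_iff {d : ℕ} (hd : 1 ≤ d) {y z : ℂ} (hy : y ^ d = 1) :
    z * y ^ (d - 1) = 1 ↔ z = y := by
  have h : y ^ (d - 1) * y = 1 := by rw [← pow_succ, Nat.sub_add_cancel hd, hy]
  constructor
  · intro e
    calc z = z * (y ^ (d - 1) * y) := by rw [h, mul_one]
      _ = z * y ^ (d - 1) * y := by ring
      _ = y := by rw [e, one_mul]
  · rintro rfl
    rw [mul_comm, h]

theorem IsRootEnum.sum_pow {d : ℕ} {ξ : Fin d → ℂ} (hξ : IsRootEnum ξ) {s : ℕ} (hs : s < d) :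
    ∑ a, ξ a ^ s = if s = 0 then (d : ℂ) else 0 := by
  split_ifs with h
  · simp [h]
  · have hd : d ≠ 0 := by omega
    have hζ := Complex.isPrimitiveRoot_exp d hd
    set ζ := Complex.exp (2 * Real.pi * Complex.I / d)
    -- multiplication by a primitive root permutes the roots of unity
    have hmem : ∀ a, ∃ b, ξ b = ζ * ξ a := fun a =>
      (hξ.range _).2 (by rw [mul_pow, hζ.pow_eq_one, hξ.pow_eq_one, one_mul])
    choose f hf using hmem
    have hζ0 : ζ ≠ 0 := hζ.ne_zero hd
    have hfinj : Function.Injective f := fun a b e => by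
      have := hf a
      rw [e, hf b] at this
      exact hξ.inj (mul_left_cancel₀ hζ0 this).symm
    have hfb : Function.Bijective f := Finite.injective_iff_bijective.1 hfinj
    have e₁ : ∑ a, ξ a ^ s = ζ ^ s * ∑ a, ξ a ^ s := by
      conv_lhs => rw [← hfb.sum_comp fun a => ξ a ^ s]
      rw [Finset.mul_sum]
      exact Finset.sum_congr rfl fun a _ => by rw [hf, mul_pow]
    have h1 : ζ ^ s ≠ 1 := hζ.pow_ne_one_of_pos_of_lt h hs
    have h2 : (ζ ^ s - 1) * ∑ a, ξ a ^ s = 0 := by rw [sub_mul, one_mul, ← e₁, sub_self]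
    exact (mul_eq_zero.1 h2).resolve_left (sub_ne_zero.2 h1)

section Projections

variable {d : ℕ} {K : Type*} [CommSemiring K] [Algebra ℂ K] {A : Type*} [Semiring A]
  [Algebra K A]

/-- The projection `(1/d) ∑_s z^s t^{-s}` to the eigenspace of `t` for the eigenvalue `z`. -/
def projT (K : Type*) [CommSemiring K] [Algebra ℂ K] {A : Type*} [Semiring A] [Algebra K A]
    (d : ℕ) (z : ℂ) (t : A) : A :=
  algebraMap ℂ K (d : ℂ)⁻¹ • ∑ s ∈ Finset.range d, algebraMap ℂ K (z ^ s) • (t ^ (d - 1)) ^ s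

theorem mul_projT (hd : 1 ≤ d) {z : ℂ} (hz : z ^ d = 1) {t : A} (ht : t ^ d = 1) :
    t * projT K d z t = algebraMap ℂ K z • projT K d z t := by
  set x : A := algebraMap ℂ K z • t ^ (d - 1) with hx
  have hp : projT K d z t = algebraMap ℂ K (d : ℂ)⁻¹ • ∑ s ∈ Finset.range d, x ^ s := by
    rw [projT]
    congr 1
    exact Finset.sum_congr rfl fun s _ => by rw [hx, smul_pow, map_pow]
  have hxd : x ^ d = 1 := by
    rw [hx, smul_pow, ← map_pow, hz, ← pow_mul, mul_comm, pow_mul, ht, one_pow, map_one, one_smul]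
  have hxs : x * ∑ s ∈ Finset.range d, x ^ s = ∑ s ∈ Finset.range d, x ^ s := by
    obtain ⟨e, rfl⟩ : ∃ e, d = e + 1 := ⟨d - 1, by omega⟩
    rw [Finset.mul_sum]
    simp only [← pow_succ']
    rw [Finset.sum_range_succ, hxd, Finset.sum_range_succ' (fun s => x ^ s), pow_zero]
  have htx : t * x = algebraMap ℂ K z • 1 := by
    rw [hx, mul_smul_comm, ← pow_succ', Nat.sub_add_cancel hd, ht]
  rw [hp, mul_smul_comm, smul_comm (algebraMap ℂ K z) (algebraMap ℂ K (d : ℂ)⁻¹),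
    ← hxs, ← mul_assoc, htx, smul_mul_assoc, one_mul, hxs]

theorem sum_projT {ξ : Fin d → ℂ} (hξ : IsRootEnum ξ) (t : A) : ∑ a, projT K d (ξ a) t = 1 := by
  have hd' : (d : ℂ) ≠ 0 := by exact_mod_cast (by have := hξ.pos; omega : d ≠ 0)
  simp only [projT]
  rw [← Finset.smul_sum, Finset.sum_comm]
  simp only [← Finset.sum_smul, ← map_sum]
  rw [Finset.sum_eq_single_of_mem 0 (by have := hξ.pos; simp; omega)]
  · rw [hξ.sum_pow hξ.pos, if_pos rfl, pow_zero, smul_smul, ← map_mul,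
      inv_mul_cancel₀ hd', map_one, one_smul]
  · intro s hs h0
    rw [hξ.sum_pow (Finset.mem_range.1 hs), if_neg h0, map_zero, zero_smul]

variable {M : Type*} [AddCommMonoid M] [Module K M]
  (ρ : A →ₐ[K] Module.End K M)

theorem map_pow_apply_of_eigen {t : A} {y : ℂ} {m : M} (h : ρ t m = algebraMap ℂ K y • m) (k : ℕ) :
    ρ (t ^ k) m = algebraMap ℂ K (y ^ k) • m := by
  induction k with
  | zero => simp
  | succ k ih =>
    rw [pow_succ', map_mul, Module.End.mul_apply, ih, map_smul, h, smul_smul, ← map_mul,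
      ← pow_succ]

theorem projT_apply_of_eigen (hd : 1 ≤ d) {y z : ℂ} (hy : y ^ d = 1) (hz : z ^ d = 1) {t : A}
    {m : M} (h : ρ t m = algebraMap ℂ K y • m) : ρ (projT K d z t) m = if z = y then m else 0 := by
  have hzy : (z * y ^ (d - 1)) ^ d = 1 := by
    rw [mul_pow, hz, ← pow_mul, mul_comm (d - 1), pow_mul, hy, one_pow, one_mul]
  rw [projT, map_smul, map_sum, LinearMap.smul_apply, LinearMap.sum_apply]
  have : ∀ s, ρ (algebraMap ℂ K (z ^ s) • (t ^ (d - 1)) ^ s) m =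
      algebraMap ℂ K ((z * y ^ (d - 1)) ^ s) • m := by
    intro s
    rw [map_smul, LinearMap.smul_apply, ← pow_mul, map_pow_apply_of_eigen ρ h, smul_smul,
      ← map_mul, mul_pow, ← pow_mul]
  simp only [this]
  rw [← Finset.sum_smul, smul_smul, inv_mul_sum_pow K hd hzy]
  simp only [mul_pow_pred_eq_one_iff hd hy]
  split_ifs <;> simp

/-- The element `(1/d) ∑_s t^s t'^{-s}` is the projection to the vectors on which `t` and `t'` have
the same eigenvalue. -/
theorem sameEigen_apply_of_eigen (hd : 1 ≤ d) {y z : ℂ} (hy : y ^ d = 1) (hz : z ^ d = 1) {t t' : A}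
    {m : M} (h : ρ t m = algebraMap ℂ K z • m) (h' : ρ t' m = algebraMap ℂ K y • m) :
    ρ (algebraMap ℂ K (d : ℂ)⁻¹ • ∑ s ∈ Finset.range d, t ^ s * (t' ^ (d - 1)) ^ s) m =
      if z = y then m else 0 := by
  have hzy : (z * y ^ (d - 1)) ^ d = 1 := by
    rw [mul_pow, hz, ← pow_mul, mul_comm (d - 1), pow_mul, hy, one_pow, one_mul]
  rw [map_smul, map_sum, LinearMap.smul_apply, LinearMap.sum_apply]
  have : ∀ s, ρ (t ^ s * (t' ^ (d - 1)) ^ s) m =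
      algebraMap ℂ K ((z * y ^ (d - 1)) ^ s) • m := by
    intro s
    rw [map_mul, Module.End.mul_apply, ← pow_mul, map_pow_apply_of_eigen ρ h', map_smul,
      map_pow_apply_of_eigen ρ h, smul_smul, ← map_mul, mul_pow, ← pow_mul, mul_comm (z ^ s)]
  simp only [this]
  rw [← Finset.sum_smul, smul_smul, inv_mul_sum_pow K hd hzy]
  simp only [mul_pow_pred_eq_one_iff hd hy]
  split_ifs <;> simp

end Projections

theorem prod_ofFn_apply_of_eigen {K A M : Type*} [CommSemiring K] [Semiring A] [Algebra K A]
    [AddCommMonoid M] [Module K M] (ρ : A →ₐ[K] Module.End K M) {n : ℕ} {f : Fin n → A}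
    {k : Fin n → K} {m : M} (h : ∀ i, ρ (f i) m = k i • m) :
    ρ (List.ofFn f).prod m = (∏ i, k i) • m := by
  induction n with
  | zero => simp
  | succ n ih =>
    rw [List.ofFn_succ, List.prod_cons, map_mul, Module.End.mul_apply, ih fun i => h i.succ,
      map_smul, h, smul_smul, Fin.prod_univ_succ, mul_comm]

theorem mul_list_prod_of_mem {K A : Type*} [CommSemiring K] [Semiring A] [Algebra K A] {t : A}
    {k : K} {l : List A} (hc : ∀ x ∈ l, Commute t x) {y : A} (hy : y ∈ l) (h : t * y = k • y) :
    t * l.prod = k • l.prod := by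
  induction l with
  | nil => simp at hy
  | cons x l ih =>
    rw [List.prod_cons]
    rcases List.mem_cons.1 hy with rfl | hy
    · rw [← mul_assoc, h, smul_mul_assoc]
    · rw [← mul_assoc, (hc x (by simp)).eq, mul_assoc, ih (fun z hz => hc z (by simp [hz])) hy,
        mul_smul_comm]

/-- The distributive law for ordered products. -/
theorem sum_prod_ofFn {A : Type*} [Semiring A] {d n : ℕ} (f : Fin n → Fin d → A) :
    ∑ c : Fin n → Fin d, (List.ofFn fun i => f i (c i)).prod =
      (List.ofFn fun i => ∑ a, f i a).prod := by
  induction n with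
  | zero => simp
  | succ n ih =>
    rw [← (Fin.consEquiv fun _ => Fin d).sum_comp, Fintype.sum_prod_type]
    simp only [Fin.consEquiv_apply, List.ofFn_succ, Fin.cons_zero, Fin.cons_succ, List.prod_cons]
    simp only [← Finset.mul_sum]
    rw [ih fun i => f i.succ, Finset.sum_mul]

/-! ### The idempotents of the Yokonuma--Hecke algebra -/

section Yok

variable {d n : ℕ}

instance instIsScalarTowerYok : IsScalarTower GroundRing (Yok d n) (Yok d n) :=
  IsScalarTower.right (R := GroundRing) (A := Yok d n)

instance instSMulCommClassYok : SMulCommClass GroundRing (Yok d n) (Yok d n) :=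
  Algebra.to_smulCommClass (R := GroundRing) (A := Yok d n)

instance instModuleYok : Module GroundRing (Yok d n) := Algebra.toModule

theorem yokG_comm {i j : Fin (n - 1)} (h : (i : ℕ) + 1 < j) :
    yokG d i * yokG d j = yokG d j * yokG d i := by
  have := yok_rel (YokRel.comm (d := d) i j (Or.inl h))
  rwa [map_mul, map_mul] at this

theorem yokG_braid {i j : Fin (n - 1)} (h : (j : ℕ) = i + 1) :
    yokG d i * yokG d j * yokG d i = yokG d j * yokG d i * yokG d j := by
  have := yok_rel (YokRel.braid (d := d) i j h)
  rwa [map_mul, map_mul, map_mul, map_mul] at this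

theorem yokT_comm (i j : Fin n) : yokT d i * yokT d j = yokT d j * yokT d i := by
  have := yok_rel (YokRel.tcomm (d := d) i j)
  rwa [map_mul, map_mul] at this

theorem yokG_mul_yokT (i : Fin (n - 1)) (j : Fin n) :
    yokG d i * yokT d j = yokT d (simpleRefl i j) * yokG d i := by
  have := yok_rel (YokRel.gt (d := d) i j)
  rwa [map_mul, map_mul] at this

theorem yokT_pow (j : Fin n) : yokT d j ^ d = 1 := by
  have := yok_rel (YokRel.tpow (d := d) j)
  rwa [map_pow, map_one] at this

/-- The element `e_i`, the sum of the `E_χ` with `s_i(χ) = χ`. -/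
def yokE (d : ℕ) {n : ℕ} (i : Fin (n - 1)) : Yok d n :=
  oneOver d • ∑ s ∈ Finset.range d, yokT d (lo i) ^ s * (yokT d (hi i) ^ (d - 1)) ^ s

theorem mkAlgHom_freeE (i : Fin (n - 1)) :
    RingQuot.mkAlgHom GroundRing (YokRel d n) (freeE d i) = yokE d i := by
  rw [freeE, map_smul, map_sum]
  simp only [map_mul, map_pow]
  rfl

theorem yokG_mul_self (i : Fin (n - 1)) :
    yokG d i * yokG d i = u ^ 2 • (1 : Yok d n) + v • (yokE d i * yokG d i) := by
  have := yok_rel (YokRel.quad (d := d) i)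
  rw [map_add, AlgHom.commutes, map_smul, map_pow, sq, Algebra.algebraMap_eq_smul_one, map_mul,
    mkAlgHom_freeE] at this
  exact this

variable {ξ : Fin d → ℂ}

theorem idem_eq (c : Fin n → Fin d) :
    idem ξ c = (List.ofFn fun i => projT GroundRing d (ξ (c i)) (yokT d i)).prod := rfl

/-- On a common eigenvector of the `t_j`, the idempotents act as expected. -/
theorem idem_apply_of_eigen (hξ : IsRootEnum ξ) {M : Type*} [AddCommMonoid M] [Module GroundRing M]
    (ρ : Yok d n →ₐ[GroundRing] Module.End GroundRing M) {c : Fin n → Fin d} {m : M}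
    (h : ∀ j, ρ (yokT d j) m = cst (ξ (c j)) • m) (c' : Fin n → Fin d) :
    ρ (idem ξ c') m = if c' = c then m else 0 := by
  have h' : ∀ j, ρ (projT GroundRing d (ξ (c' j)) (yokT d j)) m =
      (if c' j = c j then (1 : GroundRing) else 0) • m := by
    intro j
    rw [projT_apply_of_eigen ρ hξ.pos (hξ.pow_eq_one _) (hξ.pow_eq_one _) (h j)]
    simp only [hξ.inj.eq_iff]
    split_ifs <;> simp
  rw [idem_eq, prod_ofFn_apply_of_eigen ρ h']
  split_ifs with e
  · simp [e]
  · obtain ⟨j, hj⟩ := Function.ne_iff.1 e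
    rw [Finset.prod_eq_zero (Finset.mem_univ j) (if_neg hj), zero_smul]

theorem yokT_mul_idem (hξ : IsRootEnum ξ) (j : Fin n) (c : Fin n → Fin d) :
    yokT d j * idem ξ c = cst (ξ (c j)) • idem ξ c := by
  rw [idem_eq]
  refine mul_list_prod_of_mem (y := projT GroundRing d (ξ (c j)) (yokT d j)) ?_ ?_
    (mul_projT hξ.pos (hξ.pow_eq_one _) (yokT_pow j))
  · intro x hx
    obtain ⟨i, rfl⟩ := (List.mem_ofFn' _ _).1 hx
    refine Commute.smul_right (Commute.sum_right _ _ _ fun s _ => ?_) _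
    exact Commute.smul_right (Commute.pow_right (Commute.pow_right (yokT_comm j i) _) _) _
  · exact (List.mem_ofFn' _ _).2 ⟨j, rfl⟩

theorem sum_idem (hξ : IsRootEnum ξ) : ∑ c, idem ξ c = (1 : Yok d n) := by
  simp only [idem_eq]
  rw [sum_prod_ofFn fun i a => projT GroundRing d (ξ a) (yokT d i)]
  simp [sum_projT hξ]

/-- An element on which the `t_j` act through a character is fixed by the idempotent of this
character and killed by the other ones. -/
theorem idem_mul_of_eigen (hξ : IsRootEnum ξ) {c : Fin n → Fin d} {y : Yok d n}
    (h : ∀ j, yokT d j * y = cst (ξ (c j)) • y) (c' : Fin n → Fin d) :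
    idem ξ c' * y = if c' = c then y else 0 :=
  idem_apply_of_eigen hξ (Algebra.lmul GroundRing (Yok d n)) h c'

theorem idem_mul_idem (hξ : IsRootEnum ξ) (c c' : Fin n → Fin d) :
    idem ξ c' * idem ξ c = if c' = c then idem ξ c else (0 : Yok d n) :=
  idem_mul_of_eigen hξ (fun j => yokT_mul_idem hξ j c) c'

theorem idem_mul_self (hξ : IsRootEnum ξ) (c : Fin n → Fin d) :
    idem ξ c * idem ξ c = (idem ξ c : Yok d n) := by rw [idem_mul_idem hξ, if_pos rfl]

theorem yokE_mul_idem (hξ : IsRootEnum ξ) (i : Fin (n - 1)) (c : Fin n → Fin d) :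
    yokE d i * idem ξ c = if c (lo i) = c (hi i) then idem ξ c else 0 := by
  have := sameEigen_apply_of_eigen (Algebra.lmul GroundRing (Yok d n)) hξ.pos (hξ.pow_eq_one _)
    (hξ.pow_eq_one _) (yokT_mul_idem hξ (lo i) c) (yokT_mul_idem hξ (hi i) c)
  simp only [hξ.inj.eq_iff] at this
  exact this

theorem yokG_mul_idem (hξ : IsRootEnum ξ) (i : Fin (n - 1)) (c : Fin n → Fin d) :
    yokG d i * idem ξ c = idem ξ (permChar (simpleRefl i) c) * yokG d i := by
  have key : ∀ c c', idem ξ c' * (yokG d i * idem ξ c) =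
      if c' = permChar (simpleRefl i) c then yokG d i * idem ξ c else 0 := by
    intro c c'
    refine idem_mul_of_eigen hξ (fun j => ?_) c'
    have h := yokG_mul_yokT (d := d) i (simpleRefl i j)
    rw [simpleRefl_simpleRefl] at h
    rw [← mul_assoc, ← h, mul_assoc, yokT_mul_idem hξ, mul_smul_comm, permChar, simpleRefl_inv]
  have e₁ : yokG d i * idem ξ c =
      idem ξ (permChar (simpleRefl i) c) * (yokG d i * idem ξ c) := by
    rw [key, if_pos rfl]
  have e₂ : idem ξ (permChar (simpleRefl i) c) * yokG d i =
      idem ξ (permChar (simpleRefl i) c) * (yokG d i * idem ξ c) := by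
    conv_lhs => rw [← mul_one (yokG d i), ← sum_idem hξ, Finset.mul_sum, Finset.mul_sum]
    refine Finset.sum_eq_single c (fun c' _ hne => ?_) (by simp)
    rw [key, if_neg]
    intro e
    refine hne ?_
    have := congrArg (permChar (simpleRefl i)) e
    rw [← permChar_mul, ← permChar_mul, simpleRefl_mul_self] at this
    exact this.symm
  rw [e₁, e₂]

/-! ### The standard basis of the Yokonuma--Hecke algebra -/

/-- The normalised generator `u⁻¹ g_i`. -/
def yokGn (d : ℕ) {n : ℕ} (i : Fin (n - 1)) : Yok d n := uInv • yokG d i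

theorem yokG_eq (i : Fin (n - 1)) : yokG d i = u • yokGn d i := by
  rw [yokGn, smul_smul, u_mul_uInv, one_smul]

theorem isBraided_yokGn : IsBraided (yokGn d (n := n)) where
  comm i j h := by simp only [yokGn, smul_mul_smul_comm, yokG_comm h]
  braid i j h := by simp only [yokGn, smul_mul_smul_comm, yokG_braid h]

theorem yokGt_eq (w : Equiv.Perm (Fin n)) : yokGt d w = prodRed (yokGn d) w :=
  (prod_map_smul uInv (yokG d) (reducedWord w)).symm

theorem yokGt_one : yokGt d (1 : Equiv.Perm (Fin n)) = 1 := by rw [yokGt_eq, prodRed_one]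

theorem yokGt_simpleRefl_mul {i : Fin (n - 1)} {w : Equiv.Perm (Fin n)}
    (h : w⁻¹ (lo i) < w⁻¹ (hi i)) : yokGt d (simpleRefl i * w) = yokGn d i * yokGt d w := by
  simp only [yokGt_eq, isBraided_yokGn.prodRed_simpleRefl_mul h]

theorem yokGt_mul_simpleRefl {i : Fin (n - 1)} {w : Equiv.Perm (Fin n)}
    (h : w (lo i) < w (hi i)) : yokGt d (w * simpleRefl i) = yokGt d w * yokGn d i := by
  simp only [yokGt_eq, isBraided_yokGn.prodRed_mul_simpleRefl h]

theorem yokGn_mul_idem (hξ : IsRootEnum ξ) (i : Fin (n - 1)) (c : Fin n → Fin d) :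
    yokGn d i * idem ξ c = idem ξ (permChar (simpleRefl i) c) * yokGn d i := by
  rw [yokGn, smul_mul_assoc, yokG_mul_idem hξ, mul_smul_comm]

theorem yokGt_mul_idem (hξ : IsRootEnum ξ) (w : Equiv.Perm (Fin n)) (c : Fin n → Fin d) :
    yokGt d w * idem ξ c = idem ξ (permChar w c) * yokGt d w := by
  induction w using perm_induction with
  | one => rw [yokGt_one, one_mul, mul_one, permChar_one]
  | mul i w h ih =>
    rw [yokGt_simpleRefl_mul h, mul_assoc, ih, ← mul_assoc, yokGn_mul_idem hξ, mul_assoc,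
      permChar_mul]

theorem yokGn_mul_self (i : Fin (n - 1)) :
    yokGn d i * yokGn d i = 1 + (v * uInv) • (yokE d i * yokGn d i) := by
  rw [yokGn, smul_mul_smul_of_quadratic uInv_mul_u (yokG_mul_self i), mul_smul_comm]

theorem yokGn_mul_self_mul_idem (hξ : IsRootEnum ξ) (i : Fin (n - 1)) (c : Fin n → Fin d) :
    yokGn d i * (yokGn d i * idem ξ c) = idem ξ c +
      (v * uInv * if c (lo i) = c (hi i) then 1 else 0) • (yokGn d i * idem ξ c) := by
  rw [← mul_assoc, yokGn_mul_self, add_mul, one_mul, smul_mul_assoc, mul_assoc, yokGn_mul_idem hξ,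
    ← mul_assoc, yokE_mul_idem hξ]
  have : (permChar (simpleRefl i) c (lo i) = permChar (simpleRefl i) c (hi i)) ↔
      c (lo i) = c (hi i) := by
    simp only [permChar, simpleRefl_inv, simpleRefl_lo, simpleRefl_hi]
    exact eq_comm
  simp only [this]
  split_ifs
  · rw [mul_one]
  · rw [zero_mul, smul_zero, mul_zero, zero_smul]

/-- The multiplication rule `g_i g̃_w E_χ`, normalised. -/
theorem yokGn_mul_yokGt_mul_idem (hξ : IsRootEnum ξ) (i : Fin (n - 1)) (w : Equiv.Perm (Fin n))
    (c : Fin n → Fin d) :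
    yokGn d i * (yokGt d w * idem ξ c) = yokGt d (simpleRefl i * w) * idem ξ c +
      (v * uInv * colInd GroundRing c (w⁻¹ (lo i)) (w⁻¹ (hi i))) • (yokGt d w * idem ξ c) := by
  rcases inv_lo_lt_or_gt i w⁻¹ with h | h
  · rw [colInd_of_lt _ h, yokGt_simpleRefl_mul h, mul_zero, zero_smul, add_zero, mul_assoc]
  · have e := yokGt_simpleRefl_mul (d := d) (w := simpleRefl i * w) (i := i) (by simpa using h)
    rw [simpleRefl_mul_cancel] at e
    have hc : colInd GroundRing c (w⁻¹ (lo i)) (w⁻¹ (hi i)) =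
        if permChar (simpleRefl i * w) c (lo i) = permChar (simpleRefl i * w) c (hi i)
          then 1 else 0 := by
      simp only [colInd, permChar, mul_inv_rev, simpleRefl_inv, Equiv.Perm.mul_apply,
        simpleRefl_lo, simpleRefl_hi, h, true_and]
      simp only [eq_comm]
    rw [e, mul_assoc, yokGt_mul_idem hξ, ← mul_assoc (yokGn d i) (idem ξ _),
      ← mul_assoc (yokGn d i), yokGn_mul_self_mul_idem hξ, add_mul, smul_mul_assoc, hc]

/-- `g̃_w g̃_i E_χ = g̃_{w s_i} E_χ` if `s_i` moves `χ`, without a condition on the lengths. -/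
theorem yokGt_mul_yokGn_mul_idem (hξ : IsRootEnum ξ) {i : Fin (n - 1)} (w : Equiv.Perm (Fin n))
    {c : Fin n → Fin d} (hc : c (lo i) ≠ c (hi i)) :
    yokGt d w * (yokGn d i * idem ξ c) = yokGt d (w * simpleRefl i) * idem ξ c := by
  rcases inv_lo_lt_or_gt i w with h | h
  · rw [yokGt_mul_simpleRefl h, mul_assoc]
  · have e := yokGt_mul_simpleRefl (d := d) (w := w * simpleRefl i) (i := i) (by simpa using h)
    rw [mul_simpleRefl_cancel] at e
    rw [e, mul_assoc, yokGn_mul_self_mul_idem hξ, if_neg hc, mul_zero, zero_smul, add_zero]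

theorem span_yokGt_mul_idem (hξ : IsRootEnum ξ) :
    Submodule.span GroundRing (Set.range fun p : Equiv.Perm (Fin n) × (Fin n → Fin d) =>
      yokGt d p.1 * idem ξ p.2) = ⊤ := by
  rw [eq_top_iff, ← Algebra.top_toSubmodule,
    ← adjoin_range_mkAlgHom_ι (R := GroundRing) (YokRel d n)]
  refine adjoin_le_of_left_stable ?_ ?_
  · rw [← sum_idem hξ]
    refine Submodule.sum_mem _ fun c _ => Submodule.subset_span ⟨(1, c), ?_⟩
    simp only [yokGt_one, one_mul]
  rintro _ ⟨x, rfl⟩ y hy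
  induction hy using Submodule.span_induction with
  | mem y hy =>
    obtain ⟨⟨w, c⟩, rfl⟩ := hy
    cases x with
    | inl i =>
      change yokG d i * (yokGt d w * idem ξ c) ∈ _
      rw [yokG_eq, smul_mul_assoc, yokGn_mul_yokGt_mul_idem hξ]
      exact Submodule.smul_mem _ _ (Submodule.add_mem _ (Submodule.subset_span ⟨(_, c), rfl⟩)
        (Submodule.smul_mem _ _ (Submodule.subset_span ⟨(w, c), rfl⟩)))
    | inr j =>
      change yokT d j * (yokGt d w * idem ξ c) ∈ _
      rw [yokGt_mul_idem hξ, ← mul_assoc, yokT_mul_idem hξ, smul_mul_assoc, ← yokGt_mul_idem hξ]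
      exact Submodule.smul_mem _ _ (Submodule.subset_span ⟨(w, c), rfl⟩)
  | zero => simp
  | add y z _ _ hy hz => rw [mul_add]; exact Submodule.add_mem _ hy hz
  | smul r y _ hy => rw [mul_smul_comm]; exact Submodule.smul_mem _ _ hy

end Yok

section DiagOp

variable {d n : ℕ} {K : Type*} [CommSemiring K] [Algebra ℂ K] {ξ : Fin d → ℂ}

/-- The operator by which `t_j` acts on the representation attached to the character `c`. -/
def diagOp (K : Type*) [CommSemiring K] [Algebra ℂ K] (ξ : Fin d → ℂ) (c : Fin n → Fin d)
    (j : Fin n) : Module.End K (Equiv.Perm (Fin n) →₀ K) :=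
  linearCombination K fun w => algebraMap ℂ K (ξ (c (w⁻¹ j))) • single w 1

theorem diagOp_single (c : Fin n → Fin d) (j : Fin n) (w : Equiv.Perm (Fin n)) :
    diagOp K ξ c j (single w 1) = algebraMap ℂ K (ξ (c (w⁻¹ j))) • single w 1 := by
  simp [diagOp]

theorem diagOp_comm (c : Fin n → Fin d) (i j : Fin n) :
    diagOp K ξ c i * diagOp K ξ c j = diagOp K ξ c j * diagOp K ξ c i := by
  refine Finsupp.lhom_ext' fun w => LinearMap.ext_ring ?_
  change diagOp K ξ c i (diagOp K ξ c j (single w 1)) =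
    diagOp K ξ c j (diagOp K ξ c i (single w 1))
  rw [diagOp_single, diagOp_single, map_smul, map_smul, diagOp_single, diagOp_single, smul_comm]

theorem diagOp_pow (hξ : IsRootEnum ξ) (c : Fin n → Fin d) (j : Fin n) :
    diagOp K ξ c j ^ d = 1 := by
  refine Finsupp.lhom_ext' fun w => LinearMap.ext_ring ?_
  have h := map_pow_apply_of_eigen (AlgHom.id K (Module.End K (Equiv.Perm (Fin n) →₀ K)))
    (diagOp_single (K := K) (ξ := ξ) c j w) d
  rw [hξ.pow_eq_one, map_one, one_smul] at h
  exact h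

theorem stepOp_mul_diagOp (u v : K) (c : Fin n → Fin d) (i : Fin (n - 1)) (j : Fin n) :
    stepOp u v c i * diagOp K ξ c j = diagOp K ξ c (simpleRefl i j) * stepOp u v c i := by
  refine Finsupp.lhom_ext' fun w => LinearMap.ext_ring ?_
  change stepOp u v c i (diagOp K ξ c j (single w 1)) =
    diagOp K ξ c (simpleRefl i j) (stepOp u v c i (single w 1))
  rw [diagOp_single, map_smul, stepOp_single, map_add, map_smul, map_smul, diagOp_single,
    diagOp_single, mul_inv_rev, simpleRefl_inv, Equiv.Perm.mul_apply, simpleRefl_simpleRefl,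
    smul_add, smul_comm u]
  congr 1
  by_cases h : c (w⁻¹ (lo i)) = c (w⁻¹ (hi i))
  · have e := congrFun (permChar_simpleRefl_eq_self (c := permChar w c) h) j
    simp only [permChar, simpleRefl_inv] at e
    rw [e, smul_comm]
  · rw [colInd_of_ne _ h, mul_zero, zero_smul, smul_zero, zero_smul]

end DiagOp

/-- The quadratic relation of `Y_{d,n}`, for any operator `E` that projects to the permutations `w`
such that `s_i` fixes `w(c)`. -/
theorem stepOp_sq {d n : ℕ} {K : Type*} [CommSemiring K] (u v : K) (c : Fin n → Fin d)
    (i : Fin (n - 1)) {E : Module.End K (Equiv.Perm (Fin n) →₀ K)}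
    (hE : ∀ w, E (single w 1) = if c (w⁻¹ (lo i)) = c (w⁻¹ (hi i)) then single w 1 else 0) :
    stepOp u v c i ^ 2 = algebraMap K _ (u ^ 2) + v • (E * stepOp u v c i) := by
  refine Finsupp.lhom_ext' fun w => LinearMap.ext_ring ?_
  have e : E (stepOp u v c i (single w 1)) =
      (if c (w⁻¹ (lo i)) = c (w⁻¹ (hi i)) then (1 : K) else 0) • stepOp u v c i (single w 1) := by
    rw [stepOp_single, map_add, map_smul, map_smul, hE, hE]
    simp only [mul_inv_rev, simpleRefl_inv, Equiv.Perm.mul_apply, simpleRefl_lo,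
      simpleRefl_hi]
    by_cases h : c (w⁻¹ (lo i)) = c (w⁻¹ (hi i))
    · rw [if_pos h, if_pos h.symm, if_pos h, one_smul]
    · rw [if_neg h, if_neg (Ne.symm h), if_neg h, zero_smul, smul_zero, smul_zero, add_zero]
  change stepOp u v c i ((stepOp u v c i) (single w 1)) = u ^ 2 • single w 1 +
    v • E (stepOp u v c i (single w 1))
  rw [e, stepOp_sq_single, smul_smul]
  by_cases h : c (w⁻¹ (lo i)) = c (w⁻¹ (hi i))
  · simp only [if_pos h]
  · simp only [if_neg h]

section YokCoord

variable {d n : ℕ} {ξ : Fin d → ℂ}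

/-- The operators by which the generators act on the representation attached to `c`. -/
def opFamily (ξ : Fin d → ℂ) (c : Fin n → Fin d) :
    Fin (n - 1) ⊕ Fin n → Module.End GroundRing (Equiv.Perm (Fin n) →₀ GroundRing) :=
  Sum.elim (stepOp u v c) (diagOp GroundRing ξ c)

/-- The representation of the Yokonuma--Hecke algebra on the free module on the symmetric group in
which the `t_j` act on `w` through the character `w(c)`. It is the left ideal `Y_{d,n} E_c` in the
coordinates given by the `g̃_w E_c`. -/
def yokRep (hξ : IsRootEnum ξ) (c : Fin n → Fin d) :
    Yok d n →ₐ[GroundRing] Module.End GroundRing (Equiv.Perm (Fin n) →₀ GroundRing) :=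
  RingQuot.liftAlgHom GroundRing
    ⟨FreeAlgebra.lift GroundRing (opFamily ξ c), fun x y h => by
      have hG : ∀ i, FreeAlgebra.lift GroundRing (opFamily ξ c) (freeG i) =
          stepOp u v c i := fun i => FreeAlgebra.lift_ι_apply _ _
      have hT : ∀ j, FreeAlgebra.lift GroundRing (opFamily ξ c) (freeT j) =
          diagOp GroundRing ξ c j := fun j => FreeAlgebra.lift_ι_apply _ _
      generalize FreeAlgebra.lift GroundRing (opFamily ξ c) = ρ at *
      have hE : ∀ i w, ρ (freeE d i) (single w 1) =
          if c (w⁻¹ (lo i)) = c (w⁻¹ (hi i)) then single w 1 else 0 := by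
        intro i w
        have := sameEigen_apply_of_eigen ρ hξ.pos (hξ.pow_eq_one _) (hξ.pow_eq_one _)
          ((congrArg (fun f => f (single w 1)) (hT (lo i))).trans (diagOp_single c (lo i) w))
          ((congrArg (fun f => f (single w 1)) (hT (hi i))).trans (diagOp_single c (hi i) w))
        simp only [hξ.inj.eq_iff] at this
        exact this
      cases h with
      | comm i j h =>
        simp only [map_mul, hG]
        rcases h with h | h
        · exact stepOp_mul_of_lt u v c h
        · exact (stepOp_mul_of_lt u v c h).symm
      | braid i j h =>
        simp only [map_mul, hG]
        exact stepOp_braid u v c h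
      | tcomm i j =>
        simp only [map_mul, hT]
        exact diagOp_comm c i j
      | gt i j =>
        simp only [map_mul, hG, hT]
        exact stepOp_mul_diagOp u v c i j
      | tpow j =>
        simp only [map_pow, map_one, hT]
        exact diagOp_pow hξ c j
      | quad i =>
        rw [map_pow, hG, map_add, AlgHom.commutes, map_smul, map_mul, hG]
        exact stepOp_sq u v c i (hE i)⟩

theorem yokRep_yokG (hξ : IsRootEnum ξ) (c : Fin n → Fin d) (i : Fin (n - 1)) :
    yokRep hξ c (yokG d i) = stepOp u v c i := by
  simp [yokRep, yokG, freeG, opFamily]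

theorem yokRep_yokT (hξ : IsRootEnum ξ) (c : Fin n → Fin d) (j : Fin n) :
    yokRep hξ c (yokT d j) = diagOp GroundRing ξ c j := by
  simp [yokRep, yokT, freeT, opFamily]

/-- The coordinates of an element of the Yokonuma--Hecke algebra at the basis elements
`g̃_w E_c`, for a fixed character `c`. -/
def yokCoord (hξ : IsRootEnum ξ) (c : Fin n → Fin d) :
    Yok d n →ₗ[GroundRing] (Equiv.Perm (Fin n) →₀ GroundRing) :=
  (LinearMap.applyₗ (single 1 1)).comp (yokRep hξ c).toLinearMap

theorem yokRep_yokGt (hξ : IsRootEnum ξ) (c : Fin n → Fin d) (w : Equiv.Perm (Fin n)) :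
    yokRep hξ c (yokGt d w) (single 1 1) = single w 1 := by
  induction w using perm_induction with
  | one => rw [yokGt_one, map_one, Module.End.one_apply]
  | mul i w h ih =>
    rw [yokGt_simpleRefl_mul h, map_mul, Module.End.mul_apply, ih, yokGn, map_smul, yokRep_yokG,
      LinearMap.smul_apply, stepOp_single, colInd_of_lt _ h, mul_zero, zero_smul, add_zero,
      smul_smul, uInv_mul_u, one_smul]

theorem yokCoord_yokGt_mul_idem (hξ : IsRootEnum ξ) (c c' : Fin n → Fin d)
    (w : Equiv.Perm (Fin n)) :
    yokCoord hξ c (yokGt d w * idem ξ c') = if c' = c then single w 1 else 0 := by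
  change yokRep hξ c (yokGt d w * idem ξ c') (single 1 1) = _
  have h : ∀ j, yokRep hξ c (yokT d j) (single 1 1) = cst (ξ (c j)) • single 1 1 := fun j => by
    rw [yokRep_yokT, diagOp_single, inv_one, Equiv.Perm.one_apply]
  rw [map_mul, Module.End.mul_apply, idem_apply_of_eigen hξ _ h]
  split_ifs
  · exact yokRep_yokGt hξ c w
  · exact map_zero _

end YokCoord

/-! ### Multiplication by minimal coset representatives -/

section Moves

variable {d n : ℕ} {ξ : Fin d → ℂ}

/-- A product `g̃_i g̃_w E_χ` is `g̃_{s_i w} E_χ`, without a condition on the lengths, if `s_i` moves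
the character `w(χ)`. -/
theorem yokGn_mul_yokGt_mul_idem_of_ne (hξ : IsRootEnum ξ) {i : Fin (n - 1)}
    (w : Equiv.Perm (Fin n)) {c : Fin n → Fin d} (hc : permChar w c (lo i) ≠ permChar w c (hi i)) :
    yokGn d i * (yokGt d w * idem ξ c) = yokGt d (simpleRefl i * w) * idem ξ c := by
  have hc' : c (w⁻¹ (lo i)) ≠ c (w⁻¹ (hi i)) := hc
  rw [yokGn_mul_yokGt_mul_idem hξ, colInd_of_ne _ hc', mul_zero, zero_smul, add_zero]

/-- Along a word whose letters all move the character, `g̃` multiplies from the left without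
correction terms, whether or not the lengths add. -/
theorem Moves.prod_mul (hξ : IsRootEnum ξ) {l : List (Fin (n - 1))} {c c' : Fin n → Fin d}
    (hl : Moves c' l) {y : Equiv.Perm (Fin n)} (hy : permChar y c = c') :
    (l.map (yokGn d)).prod * (yokGt d y * idem ξ c) = yokGt d (wordProd l * y) * idem ξ c := by
  induction l with
  | nil => simp [wordProd_nil]
  | cons i l ih =>
    rw [List.map_cons, List.prod_cons, mul_assoc, ih hl.1, yokGn_mul_yokGt_mul_idem_of_ne hξ,
      wordProd_cons, mul_assoc]
    rw [permChar_mul, hy]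
    exact hl.2

/-- The analogue of `Moves.prod_mul` for multiplication from the right. -/
theorem Moves.mul_prod (hξ : IsRootEnum ξ) {l : List (Fin (n - 1))} {c : Fin n → Fin d}
    (hl : Moves c l) (y : Equiv.Perm (Fin n)) :
    yokGt d y * ((l.map (yokGn d)).prod * idem ξ c) = yokGt d (y * wordProd l) * idem ξ c := by
  induction l generalizing y with
  | nil => simp [wordProd_nil]
  | cons i l ih =>
    have h₁ : ∀ l : List (Fin (n - 1)), (l.map (yokGn d)).prod * idem ξ c =
        idem ξ (permChar (wordProd l) c) * (l.map (yokGn d)).prod := by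
      intro l
      induction l with
      | nil => simp [wordProd_nil]
      | cons i l ih =>
        rw [List.map_cons, List.prod_cons, mul_assoc, ih, ← mul_assoc, yokGn_mul_idem hξ,
          mul_assoc, wordProd_cons, permChar_mul]
    -- the idempotent is moved to the left of `l`, where `s_i` moves its character
    have e : idem ξ (permChar (wordProd l) c) * ((l.map (yokGn d)).prod * idem ξ c) =
        (l.map (yokGn d)).prod * idem ξ c := by
      rw [h₁, ← mul_assoc, idem_mul_self hξ]
    rw [List.map_cons, List.prod_cons, mul_assoc, ← e, ← mul_assoc, ← mul_assoc (yokGt d y * _),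
      mul_assoc (yokGt d y), yokGt_mul_yokGn_mul_idem hξ y hl.2, mul_assoc, e, ih hl.1,
      wordProd_cons, mul_assoc]

variable {μ : Comp d n}

theorem yokGt_minRep_mul (hξ : IsRootEnum ξ) (χ : Orbit μ) {c : Fin n → Fin d}
    {y : Equiv.Perm (Fin n)} (hy : permChar y c = chiOne μ) :
    yokGt d (minRep χ) * (yokGt d y * idem ξ c) = yokGt d (minRep χ * y) * idem ξ c := by
  have := (moves_minRep χ).prod_mul hξ hy
  rw [wordProd_reducedWord] at this
  rw [yokGt_eq (minRep χ)]
  exact this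

theorem yokGt_minRep_inv_mul (hξ : IsRootEnum ξ) (χ : Orbit μ) {c : Fin n → Fin d}
    {y : Equiv.Perm (Fin n)} (hy : permChar y c = χ.1) :
    yokGt d (minRep χ)⁻¹ * (yokGt d y * idem ξ c) = yokGt d ((minRep χ)⁻¹ * y) * idem ξ c := by
  have := (moves_minRep_inv χ).prod_mul hξ hy
  rw [wordProd_reducedWord] at this
  rw [yokGt_eq (minRep χ)⁻¹]
  exact this

theorem yokGt_mul_minRep_inv (hξ : IsRootEnum ξ) (χ : Orbit μ) (y : Equiv.Perm (Fin n)) :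
    yokGt d y * (yokGt d (minRep χ)⁻¹ * idem ξ χ.1) = yokGt d (y * (minRep χ)⁻¹) * idem ξ χ.1 := by
  have := (moves_minRep_inv χ).mul_prod hξ y
  rw [wordProd_reducedWord] at this
  rw [yokGt_eq (minRep χ)⁻¹]
  exact this

end Moves

/-! ### The corners at the distinguished characters -/

section Iso

variable {d n : ℕ} {ξ : Fin d → ℂ}

instance instIsScalarTowerSub (μ : Comp d n) :
    IsScalarTower GroundRing (heckeSub μ) (heckeSub μ) :=
  IsScalarTower.right (R := GroundRing) (A := heckeSub μ)

instance instSMulCommClassSub (μ : Comp d n) :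
    SMulCommClass GroundRing (heckeSub μ) (heckeSub μ) :=
  Algebra.to_smulCommClass (R := GroundRing) (A := heckeSub μ)

/-- The linear map `H_n → Y_{d,n}`, `T̃_w ↦ g̃_w E_c`. -/
def cornerMap (ξ : Fin d → ℂ) (c : Fin n → Fin d) : Hecke n →ₗ[GroundRing] Yok d n :=
  heckeLift fun w => yokGt d w * idem ξ c

theorem cornerMap_heckeTt (c : Fin n → Fin d) (w : Equiv.Perm (Fin n)) :
    cornerMap ξ c (heckeTt w) = yokGt d w * idem ξ c := heckeLift_heckeTt _ _

theorem cornerMap_mul_idem (hξ : IsRootEnum ξ) (c : Fin n → Fin d) (x : Hecke n) :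
    cornerMap ξ c x * idem ξ c = cornerMap ξ c x := by
  have h : (LinearMap.mulRight GroundRing (idem ξ c)).comp (cornerMap ξ c) = cornerMap ξ c := by
    refine LinearMap.ext_on_range span_heckeTt fun w => ?_
    change cornerMap ξ c (heckeTt w) * idem ξ c = cornerMap ξ c (heckeTt w)
    rw [cornerMap_heckeTt, mul_assoc, idem_mul_self hξ]
  exact LinearMap.congr_fun h x

theorem cornerMap_injective (hξ : IsRootEnum ξ) (c : Fin n → Fin d) :
    Function.Injective (cornerMap ξ c) := by
  have h : (yokCoord hξ c).comp (cornerMap ξ c) = heckeCoord := by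
    refine LinearMap.ext_on_range span_heckeTt fun w => ?_
    rw [LinearMap.comp_apply, cornerMap_heckeTt, yokCoord_yokGt_mul_idem, if_pos rfl,
      heckeCoord_heckeTt]
  intro x y e
  apply heckeCoord_injective
  rw [← h, LinearMap.comp_apply, e, LinearMap.comp_apply]

variable (ξ) in
/-- The map `H^μ → E_{χ_1} Y_{d,n} E_{χ_1}`, `T̃_w ↦ g̃_w E_{χ_1}`, for `χ_1 = χ_1^μ`. -/
def subCorner (μ : Comp d n) : heckeSub μ →ₗ[GroundRing] Yok d n :=
  (cornerMap ξ (chiOne μ)).comp (heckeSub μ).val.toLinearMap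

variable {μ : Comp d n}

theorem subCorner_subTt (w : young μ) :
    subCorner ξ μ (subTt w) = yokGt d w.1 * idem ξ (chiOne μ) := cornerMap_heckeTt _ _

theorem subCorner_injective (hξ : IsRootEnum ξ) : Function.Injective (subCorner ξ μ) :=
  (cornerMap_injective hξ _).comp Subtype.val_injective

theorem subCorner_mul_idem (hξ : IsRootEnum ξ) (x : heckeSub μ) :
    subCorner ξ μ x * idem ξ (chiOne μ) = subCorner ξ μ x := cornerMap_mul_idem hξ _ _

theorem idem_mul_subCorner (hξ : IsRootEnum ξ) (x : heckeSub μ) :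
    idem ξ (chiOne μ) * subCorner ξ μ x = subCorner ξ μ x := by
  have h : (LinearMap.mulLeft GroundRing (idem ξ (chiOne μ))).comp (subCorner ξ μ) =
      subCorner ξ μ := by
    refine LinearMap.ext_on_range span_subTt fun w => ?_
    change idem ξ (chiOne μ) * subCorner ξ μ (subTt w) = subCorner ξ μ (subTt w)
    rw [subCorner_subTt, yokGt_mul_idem hξ, mem_young_iff.1 w.2, ← mul_assoc, idem_mul_self hξ]
  exact LinearMap.congr_fun h x

/-- As elements of the Young subgroup fix `χ_1^μ`, the multiplication rules of the `T̃_w` and of the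
`g̃_w E_{χ_1^μ}` agree. -/
theorem subCorner_mul (hξ : IsRootEnum ξ) (x y : heckeSub μ) :
    subCorner ξ μ (x * y) = subCorner ξ μ x * subCorner ξ μ y := by
  have gen : ∀ i ∈ μ.innerIdx, ∀ (hT : heckeTn i ∈ heckeSub μ) (y : heckeSub μ),
      subCorner ξ μ (⟨heckeTn i, hT⟩ * y) = yokGn d i * subCorner ξ μ y := by
    intro i hi' hT y
    have h : (subCorner ξ μ).comp (LinearMap.mulLeft GroundRing ⟨heckeTn i, hT⟩) =
        (LinearMap.mulLeft GroundRing (yokGn d i)).comp (subCorner ξ μ) := by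
      refine LinearMap.ext_on_range span_subTt fun w => ?_
      change cornerMap ξ (chiOne μ) (heckeTn i * heckeTt w.1) =
        yokGn d i * subCorner ξ μ (subTt w)
      rw [subCorner_subTt, heckeTn_mul_heckeTt, map_add, map_smul, cornerMap_heckeTt,
        cornerMap_heckeTt, yokGn_mul_yokGt_mul_idem hξ]
      have e : chiOne μ (w.1⁻¹ (lo i)) = chiOne μ (w.1⁻¹ (hi i)) := by
        have h₁ := (young μ).inv_mem w.2
        have h₂ := μ.mem_innerIdx_iff.1 hi'
        exact (h₁ (lo i)).trans (h₂.trans (h₁ (hi i)).symm)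
      congr 3
      simp only [colInd, e, and_true]
    exact LinearMap.congr_fun h y
  have key : ∀ (w : Equiv.Perm (Fin n)) (hw : w ∈ young μ) (y : heckeSub μ),
      subCorner ξ μ (subTt ⟨w, hw⟩ * y) = yokGt d w * subCorner ξ μ y := by
    intro w hw
    have := young_induction (μ := μ) (p := fun w => ∃ hw : w ∈ young μ, ∀ y : heckeSub μ,
      subCorner ξ μ (subTt ⟨w, hw⟩ * y) = yokGt d w * subCorner ξ μ y) ?_ ?_ w hw
    · exact this.2
    · refine ⟨one_mem _, fun y => ?_⟩
      rw [subTt_one, one_mul, yokGt_one, one_mul]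
    · rintro i hi' w hw h ⟨_, ih⟩
      refine ⟨mul_mem (simpleRefl_mem_young hi') hw, fun y => ?_⟩
      have hT : heckeTn i ∈ heckeSub μ := by
        rw [← heckeTt_simpleRefl]
        exact heckeTt_mem_heckeSub (simpleRefl_mem_young hi')
      have e : subTt (⟨simpleRefl i * w, mul_mem (simpleRefl_mem_young hi') hw⟩ : young μ) =
          ⟨heckeTn i, hT⟩ * subTt ⟨w, hw⟩ := by
        apply Subtype.ext
        change heckeTt (simpleRefl i * w) = heckeTn i * heckeTt w
        rw [heckeTn_mul_heckeTt, colInd_of_lt _ h, mul_zero, zero_smul, add_zero]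
      rw [e, mul_assoc, gen i hi' hT, ih, yokGt_simpleRefl_mul h, mul_assoc]
  have h : (subCorner ξ μ).comp (LinearMap.mulRight GroundRing y) =
      (LinearMap.mulRight GroundRing (subCorner ξ μ y)).comp (subCorner ξ μ) := by
    refine LinearMap.ext_on_range span_subTt fun w => ?_
    change subCorner ξ μ (subTt w * y) = subCorner ξ μ (subTt w) * subCorner ξ μ y
    rw [key w.1 w.2, subCorner_subTt, mul_assoc, idem_mul_subCorner hξ]
  exact LinearMap.congr_fun h x

theorem subCorner_one : subCorner ξ μ 1 = idem ξ (chiOne μ) := by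
  rw [← subTt_one, subCorner_subTt, yokGt_one, one_mul]

end Iso

section Phi

variable {d n : ℕ} {ξ : Fin d → ℂ}

/-! ### Orbits of characters -/

/-- `Comp(χ)`: the composition formed by the multiplicities of the values of a character. -/
def compOf (c : Fin n → Fin d) : Comp d n :=
  ⟨fun a => (Finset.univ.filter fun j => c j = a).card, by
    rw [← Finset.card_eq_sum_card_fiberwise (fun _ _ => Finset.mem_coe.2 (Finset.mem_univ _))]
    simp⟩

/-- A character as an element of its orbit. -/
def orbitOf (c : Fin n → Fin d) : Orbit (compOf c) := ⟨c, fun _ => rfl⟩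

theorem compOf_orbit {μ : Comp d n} (i : Orbit μ) : compOf i.1 = μ :=
  Subtype.ext (funext fun a => i.2 a)

/-- A character is the same as a composition together with an element of its orbit. -/
def sigmaOrbitEquiv (d n : ℕ) : (Σ μ : Comp d n, Orbit μ) ≃ (Fin n → Fin d) where
  toFun p := p.2.1
  invFun c := ⟨compOf c, orbitOf c⟩
  left_inv := by
    rintro ⟨μ, i⟩
    have h := compOf_orbit i
    obtain ⟨c, hc⟩ := i
    dsimp only at h
    subst h
    rfl
  right_inv _ := rfl

theorem comp_eq_of_orbit_eq {μ ν : Comp d n} {i : Orbit μ} {k : Orbit ν} (h : i.1 = k.1) :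
    μ = ν := by rw [← compOf_orbit i, ← compOf_orbit k, h]

theorem card_filter_permChar (w : Equiv.Perm (Fin n)) (c : Fin n → Fin d) (a : Fin d) :
    (Finset.univ.filter fun j => permChar w c j = a).card =
      (Finset.univ.filter fun j => c j = a).card := by
  rw [← Fintype.card_subtype, ← Fintype.card_subtype]
  exact Fintype.card_congr (w⁻¹.subtypeEquiv fun j => Iff.rfl)

/-- The element `w(χ)` of the orbit of `χ`. -/
def permOrbit {μ : Comp d n} (w : Equiv.Perm (Fin n)) (i : Orbit μ) : Orbit μ :=
  ⟨permChar w i.1, fun a => by rw [card_filter_permChar, i.2]⟩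

/-! ### The isomorphism with the sum of matrix algebras -/

variable {μ : Comp d n}

/-- The element `g̃_π E_{χ_1} = E_χ g̃_π` for `π = π_χ`, which together with `cornerRight` identifies
the corners of the algebra at `χ_1` and at `χ`. -/
def cornerLeft (ξ : Fin d → ℂ) (i : Orbit μ) : Yok d n :=
  yokGt d (minRep i) * idem ξ (chiOne μ)

/-- The element `g̃_{π⁻¹} E_χ = E_{χ_1} g̃_{π⁻¹}`. -/
def cornerRight (ξ : Fin d → ℂ) (i : Orbit μ) : Yok d n :=
  yokGt d (minRep i)⁻¹ * idem ξ i.1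

theorem idem_mul_cornerLeft (hξ : IsRootEnum ξ) (i : Orbit μ) :
    idem ξ i.1 * cornerLeft ξ i = cornerLeft ξ i := by
  rw [cornerLeft, yokGt_mul_idem hξ, permChar_minRep, ← mul_assoc, idem_mul_self hξ]

theorem idem_mul_cornerRight (hξ : IsRootEnum ξ) (i : Orbit μ) :
    idem ξ (chiOne μ) * cornerRight ξ i = cornerRight ξ i := by
  rw [cornerRight, yokGt_mul_idem hξ, permChar_minRep_inv, ← mul_assoc, idem_mul_self hξ]

theorem cornerRight_mul_idem (hξ : IsRootEnum ξ) (i : Orbit μ) :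
    cornerRight ξ i * idem ξ i.1 = cornerRight ξ i := by
  rw [cornerRight, mul_assoc, idem_mul_self hξ]

theorem cornerRight_mul_cornerLeft (hξ : IsRootEnum ξ) (i : Orbit μ) :
    cornerRight ξ i * cornerLeft ξ i = idem ξ (chiOne μ) := by
  rw [cornerRight, mul_assoc, idem_mul_cornerLeft hξ, cornerLeft,
    yokGt_minRep_inv_mul hξ i (permChar_minRep i), inv_mul_cancel, yokGt_one, one_mul]

theorem cornerLeft_mul_cornerRight (hξ : IsRootEnum ξ) (i : Orbit μ) :
    cornerLeft ξ i * cornerRight ξ i = idem ξ i.1 := by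
  rw [cornerLeft, mul_assoc, idem_mul_cornerRight hξ, cornerRight,
    yokGt_minRep_mul hξ i (permChar_minRep_inv i), mul_inv_cancel, yokGt_one, one_mul]

theorem cornerRight_mul_cornerLeft_of_ne (hξ : IsRootEnum ξ) {ν : Comp d n} {i : Orbit μ}
    {k : Orbit ν} (h : i.1 ≠ k.1) : cornerRight ξ i * cornerLeft ξ k = 0 := by
  rw [← cornerRight_mul_idem hξ, ← idem_mul_cornerLeft hξ k, mul_assoc, ← mul_assoc (idem ξ i.1),
    idem_mul_idem hξ, if_neg h, zero_mul, mul_zero]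

/-- The map `x ↦ x M_{i,j}`, followed by the isomorphism. -/
def phiEntry (ξ : Fin d → ℂ) (i j : Orbit μ) : heckeSub μ →ₗ[GroundRing] Yok d n :=
  (LinearMap.mulLeft GroundRing (cornerLeft ξ i)).comp
    ((LinearMap.mulRight GroundRing (cornerRight ξ j)).comp (subCorner ξ μ))

theorem phiEntry_apply (i j : Orbit μ) (x : heckeSub μ) :
    phiEntry ξ i j x = cornerLeft ξ i * (subCorner ξ μ x * cornerRight ξ j) := rfl

/-- The factors combine to the defining rule of `Φ_n` although the lengths in `π_i w π_j⁻¹` need not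
add. -/
theorem phiEntry_subTt (hξ : IsRootEnum ξ) (i j : Orbit μ) (w : young μ) :
    phiEntry ξ i j (subTt w) = yokGt d (minRep i * w.1 * (minRep j)⁻¹) * idem ξ j.1 := by
  have h₁ : permChar (w.1 * (minRep j)⁻¹) j.1 = chiOne μ := by
    rw [permChar_mul, permChar_minRep_inv, mem_young_iff.1 w.2]
  rw [phiEntry_apply, cornerLeft, mul_assoc, ← mul_assoc (idem ξ _), idem_mul_subCorner hξ,
    subCorner_subTt, mul_assoc (yokGt d w.1), idem_mul_cornerRight hξ, cornerRight,
    yokGt_mul_minRep_inv hξ, yokGt_minRep_mul hξ i h₁, mul_assoc (minRep i)]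

/-- The linear map underlying the isomorphism `Φ_n`. -/
def phiLin (ξ : Fin d → ℂ) : MatAlg d n →ₗ[GroundRing] Yok d n where
  toFun X := ∑ μ : Comp d n, ∑ i : Orbit μ, ∑ j : Orbit μ, phiEntry ξ i j (X μ i j)
  map_add' X Y := by
    simp only [Pi.add_apply, Matrix.add_apply, map_add, Finset.sum_add_distrib]
  map_smul' r X := by
    simp only [Pi.smul_apply, Matrix.smul_apply, map_smul, Finset.smul_sum, RingHom.id_apply]

theorem phiLin_apply (X : MatAlg d n) :
    phiLin ξ X = ∑ μ : Comp d n, ∑ i : Orbit μ, ∑ j : Orbit μ, phiEntry ξ i j (X μ i j) := rfl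

theorem phiLin_single (i j : Orbit μ) (x : heckeSub μ) :
    phiLin ξ (Pi.single μ (Matrix.single i j x)) = phiEntry ξ i j x := by
  rw [phiLin_apply, Finset.sum_eq_single_of_mem μ (Finset.mem_univ _)]
  · rw [Pi.single_eq_same, Finset.sum_eq_single_of_mem i (Finset.mem_univ _),
      Finset.sum_eq_single_of_mem j (Finset.mem_univ _)]
    · rw [Matrix.single_apply_same]
    · intro k _ hk
      rw [Matrix.single_apply_of_col_ne _ _ hk.symm, map_zero]
    · intro k _ hk
      refine Finset.sum_eq_zero fun l _ => ?_
      rw [Matrix.single_apply_of_row_ne hk.symm, map_zero]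
  · intro ν _ hν
    rw [Pi.single_eq_of_ne hν]
    refine Finset.sum_eq_zero fun k _ => Finset.sum_eq_zero fun l _ => ?_
    rw [Matrix.zero_apply, map_zero]

theorem cornerRight_mul_phiLin (hξ : IsRootEnum ξ) (k : Orbit μ) (X : MatAlg d n) :
    cornerRight ξ k * phiLin ξ X = ∑ j : Orbit μ, subCorner ξ μ (X μ k j) * cornerRight ξ j := by
  rw [phiLin_apply, Finset.mul_sum, Finset.sum_eq_single_of_mem μ (Finset.mem_univ _)]
  · rw [Finset.mul_sum, Finset.sum_eq_single_of_mem k (Finset.mem_univ _), Finset.mul_sum]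
    · refine Finset.sum_congr rfl fun j _ => ?_
      rw [phiEntry_apply, ← mul_assoc, cornerRight_mul_cornerLeft hξ, ← mul_assoc,
        idem_mul_subCorner hξ]
    · intro i _ hi'
      rw [Finset.mul_sum]
      refine Finset.sum_eq_zero fun j _ => ?_
      rw [phiEntry_apply, ← mul_assoc, cornerRight_mul_cornerLeft_of_ne hξ, zero_mul]
      exact fun e => hi' (Subtype.ext e.symm)
  · intro ν _ hν
    rw [Finset.mul_sum]
    refine Finset.sum_eq_zero fun i _ => ?_
    rw [Finset.mul_sum]
    refine Finset.sum_eq_zero fun j _ => ?_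
    rw [phiEntry_apply, ← mul_assoc, cornerRight_mul_cornerLeft_of_ne hξ, zero_mul]
    exact fun e => hν (comp_eq_of_orbit_eq e).symm

/-- The entries of a matrix are recovered by cutting its image with the corner elements. -/
theorem cornerRight_mul_phiLin_mul_cornerLeft (hξ : IsRootEnum ξ) (i j : Orbit μ)
    (X : MatAlg d n) :
    cornerRight ξ i * phiLin ξ X * cornerLeft ξ j = subCorner ξ μ (X μ i j) := by
  rw [cornerRight_mul_phiLin hξ, Finset.sum_mul,
    Finset.sum_eq_single_of_mem j (Finset.mem_univ _)]
  · rw [mul_assoc, cornerRight_mul_cornerLeft hξ, subCorner_mul_idem hξ]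
  · intro k _ hk
    rw [mul_assoc, cornerRight_mul_cornerLeft_of_ne hξ, mul_zero]
    exact fun e => hk (Subtype.ext e)

theorem phiLin_injective (hξ : IsRootEnum ξ) : Function.Injective (phiLin (n := n) ξ) := by
  intro X Y h
  funext μ
  refine Matrix.ext fun i j => subCorner_injective hξ ?_
  rw [← cornerRight_mul_phiLin_mul_cornerLeft hξ, h, cornerRight_mul_phiLin_mul_cornerLeft hξ]

theorem phiLin_mul (hξ : IsRootEnum ξ) (X Y : MatAlg d n) :
    phiLin ξ (X * Y) = phiLin ξ X * phiLin ξ Y := by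
  conv_rhs => rw [phiLin_apply X, Finset.sum_mul]
  rw [phiLin_apply]
  refine Finset.sum_congr rfl fun μ _ => ?_
  rw [Finset.sum_mul]
  refine Finset.sum_congr rfl fun i _ => ?_
  rw [Finset.sum_mul]
  have h : ∀ k, phiEntry ξ i k (X μ i k) * phiLin ξ Y =
      ∑ j, phiEntry ξ i j (X μ i k * Y μ k j) := by
    intro k
    rw [phiEntry_apply, mul_assoc, mul_assoc, cornerRight_mul_phiLin hξ, Finset.mul_sum,
      Finset.mul_sum]
    refine Finset.sum_congr rfl fun j _ => ?_
    rw [phiEntry_apply, subCorner_mul hξ, mul_assoc (subCorner ξ μ _)]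
  simp only [h]
  rw [Finset.sum_comm]
  refine Finset.sum_congr rfl fun j _ => ?_
  rw [Pi.mul_apply, Matrix.mul_apply, map_sum]

theorem sum_sum_idem (hξ : IsRootEnum ξ) :
    ∑ μ : Comp d n, ∑ i : Orbit μ, idem ξ i.1 = (1 : Yok d n) := by
  rw [← sum_idem hξ, ← (sigmaOrbitEquiv d n).sum_comp, Fintype.sum_sigma]
  rfl

theorem phiLin_one (hξ : IsRootEnum ξ) : phiLin ξ (1 : MatAlg d n) = 1 := by
  rw [← sum_sum_idem hξ, phiLin_apply]
  refine Finset.sum_congr rfl fun μ _ => Finset.sum_congr rfl fun i _ => ?_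
  rw [Finset.sum_eq_single_of_mem i (Finset.mem_univ _)]
  · rw [Pi.one_apply, Matrix.one_apply_eq, phiEntry_apply, subCorner_one,
      idem_mul_cornerRight hξ, cornerLeft_mul_cornerRight hξ]
  · intro j _ hj
    rw [Pi.one_apply, Matrix.one_apply_ne hj.symm, map_zero]

theorem minRep_inv_mul_mem_young {k j : Orbit μ} {w : Equiv.Perm (Fin n)}
    (h : permChar w j.1 = k.1) : (minRep k)⁻¹ * w * minRep j ∈ young μ := by
  rw [mem_young_iff, permChar_mul, permChar_mul, permChar_minRep, h, permChar_minRep_inv]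

theorem phiLin_single_subTt (hξ : IsRootEnum ξ) {k j : Orbit μ} {w : Equiv.Perm (Fin n)}
    (h : permChar w j.1 = k.1) :
    phiLin ξ (Pi.single μ (Matrix.single k j (subTt ⟨_, minRep_inv_mul_mem_young h⟩))) =
      yokGt d w * idem ξ j.1 := by
  rw [phiLin_single, phiEntry_subTt hξ]
  congr 2
  group

theorem phiLin_surjective (hξ : IsRootEnum ξ) : Function.Surjective (phiLin (n := n) ξ) := by
  rw [← LinearMap.range_eq_top, eq_top_iff, ← span_yokGt_mul_idem hξ, Submodule.span_le]
  rintro _ ⟨⟨w, c⟩, rfl⟩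
  exact ⟨_, phiLin_single_subTt hξ (k := permOrbit w (orbitOf c)) (j := orbitOf c) rfl⟩

/-- The isomorphism `Φ_n`. -/
def phiEquiv (hξ : IsRootEnum ξ) : MatAlg d n ≃ₐ[GroundRing] Yok d n :=
  AlgEquiv.ofBijective (AlgHom.ofLinearMap (phiLin ξ) (phiLin_one hξ) (phiLin_mul hξ))
    ⟨phiLin_injective hξ, phiLin_surjective hξ⟩

theorem phiEquiv_apply (hξ : IsRootEnum ξ) (X : MatAlg d n) : phiEquiv hξ X = phiLin ξ X := rfl

theorem idem_mul_yokGt_eq (hξ : IsRootEnum ξ) {c c' : Fin n → Fin d} {w : Equiv.Perm (Fin n)}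
    (h : permChar w c = c') : idem ξ c' * yokGt d w = yokGt d w * idem ξ c := by
  rw [yokGt_mul_idem hξ, h]

theorem isPhi_phiEquiv (hξ : IsRootEnum ξ) :
    IsPhi ξ (phiEquiv (n := n) hξ).toLinearMap := by
  intro μ i j w hw
  refine ⟨heckeTt_mem_heckeSub hw, ?_⟩
  change phiLin ξ (Pi.single μ (Matrix.single i j (subTt ⟨w, hw⟩))) = _
  have h : permChar (minRep i * w * (minRep j)⁻¹) j.1 = i.1 := by
    rw [permChar_mul, permChar_mul, permChar_minRep_inv, mem_young_iff.1 hw, permChar_minRep]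
  rw [phiLin_single, phiEntry_subTt hξ, idem_mul_yokGt_eq hξ h,
    mul_assoc (yokGt d (minRep i * w * (minRep j)⁻¹)) (idem ξ j.1), idem_mul_self hξ]

/-- A linear map on the sum of matrix algebras is determined by its values on the
`T̃_w M_{i,j}`. -/
theorem matAlg_hom_ext {M : Type*} [AddCommMonoid M] [Module GroundRing M]
    {L L' : MatAlg d n →ₗ[GroundRing] M}
    (h : ∀ (μ : Comp d n) (i j : Orbit μ) (w : young μ),
      L (Pi.single μ (Matrix.single i j (subTt w))) =
        L' (Pi.single μ (Matrix.single i j (subTt w)))) : L = L' := by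
  have key : ∀ (μ : Comp d n) (i j : Orbit μ) (x : heckeSub μ),
      L (Pi.single μ (Matrix.single i j x)) = L' (Pi.single μ (Matrix.single i j x)) := by
    intro μ i j x
    have : (L.comp (LinearMap.single GroundRing MatBlock μ)).comp
        (Matrix.singleLinearMap GroundRing i j) =
        (L'.comp (LinearMap.single GroundRing MatBlock μ)).comp
          (Matrix.singleLinearMap GroundRing i j) :=
      LinearMap.ext_on_range span_subTt fun w => h μ i j w
    exact LinearMap.congr_fun this x
  refine LinearMap.pi_ext fun μ X => ?_
  rw [Matrix.matrix_eq_sum_single X]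
  have e : ∀ Z : MatBlock μ, (Pi.single μ Z : MatAlg d n) =
      LinearMap.single GroundRing MatBlock μ Z := fun _ => rfl
  rw [e]
  simp only [map_sum]
  exact Finset.sum_congr rfl fun i _ => Finset.sum_congr rfl fun j _ => key μ i j _

theorem isPhi_unique {L L' : MatAlg d n →ₗ[GroundRing] Yok d n} (h : IsPhi ξ L)
    (h' : IsPhi ξ L') : L = L' :=
  matAlg_hom_ext fun μ i j w =>
    ((h μ i j w.1 w.2).choose_spec).trans ((h' μ i j w.1 w.2).choose_spec).symm

theorem isPsi_phiEquiv_symm (hξ : IsRootEnum ξ) :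
    IsPsi ξ (phiEquiv (n := n) hξ).symm.toLinearMap := by
  intro μ k j w h
  refine ⟨heckeTt_mem_heckeSub (minRep_inv_mul_mem_young h), ?_⟩
  change (phiEquiv (n := n) hξ).symm (idem ξ k.1 * yokGt d w) = _
  rw [AlgEquiv.symm_apply_eq, phiEquiv_apply, idem_mul_yokGt_eq hξ h]
  exact (phiLin_single_subTt hξ h).symm

theorem isPsi_unique (hξ : IsRootEnum ξ) {L L' : Yok d n →ₗ[GroundRing] MatAlg d n}
    (h : IsPsi ξ L) (h' : IsPsi ξ L') : L = L' := by
  refine LinearMap.ext_on_range (span_yokGt_mul_idem hξ) fun p => ?_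
  have e := idem_mul_yokGt_eq hξ (show permChar p.1 p.2 = (permOrbit p.1 (orbitOf p.2)).1 from rfl)
  rw [← e]
  exact ((h _ (permOrbit p.1 (orbitOf p.2)) (orbitOf p.2) p.1 rfl).choose_spec).trans
    ((h' _ (permOrbit p.1 (orbitOf p.2)) (orbitOf p.2) p.1 rfl).choose_spec).symm

end Phi

/-! ### The embedding `Y_{d,n} → Y_{d,n+1}` on the standard basis -/

section Incl

variable {d n : ℕ} {ξ : Fin d → ℂ}

theorem yokIncl_yokG (i : Fin (n - 1)) : yokIncl d n (yokG d i) = yokG d (extIdx i) := by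
  refine (RingQuot.liftAlgHom_mkAlgHom_apply _ _ _ _).trans ?_
  rw [AlgHom.comp_apply, freeIncl_G]
  rfl

theorem yokIncl_yokT (j : Fin n) : yokIncl d n (yokT d j) = yokT d j.castSucc := by
  refine (RingQuot.liftAlgHom_mkAlgHom_apply _ _ _ _).trans ?_
  rw [AlgHom.comp_apply, freeIncl_T]
  rfl

theorem yokIncl_yokGn (i : Fin (n - 1)) : yokIncl d n (yokGn d i) = yokGn d (extIdx i) := by
  rw [yokGn, map_smul, yokIncl_yokG, yokGn]

theorem yokIncl_yokGt (w : Equiv.Perm (Fin n)) :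
    yokIncl d n (yokGt d w) = yokGt d (extPerm w) := by
  induction w using perm_induction with
  | one => rw [yokGt_one, map_one, extPerm_one, yokGt_one]
  | mul i w h ih =>
    have h' : (extPerm w)⁻¹ (lo (extIdx i)) < (extPerm w)⁻¹ (hi (extIdx i)) := by
      rw [← extPerm_inv, lo_extIdx, hi_extIdx, extPerm_castSucc, extPerm_castSucc]
      exact h
    rw [yokGt_simpleRefl_mul h, map_mul, ih, yokIncl_yokGn, extPerm_mul, extPerm_simpleRefl,
      yokGt_simpleRefl_mul h']

theorem yokIncl_projT (z : ℂ) (j : Fin n) :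
    yokIncl d n (projT GroundRing d z (yokT d j)) =
      projT GroundRing d z (yokT d j.castSucc) := by
  rw [projT, map_smul, map_sum, projT]
  simp only [map_smul, map_pow, yokIncl_yokT]

theorem idem_snoc (c : Fin n → Fin d) (a : Fin d) :
    idem ξ (Fin.snoc (α := fun _ => Fin d) c a) =
      yokIncl d n (idem ξ c) * projT GroundRing d (ξ a) (yokT d (Fin.last n)) := by
  rw [idem_eq, idem_eq, List.ofFn_succ', List.concat_eq_append, List.prod_append, map_list_prod,
    List.map_ofFn]
  simp only [Fin.snoc_castSucc, Fin.snoc_last, List.prod_cons, List.prod_nil, mul_one,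
    Function.comp_def, yokIncl_projT]

theorem yokIncl_idem (hξ : IsRootEnum ξ) (c : Fin n → Fin d) :
    yokIncl d n (idem ξ c) = ∑ a, idem ξ (Fin.snoc (α := fun _ => Fin d) c a) := by
  simp only [idem_snoc]
  rw [← Finset.mul_sum, sum_projT hξ, mul_one]

theorem sum_yokCoord (hξ : IsRootEnum ξ) (y : Yok d n) :
    ∑ c, linearCombination GroundRing (fun w => yokGt d w * idem ξ c) (yokCoord hξ c y) = y := by
  have h : ∑ c, (linearCombination GroundRing fun w => yokGt d w * idem ξ c).comp
      (yokCoord hξ c) = (LinearMap.id : Yok d n →ₗ[GroundRing] Yok d n) := by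
    refine LinearMap.ext_on_range (span_yokGt_mul_idem hξ) fun p => ?_
    rw [LinearMap.sum_apply, Finset.sum_eq_single_of_mem p.2 (Finset.mem_univ _)]
    · rw [LinearMap.comp_apply, yokCoord_yokGt_mul_idem, if_pos rfl]
      simp
    · intro c _ hc
      rw [LinearMap.comp_apply, yokCoord_yokGt_mul_idem, if_neg hc.symm, map_zero]
  have := LinearMap.congr_fun h y
  rwa [LinearMap.sum_apply] at this

/-- The coordinates at an extended character are those at the original character, whatever the new
value is. -/
theorem yokCoord_yokIncl (hξ : IsRootEnum ξ) (c : Fin n → Fin d) (a : Fin d) (y : Yok d n) :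
    yokCoord hξ (Fin.snoc (α := fun _ => Fin d) c a) (yokIncl d n y) =
      mapDomain extPerm (yokCoord hξ c y) := by
  have h : (yokCoord hξ (Fin.snoc (α := fun _ => Fin d) c a)).comp (yokIncl d n).toLinearMap =
      (lmapDomain GroundRing GroundRing extPerm).comp (yokCoord hξ c) := by
    refine LinearMap.ext_on_range (span_yokGt_mul_idem hξ) fun p => ?_
    rw [LinearMap.comp_apply, LinearMap.comp_apply, AlgHom.toLinearMap_apply, map_mul,
      yokIncl_yokGt, yokIncl_idem hξ, Finset.mul_sum, map_sum, yokCoord_yokGt_mul_idem]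
    simp only [yokCoord_yokGt_mul_idem, Fin.snoc_inj]
    by_cases e : p.2 = c
    · simp [e]
    · simp [e]
  exact LinearMap.congr_fun h y

theorem yokIncl_injective (hξ : IsRootEnum ξ) : Function.Injective (yokIncl d n) := by
  intro y y' h
  rw [← sum_yokCoord hξ y, ← sum_yokCoord hξ y']
  refine Finset.sum_congr rfl fun c _ => ?_
  have e := yokCoord_yokIncl hξ c ⟨0, hξ.pos⟩ y
  rw [h, yokCoord_yokIncl hξ] at e
  rw [mapDomain_injective extPerm_injective e]

end Incl

/-! ### The natural embeddings of the parabolic subalgebras -/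

section Kappa

variable {d n : ℕ} {ξ : Fin d → ℂ} (μ : Comp d n) (a : Fin d)

/-- The linear map `H_n → H_{n+1}`, `T̃_w ↦ T̃_{σ⁻¹ w σ}`, where `σ` is the permutation
`shiftPerm μ a`. It need not be multiplicative outside `H^μ`. -/
def heckeEmb : Hecke n →ₗ[GroundRing] Hecke (n + 1) := heckeLift fun w => heckeTt (youngEmb μ a w)

theorem heckeEmb_heckeTt (w : Equiv.Perm (Fin n)) :
    heckeEmb μ a (heckeTt w) = heckeTt (youngEmb μ a w) := heckeLift_heckeTt _ _

theorem heckeEmb_injective : Function.Injective (heckeEmb μ a) := by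
  have h : heckeCoord.comp (heckeEmb μ a) =
      (lmapDomain GroundRing GroundRing (youngEmb μ a)).comp heckeCoord := by
    refine LinearMap.ext_on_range span_heckeTt fun w => ?_
    rw [LinearMap.comp_apply, LinearMap.comp_apply, heckeEmb_heckeTt, heckeCoord_heckeTt,
      heckeCoord_heckeTt, lmapDomain_apply, mapDomain_single]
  intro x y e
  apply heckeCoord_injective
  refine mapDomain_injective (youngEmb_injective μ a) ?_
  have hx := LinearMap.congr_fun h x
  have hy := LinearMap.congr_fun h y
  rw [LinearMap.comp_apply, LinearMap.comp_apply, lmapDomain_apply] at hx hy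
  rw [← hx, ← hy, e]

theorem heckeEmb_mem {x : Hecke n} (hx : x ∈ heckeSub μ) :
    heckeEmb μ a x ∈ heckeSub (μ.incr a) := by
  have h : Submodule.span GroundRing (heckeTt '' (young μ : Set (Equiv.Perm (Fin n)))) ≤
      (Subalgebra.toSubmodule (heckeSub (μ.incr a))).comap (heckeEmb μ a) := by
    rw [Submodule.span_le]
    rintro _ ⟨w, hw, rfl⟩
    change heckeEmb μ a (heckeTt w) ∈ heckeSub (μ.incr a)
    rw [heckeEmb_heckeTt]
    exact heckeTt_mem_heckeSub (youngEmb_mem_young a hw)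
  exact h (heckeSub_le_span hx)

/-- The natural embedding `H^μ → H^{μ^{[a]}}`, as a linear map. -/
def kappaLin : heckeSub μ →ₗ[GroundRing] heckeSub (μ.incr a) :=
  ((heckeEmb μ a).comp (heckeSub μ).val.toLinearMap).codRestrict
    (Subalgebra.toSubmodule (heckeSub (μ.incr a))) fun x => heckeEmb_mem μ a x.2

theorem kappaLin_subTt (w : young μ) :
    kappaLin μ a (subTt w) = subTt ⟨youngEmb μ a w.1, youngEmb_mem_young a w.2⟩ :=
  Subtype.ext (heckeEmb_heckeTt μ a w.1)

theorem kappaLin_injective : Function.Injective (kappaLin μ a) := fun _ _ h =>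
  Subtype.ext (heckeEmb_injective μ a (congrArg Subtype.val h))

/-- The linear map underlying `ι_μ`, `x M_{i,j} ↦ ∑_a x M_{i_a,j_a}`. -/
def iotaLin : MatBlock μ →ₗ[GroundRing] ((a : Fin d) → MatBlock (μ.incr a)) where
  toFun X a := ∑ i : Orbit μ, ∑ j : Orbit μ,
    Matrix.single (i.extend a) (j.extend a) (kappaLin μ a (X i j))
  map_add' X Y := by
    funext a
    simp only [Matrix.add_apply, map_add, Matrix.single_add, Finset.sum_add_distrib, Pi.add_apply]
  map_smul' r X := by
    funext a
    simp only [Matrix.smul_apply, map_smul, Matrix.smul_single, Finset.smul_sum, Pi.smul_apply,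
      RingHom.id_apply]

theorem iotaLin_apply (X : MatBlock μ) : iotaLin μ X a = ∑ i : Orbit μ, ∑ j : Orbit μ,
    Matrix.single (i.extend a) (j.extend a) (kappaLin μ a (X i j)) := rfl

theorem iotaLin_single (i j : Orbit μ) (x : heckeSub μ) :
    iotaLin μ (Matrix.single i j x) a =
      Matrix.single (i.extend a) (j.extend a) (kappaLin μ a x) := by
  rw [iotaLin_apply, Finset.sum_eq_single_of_mem i (Finset.mem_univ _),
    Finset.sum_eq_single_of_mem j (Finset.mem_univ _), Matrix.single_apply_same]
  · intro k _ hk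
    rw [Matrix.single_apply_of_col_ne _ _ hk.symm, map_zero, Matrix.single_zero]
  · intro k _ hk
    refine Finset.sum_eq_zero fun l _ => ?_
    rw [Matrix.single_apply_of_row_ne hk.symm, map_zero, Matrix.single_zero]

theorem Orbit.extend_injective : Function.Injective fun i : Orbit μ => i.extend a := by
  intro i j h
  have h' : Fin.snoc (α := fun _ => Fin d) i.1 a = Fin.snoc (α := fun _ => Fin d) j.1 a :=
    congrArg Subtype.val h
  exact Subtype.ext (Fin.snoc_inj.1 h').1

theorem iotaLin_apply_extend (X : MatBlock μ) (i j : Orbit μ) :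
    iotaLin μ X a (i.extend a) (j.extend a) = kappaLin μ a (X i j) := by
  have hinj := Orbit.extend_injective μ a
  rw [iotaLin_apply, Matrix.sum_apply, Finset.sum_eq_single_of_mem i (Finset.mem_univ _),
    Matrix.sum_apply, Finset.sum_eq_single_of_mem j (Finset.mem_univ _),
    Matrix.single_apply_same]
  · intro k _ hk
    rw [Matrix.single_apply_of_col_ne _ _ fun e => hk (hinj e)]
  · intro k _ hk
    rw [Matrix.sum_apply]
    refine Finset.sum_eq_zero fun l _ => ?_
    rw [Matrix.single_apply_of_row_ne fun e => hk (hinj e)]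

theorem iotaLin_injective (hd : 1 ≤ d) : Function.Injective (iotaLin μ) := by
  intro X Y h
  refine Matrix.ext fun i j => kappaLin_injective μ ⟨0, hd⟩ ?_
  rw [← iotaLin_apply_extend, h, iotaLin_apply_extend]

/-- The sum of the components of `ι_μ`, in the sum of all matrix algebras. -/
def iotaTot : MatBlock μ →ₗ[GroundRing] MatAlg d (n + 1) :=
  ∑ a : Fin d, (LinearMap.single GroundRing MatBlock (μ.incr a)).comp
    ((LinearMap.proj a).comp (iotaLin μ))

theorem iotaTot_eq (X : MatBlock μ) :
    iotaTot μ X = ∑ a : Fin d, Pi.single (μ.incr a) (iotaLin μ X a) := by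
  rw [iotaTot, LinearMap.sum_apply]
  rfl

theorem iotaTot_apply_incr (X : MatBlock μ) : iotaTot μ X (μ.incr a) = iotaLin μ X a := by
  rw [iotaTot_eq, Finset.sum_apply, Finset.sum_eq_single_of_mem a (Finset.mem_univ _),
    Pi.single_eq_same]
  intro b _ hb
  exact Pi.single_eq_of_ne (fun e => hb (Comp.incr_injective μ e).symm) _

variable {μ}

/-- The embedding of the Yokonuma--Hecke algebras, computed on the `T̃_w M_{i,j}`. -/
theorem phiLin_iotaTot_single (hξ : IsRootEnum ξ) (i j : Orbit μ) (w : young μ) :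
    phiLin ξ (iotaTot μ (Matrix.single i j (subTt w))) =
      yokIncl d n (phiLin ξ (Pi.single μ (Matrix.single i j (subTt w)))) := by
  rw [phiLin_single, phiEntry_subTt hξ, map_mul, yokIncl_yokGt, yokIncl_idem hξ, Finset.mul_sum,
    iotaTot_eq, map_sum]
  refine Finset.sum_congr rfl fun a _ => ?_
  rw [iotaLin_single, kappaLin_subTt, phiLin_single, phiEntry_subTt hξ]
  have e : minRep (i.extend a) * youngEmb μ a w.1 * (minRep (j.extend a))⁻¹ =
      extPerm (minRep i * w.1 * (minRep j)⁻¹) := by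
    rw [← youngEmb_eq a i j]
    group
  rw [e]
  rfl

theorem phiLin_iotaTot (hξ : IsRootEnum ξ) (X : MatBlock μ) :
    phiLin ξ (iotaTot μ X) = yokIncl d n (phiLin ξ (Pi.single μ X)) := by
  have key : ∀ (i j : Orbit μ) (x : heckeSub μ),
      phiLin ξ (iotaTot μ (Matrix.single i j x)) =
        yokIncl d n (phiLin ξ (Pi.single μ (Matrix.single i j x))) := by
    intro i j x
    have : ((phiLin ξ).comp (iotaTot μ)).comp (Matrix.singleLinearMap GroundRing i j) =
        (((yokIncl d n).toLinearMap.comp (phiLin ξ)).comp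
          (LinearMap.single GroundRing MatBlock μ)).comp
            (Matrix.singleLinearMap GroundRing i j) :=
      LinearMap.ext_on_range span_subTt fun w => phiLin_iotaTot_single hξ i j w
    exact LinearMap.congr_fun this x
  have : (phiLin ξ).comp (iotaTot μ) =
      ((yokIncl d n).toLinearMap.comp (phiLin ξ)).comp
          (LinearMap.single GroundRing MatBlock μ) :=
    Matrix.ext_linearMap GroundRing fun i j => LinearMap.ext fun x => key i j x
  exact LinearMap.congr_fun this X

/-- The isomorphism `Φ_{n+1}` is injective, and turns `ι_μ` into the multiplicative map
`Y_{d,n} → Y_{d,n+1}`. -/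
theorem iotaTot_mul (hξ : IsRootEnum ξ) (X Y : MatBlock μ) :
    iotaTot μ (X * Y) = iotaTot μ X * iotaTot μ Y := by
  apply phiLin_injective hξ
  rw [phiLin_mul hξ, phiLin_iotaTot hξ, phiLin_iotaTot hξ, phiLin_iotaTot hξ, ← map_mul,
    ← phiLin_mul hξ, Pi.single_mul]

theorem iotaLin_mul (hξ : IsRootEnum ξ) (X Y : MatBlock μ) :
    iotaLin μ (X * Y) = iotaLin μ X * iotaLin μ Y := by
  funext a
  rw [← iotaTot_apply_incr, iotaTot_mul hξ, Pi.mul_apply, iotaTot_apply_incr, iotaTot_apply_incr,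
    Pi.mul_apply]

/-- The multiplicativity of the natural embedding is read off from one diagonal entry of `ι_μ`. -/
theorem kappaLin_mul (hξ : IsRootEnum ξ) (x y : heckeSub μ) :
    kappaLin μ a (x * y) = kappaLin μ a x * kappaLin μ a y := by
  have h := congrFun (iotaLin_mul hξ (Matrix.single (orbitOne μ) (orbitOne μ) x)
    (Matrix.single (orbitOne μ) (orbitOne μ) y)) a
  rw [Matrix.single_mul_single_same, Pi.mul_apply, iotaLin_single, iotaLin_single,
    iotaLin_single, Matrix.single_mul_single_same] at h
  have h' := congrFun (congrFun h ((orbitOne μ).extend a)) ((orbitOne μ).extend a)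
  rwa [Matrix.single_apply_same, Matrix.single_apply_same] at h'

theorem kappaLin_one : kappaLin μ a 1 = 1 := by
  rw [← subTt_one, kappaLin_subTt, ← subTt_one]
  simp only [youngEmb_one]

/-- The natural embedding `H^μ → H^{μ^{[a]}}`. -/
def kappa (hξ : IsRootEnum ξ) (μ : Comp d n) (a : Fin d) :
    heckeSub μ →ₐ[GroundRing] heckeSub (μ.incr a) :=
  AlgHom.ofLinearMap (kappaLin μ a) (kappaLin_one a) (kappaLin_mul a hξ)

theorem kappa_apply (hξ : IsRootEnum ξ) (x : heckeSub μ) : kappa hξ μ a x = kappaLin μ a x := rfl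

/-- The morphism `ι_μ`. -/
def iota (hξ : IsRootEnum ξ) (μ : Comp d n) :
    MatBlock μ →ₙₐ[GroundRing] ((a : Fin d) → MatBlock (μ.incr a)) :=
  { iotaLin μ with
    map_zero' := map_zero (iotaLin μ)
    map_mul' := iotaLin_mul hξ }

theorem iota_apply (hξ : IsRootEnum ξ) (X : MatBlock μ) : iota hξ μ X = iotaLin μ X := rfl

theorem isNaturalEmbedding_kappa (hξ : IsRootEnum ξ) :
    IsNaturalEmbedding μ (μ.incr a) (kappa hξ μ a) := by
  intro b r hr i i' hi₁ hi' x hx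
  have hin : i ∈ μ.innerIdx := by
    rw [μ.mem_innerIdx_iff]
    rw [(μ.block_eq_iff (b := b)).2 (by simp only [lo]; omega),
      (μ.block_eq_iff (b := b)).2 (by simp only [hi]; omega)]
  have e : x = u • subTt ⟨simpleRefl i, simpleRefl_mem_young hin⟩ := by
    apply Subtype.ext
    rw [hx, heckeT_eq, ← heckeTt_simpleRefl]
    rfl
  rw [e, map_smul, kappa_apply, kappaLin_subTt, heckeT_eq, ← heckeTt_simpleRefl,
    ← youngEmb_simpleRefl μ a b r hr i i' hi₁ hi']
  rfl

theorem isNaturalEmbedding_unique {f f' : heckeSub μ →ₐ[GroundRing] heckeSub (μ.incr a)}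
    (hf : IsNaturalEmbedding μ (μ.incr a) f) (hf' : IsNaturalEmbedding μ (μ.incr a) f') :
    f = f' := by
  refine AlgHom.adjoin_ext fun x hx => Subtype.ext ?_
  obtain ⟨i, hi, rfl⟩ := hx
  obtain ⟨b, r, hr, hi'⟩ := μ.exists_of_mem_innerIdx hi
  have hb : μ.1 b ≤ (μ.incr a).1 b := Nat.le_add_right _ _
  have hs := (μ.incr a).start_add_le b
  have e : ((⟨(μ.incr a).start b + r, by omega⟩ : Fin (n + 1 - 1)) : ℕ) =
    (μ.incr a).start b + r := rfl
  exact (hf b r hr i _ hi' e _ rfl).trans (hf' b r hr i _ hi' e _ rfl).symm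

end Kappa

end YokonumaHecke

end

theorem proposition3p2 (d n : ℕ) (hd : 1 ≤ d) (hn : 1 ≤ n)
    (ξ : Fin d → ℂ) (hξ_inj : Function.Injective ξ)
    (hξ_range : ∀ z : ℂ, z ∈ Set.range ξ ↔ z ^ d = 1) :
    ∃ (Φ : MatAlg d n ≃ₐ[GroundRing] Yok d n)
      (Φ' : MatAlg d (n + 1) ≃ₐ[GroundRing] Yok d (n + 1))
      (κ : ∀ (μ : Comp d n) (a : Fin d), heckeSub μ →ₐ[GroundRing] heckeSub (μ.incr a))
      (ι : ∀ μ : Comp d n, MatBlock μ →ₙₐ[GroundRing] ((a : Fin d) → MatBlock (μ.incr a))),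
      -- `Φ = Φ_n` is the linear map of the defining rule, and its inverse is `Ψ_n`
      IsPhi ξ Φ.toLinearMap ∧ (∀ L, IsPhi ξ L → L = Φ.toLinearMap) ∧
      IsPsi ξ Φ.symm.toLinearMap ∧ (∀ L, IsPsi ξ L → L = Φ.symm.toLinearMap) ∧
      -- `Φ' = Φ_{n+1}` is the linear map of the defining rule, and its inverse is `Ψ_{n+1}`
      IsPhi ξ Φ'.toLinearMap ∧ (∀ L, IsPhi ξ L → L = Φ'.toLinearMap) ∧
      IsPsi ξ Φ'.symm.toLinearMap ∧ (∀ L, IsPsi ξ L → L = Φ'.symm.toLinearMap) ∧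
      -- `κ μ a` is the natural embedding of `H^μ` into `H^{μ^{[a]}}`
      (∀ μ a, IsNaturalEmbedding μ (μ.incr a) (κ μ a) ∧ Function.Injective (κ μ a) ∧
        ∀ f, IsNaturalEmbedding μ (μ.incr a) f → f = κ μ a) ∧
      -- `Y_{d,n}` embeds into `Y_{d,n+1}`
      Function.Injective (yokIncl d n) ∧
      -- the injective morphisms `ι_μ` : `x M_{i,j} ↦ ∑_a x M_{i_a,j_a}`
      (∀ μ, Function.Injective (ι μ)) ∧
      (∀ (μ : Comp d n) (x : heckeSub μ) (i j : Orbit μ),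
        ι μ (Matrix.single i j x) =
          ∑ a : Fin d, Pi.single a (Matrix.single (i.extend a) (j.extend a) (κ μ a x))) ∧
      -- the embedding `Ψ_{n+1} ∘ (Y_{d,n} ⊂ Y_{d,n+1}) ∘ Φ_n` is the direct sum of the `ι_μ`
      (∀ X : MatAlg d n,
        Φ'.symm (yokIncl d n (Φ X)) =
          ∑ μ : Comp d n, ∑ a : Fin d, Pi.single (μ.incr a) (ι μ (X μ) a)) := by
  have hξ : IsRootEnum ξ := ⟨hd, hξ_inj, hξ_range⟩
  refine ⟨phiEquiv hξ, phiEquiv hξ, kappa hξ, iota hξ, isPhi_phiEquiv hξ,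
    fun L h => isPhi_unique h (isPhi_phiEquiv hξ), isPsi_phiEquiv_symm hξ,
    fun L h => isPsi_unique hξ h (isPsi_phiEquiv_symm hξ), isPhi_phiEquiv hξ,
    fun L h => isPhi_unique h (isPhi_phiEquiv hξ), isPsi_phiEquiv_symm hξ,
    fun L h => isPsi_unique hξ h (isPsi_phiEquiv_symm hξ),
    fun μ a => ⟨isNaturalEmbedding_kappa a hξ, kappaLin_injective μ a,
      fun f hf => isNaturalEmbedding_unique a hf (isNaturalEmbedding_kappa a hξ)⟩,
    yokIncl_injective hξ, fun μ => iotaLin_injective μ hd, fun μ x i j => ?_, fun X => ?_⟩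
  · funext b
    rw [iota_apply, iotaLin_single, Finset.sum_apply,
      Finset.sum_eq_single_of_mem b (Finset.mem_univ _), Pi.single_eq_same, kappa_apply]
    intro a _ ha
    exact Pi.single_eq_of_ne ha.symm _
  · rw [AlgEquiv.symm_apply_eq, phiEquiv_apply, phiEquiv_apply]
    conv_lhs => rw [← Finset.univ_sum_single X, map_sum, map_sum]
    rw [map_sum]
    refine Finset.sum_congr rfl fun μ _ => ?_
    rw [← phiLin_iotaTot hξ, iotaTot_eq]
    rfl
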